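/- **Theorem (maintaining strong components via topological search takes $O(n^{5/2})$ time).** Consider a directed graph with a fixed vertex set of $n \ge 1$ vertices, initially without arcs, to which pairwise distinct arcs $(v_1,w_1),\dots,(v_m,w_m)$ are added one at a time. The *graph of strong components* has the strong components as vertices and an arc $(X,Y)$ whenever $X\neq Y$ and some arc of the graph leads from $X$ to $Y$. The algorithm stores the partition of the vertices into strong components in a disjoint set structure (trees, union by rank, path compression) that answers the query $\mathit{find}(v)$, written $f(v)$, with the canonical vertex of the component of $v$; arrays $\mathit{vertex}$ and $\mathit{position}$ that number the canonical vertices consecutively from $1$ (we write $x<y$ if $\mathit{position}(x)<\mathit{position}(y)$); and an adjacency matrix $A$ of the graph of strong components, indexed by canonical vertices. Initially $A=0$, all components are singletons, and the numbering is arbitrary. An arc $(v,w)$ is added as follows. 1. If $f(v)\ne f(w)$, set $A(f(v),f(w))=1$. If not $f(v)>f(w)$, stop. 2. (Search.) Let $F$ and $B$ be queues containing $f(w)$ and $f(v)$ respectively; let $i=\mathit{position}(f(w))$, $j=\mathit{position}(f(v))$, and set $\mathit{vertex}(i)=\mathit{vertex}(j)=$ null. Alternately (a) increase $i$ by one, and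 further while $i<j$ and no $u\in F$ has $A(u,\mathit{vertex}(i))=1$; if $i=j$ end the search, otherwise move $\mathit{vertex}(i)$ to the back of $F$ and set $\mathit{vertex}(i)=$ null; and (b) decrease $j$ by one, and further while $i<j$ and no $z\in B$ has $A(\mathit{vertex}(j),z)=1$; if $i=j$ end the search, otherwise move $\mathit{vertex}(j)$ to the back of $B$ and set $\mathit{vertex}(j)=$ null. Let $k$ be the common final value of $i$ and $j$. 3. (New component.) Find the set of old canonical vertices contained in the new component, if any, in the graph with vertex set $F\cup B$ and arcs the pairs $(x,y)$ with $A(x,y)=1$, by a depth-first search from $f(w)$ that marks $f(v)$ when it is reached and marks $x$ when retreating along an arc $(x,y)$ with $y$ marked; there is a new component if and only if $f(w)$ becomes marked, and then it consists of the marked vertices. 4. (Reordering.) For $i=k,k+1,\dots$ while $F$ is nonempty: if $\mathit{vertex}(i)$ is not null and $A(u,\mathit{vertex}(i))=1$ for some $u\in F$, move $\mathit{vertex}(i)$ to the back of $F$ and set $\mathit{vertex}(i)=$ null; then, if $\mathit{vertex}(i)$ is null, put the front element of $F$ there and remove it from $F$. Symmetrically, for $j=k-1,k-2,\dots$ while $B$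 is nonempty, with the test $A(\mathit{vertex}(j),z)=1$ for some $z\in B$. 5. If there is a new component, make $\mathit{vertex}(k)$ its canonical vertex, unite the sets of the old components contained in it, combine their rows and columns of $A$, delete the vertices that are no longer canonical from the order, and number the remaining ones consecutively from $1$. Time is measured on a random-access machine, with one unit for each array access and each loop iteration. *Claim.* There is an absolute constant $C$ such that, for every $n\ge1$, every initial numbering and every sequence of distinct arcs, every operation of the algorithm terminates, and * after initialization and after each arc addition, $f(v)$ is a vertex of the strong component of $v$ in the current graph for every $v$, $f(v)=f(w)$ whenever $v$ and $w$ are in the same strong component, the list $\mathit{vertex}(1),\dots,\mathit{vertex}(N)$ contains each canonical vertex exactly once ($\mathit{position}$ being the inverse map), and it is a topological order of the graph of strong components: for every arc $(X,Y)$ of that graph the canonical vertex of $X$ precedes that of $Y$; * the total time of the initialization and of all $m$ arc additions is at most $C\,n^{5/2}$. -/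

import Mathlib

/-! # A random-access machine with a clock

The memory of the machine consists of finitely many named arrays of words, a two-dimensional
array `adj`, and a clock.  A program is a partial state transformer (programs need not terminate).
One unit of time is charged for every array access and for every iteration of a loop; the bounded
number of comparisons and additions of words done between two charged operations is absorbed in
the constant factor.  The local variables of a program hold a bounded number of words. -/

/-- The names of the one-dimensional arrays. -/
inductive Arr
  /-- `position x`: the number of the canonical vertex `x` in the order (numbers start at `1`) -/
  | position
  /-- `vertex i`: the canonical vertex with number `i`, or null -/
  | vertex
  /-- cell `0` holds the number of canonical vertices -/
  | count
  /-- disjoint sets: parent in the tree (a root is its own parent) -/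
  | parent
  /-- disjoint sets: rank of a root -/
  | rank
  /-- disjoint sets: the canonical vertex of the set, stored at the root -/
  | canon
  /-- the queue `F` of the forward search -/
  | fwd
  /-- the queue `B` of the backward search -/
  | bwd
  /-- the list `X` of the vertices of `F` and `B` at the end of the search -/
  | found
  /-- stack of the depth-first search -/
  | stack
  /-- depth-first search: `next x` is the index in `found` of the next vertex to try from `x` -/
  | next
  /-- depth-first search: `1` if reached, `0` if not -/
  | visited
  /-- depth-first search: `1` if marked as belonging to the new component, `0` if not -/
  | mark
  deriving DecidableEq

/-- The memory of the machine. -/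
structure Mem where
  arr : Arr → ℕ → ℕ
  adj : ℕ → ℕ → ℕ
  clock : ℕ

/-- Programs that return a value of type `α`. -/
abbrev RAM (α : Type) : Type := StateT Mem Part α

namespace RAM

/-- Spend one unit of time. -/
def tick : RAM Unit :=
  modify fun s => { s with clock := s.clock + 1 }

/-- Read the cell `a[i]`. -/
def read (a : Arr) (i : ℕ) : RAM ℕ := do
  tick
  return (← get).arr a i

/-- Write `x` into the cell `a[i]`. -/
def write (a : Arr) (i x : ℕ) : RAM Unit := do
  tick
  modify fun s => { s with arr := Function.update s.arr a (Function.update (s.arr a) i x) }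

/-- Read the matrix entry `A(x, y)`. -/
def readAdj (x y : ℕ) : RAM ℕ := do
  tick
  return (← get).adj x y

/-- Write `b` into the matrix entry `A(x, y)`. -/
def writeAdj (x y b : ℕ) : RAM Unit := do
  tick
  modify fun s => { s with adj := Function.update s.adj x (Function.update (s.adj x) y b) }

/-- One iteration of a loop, as a partial function on the loop variables and the memory. -/
def loopStep {α β : Type} (body : β → RAM (α ⊕ β)) : β × Mem →. (α × Mem) ⊕ (β × Mem) := fun c =>
  ((do tick; body c.1 : RAM (α ⊕ β)).run c.2).map fun r =>
    match r.1 with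
    | Sum.inl a => Sum.inl (a, r.2)
    | Sum.inr b' => Sum.inr (b', r.2)

/-- Unbounded iteration: the body either stops with a result (`Sum.inl`) or continues with new
values of the loop variables (`Sum.inr`). Undefined if the iteration does not stop. -/
noncomputable def loop {α β : Type} (body : β → RAM (α ⊕ β)) (b : β) : RAM α :=
  StateT.mk fun s => (loopStep body).fix (b, s)

/-- Execute `body 0`, …, `body (k - 1)` in this order. -/
def forRange : ℕ → (ℕ → RAM Unit) → RAM Unit
  | 0, _ => pure ()
  | k + 1, body => do
    forRange k body
    tick
    body k

end RAM

/-! # Maintaining strong components by topological search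

The vertices are the numbers `0, …, n - 1`, and the number `n` is used as null. -/

namespace TopSearch

open RAM

/-! ## Disjoint sets: trees with path compression and union by rank -/

/-- The root of the tree containing `v`, with path compression. -/
noncomputable def findRoot (v : ℕ) : RAM ℕ := do
  let r ← loop (fun u => do
    let p ← read .parent u
    if p = u then return Sum.inl u else return Sum.inr p) v
  loop (fun u => do
    if u = r then return Sum.inl r
    else
      let p ← read .parent u
      write .parent u r
      return Sum.inr p) v

/-- The query `find(v)`: the canonical vertex of the set containing `v`. -/
noncomputable def find (v : ℕ) : RAM ℕ := do
  let r ← findRoot v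
  read .canon r

/-- `unite(x, y)`: unite the sets with the (different) canonical vertices `x` and `y`,
making `x` the canonical vertex of the union. -/
noncomputable def unite (x y : ℕ) : RAM Unit := do
  let rx ← findRoot x
  let ry ← findRoot y
  let kx ← read .rank rx
  let ky ← read .rank ry
  if kx < ky then
    write .parent rx ry
    write .canon ry x
  else
    write .parent ry rx
    write .canon rx x
    if kx = ky then write .rank rx (kx + 1)

/-! ## The search -/

/-- Is there an arc from some `u` in `F` to `x`?  Here `F` occupies the cells `lo, …, hi - 1`. -/
noncomputable def arcFromF (lo hi x : ℕ) : RAM Bool :=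
  loop (fun t => do
    if t < hi then
      let u ← read .fwd t
      let b ← readAdj u x
      if b = 1 then return Sum.inl true else return Sum.inr (t + 1)
    else return Sum.inl false) lo

/-- Is there an arc from `x` to some `z` in `B`?  Here `B` occupies the cells `lo, …, hi - 1`. -/
noncomputable def arcToB (lo hi x : ℕ) : RAM Bool :=
  loop (fun t => do
    if t < hi then
      let z ← read .bwd t
      let b ← readAdj x z
      if b = 1 then return Sum.inl true else return Sum.inr (t + 1)
    else return Sum.inl false) lo

/-- Increase `i` while `i < j` and there is no arc from `F` to `vertex(i)`. -/
noncomputable def scanUp (i j tF : ℕ) : RAM ℕ :=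
  loop (fun i => do
    if i < j then
      let x ← read .vertex i
      let hit ← arcFromF 0 tF x
      if hit then return Sum.inl i else return Sum.inr (i + 1)
    else return Sum.inl i) i

/-- Decrease `j` while `i < j` and there is no arc from `vertex(j)` to `B`. -/
noncomputable def scanDown (i j tB : ℕ) : RAM ℕ :=
  loop (fun j => do
    if i < j then
      let x ← read .vertex j
      let hit ← arcToB 0 tB x
      if hit then return Sum.inl j else return Sum.inr (j - 1)
    else return Sum.inl j) j

/-- The two-way search of the order, forward from `w` and backward from `v`.
It returns the common final value of `i` and `j`, and the final sizes of `F` and `B`. -/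
noncomputable def topologicalSearch (n v w : ℕ) : RAM (ℕ × ℕ × ℕ) := do
  write .fwd 0 w
  write .bwd 0 v
  let i ← read .position w
  let j ← read .position v
  write .vertex i n
  write .vertex j n
  loop (fun (c : ℕ × ℕ × ℕ × ℕ) => do
    let (i, j, tF, tB) := c
    let i ← scanUp (i + 1) j tF
    if i = j then return Sum.inl (i, tF, tB)
    else
      let x ← read .vertex i
      write .fwd tF x
      write .vertex i n
      let j ← scanDown i (j - 1) tB
      if i = j then return Sum.inl (i, tF + 1, tB)
      else
        let y ← read .vertex j
        write .bwd tB y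
        write .vertex j n
        return Sum.inr (i, j, tF + 1, tB + 1)) (i, j, 1, 1)

/-! ## Finding the new component -/

/-- List the vertices of `F` and `B` in `found`; make them unreached and unmarked. -/
def collect (tF tB : ℕ) : RAM Unit := do
  forRange tF (fun t => do
    let x ← read .fwd t
    write .found t x)
  forRange tB (fun t => do
    let x ← read .bwd t
    write .found (tF + t) x)
  forRange (tF + tB) (fun t => do
    let x ← read .found t
    write .visited x 0
    write .mark x 0
    write .next x 0)

/-- Depth-first search from `w` along the arcs between the first `size` vertices of `found`.
The vertex `v` is marked when it is reached, and when the search retreats along an arc `(u, x)`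
with `x` marked, `u` is marked.  The result tells whether there is a new component, in which case
the marked vertices are the old canonical vertices contained in it. -/
noncomputable def findComponent (size v w : ℕ) : RAM Bool := do
  write .visited w 1
  write .stack 0 w
  loop (fun h => do
    if h = 0 then return Sum.inl ()
    else
      let u ← read .stack (h - 1)
      let t ← read .next u
      if t < size then
        write .next u (t + 1)
        let x ← read .found t
        let b ← readAdj u x
        if b = 1 then
          let seen ← read .visited x
          if seen = 1 then
            let m ← read .mark x
            if m = 1 then write .mark u 1
            return Sum.inr h
          else
            write .visited x 1
            if x = v then write .mark x 1
            write .stack h x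
            return Sum.inr (h + 1)
        else return Sum.inr h
      else
        if 1 < h then
          let m ← read .mark u
          let p ← read .stack (h - 2)
          if m = 1 then write .mark p 1
        return Sum.inr (h - 1)) 1
  let m ← read .mark w
  return m == 1

/-! ## Reordering -/

/-- Reinsert the vertices of `F` at positions `k, k + 1, …`.  The loop variables are the position
`i` and the bounds of the queue `F`, which occupies the cells `hF, …, tF - 1`. -/
noncomputable def reorderForward (n k tF : ℕ) : RAM Unit :=
  loop (fun (c : ℕ × ℕ × ℕ) => do
    let (i, hF, tF) := c
    if hF < tF then
      let x ← read .vertex i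
      let hit ← if x ≠ n then arcFromF hF tF x else pure false
      if hit then
        write .fwd tF x
        write .vertex i n
      let tF := if hit then tF + 1 else tF
      let x ← read .vertex i
      if x = n then
        let z ← read .fwd hF
        write .vertex i z
        write .position z i
        return Sum.inr (i + 1, hF + 1, tF)
      else return Sum.inr (i + 1, hF, tF)
    else return Sum.inl ()) (k, 0, tF)

/-- Reinsert the vertices of `B` at positions `k - 1, k - 2, …`. -/
noncomputable def reorderBackward (n k tB : ℕ) : RAM Unit :=
  loop (fun (c : ℕ × ℕ × ℕ) => do
    let (j, hB, tB) := c
    if hB < tB then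
      let j := j - 1
      let x ← read .vertex j
      let hit ← if x ≠ n then arcToB hB tB x else pure false
      if hit then
        write .bwd tB x
        write .vertex j n
      let tB := if hit then tB + 1 else tB
      let x ← read .vertex j
      if x = n then
        let z ← read .bwd hB
        write .vertex j z
        write .position z j
        return Sum.inr (j, hB + 1, tB)
      else return Sum.inr (j, hB, tB)
    else return Sum.inl ()) (k, 0, tB)

/-! ## Forming the new component -/

/-- Add row `x` of the matrix to row `c`, add column `x` to column `c`, and clear row and
column `x`. -/
def combine (n c x : ℕ) : RAM Unit :=
  forRange n (fun y => do
    let b ← readAdj x y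
    if b = 1 then
      writeAdj c y 1
      writeAdj x y 0
    let b ← readAdj y x
    if b = 1 then
      writeAdj y c 1
      writeAdj y x 0)

/-- Number the vertices remaining in the order consecutively from `1`. -/
noncomputable def renumber (n : ℕ) : RAM Unit := do
  let N ← read .count 0
  let k ← loop (fun (c : ℕ × ℕ) => do
    let (i, k) := c
    if i ≤ N then
      let x ← read .vertex i
      if x = n then return Sum.inr (i + 1, k)
      else
        write .vertex i n
        write .vertex (k + 1) x
        write .position x (k + 1)
        return Sum.inr (i + 1, k + 1)
    else return Sum.inl k) (1, 0)
  write .count 0 k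

/-- Combine the old components whose canonical vertices are the marked vertices among the first
`size` vertices of `found` into one component with the canonical vertex `c`; delete the vertices
that are no longer canonical from the order. -/
noncomputable def formComponent (n size c : ℕ) : RAM Unit := do
  forRange size (fun t => do
    let x ← read .found t
    let m ← read .mark x
    if m = 1 ∧ x ≠ c then
      unite c x
      combine n c x
      let p ← read .position x
      write .vertex p n)
  writeAdj c c 0
  renumber n

/-! ## The two operations of the algorithm -/

/-- Initialization: no arcs, singleton components, and the arbitrary numbering in which
`init 0, …, init (n - 1)` have the numbers `1, …, n`. -/
def setup (n : ℕ) (init : Fin n → Fin n) : RAM Unit := do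
  forRange n (fun x => forRange n (fun y => writeAdj x y 0))
  forRange n (fun x => do
    write .parent x x
    write .rank x 0
    write .canon x x)
  forRange n (fun i => do
    if h : i < n then
      write .vertex (i + 1) (init ⟨i, h⟩)
      write .position (init ⟨i, h⟩) (i + 1))
  write .count 0 n

/-- Addition of the arc `(v, w)`. -/
noncomputable def addArc (n v w : ℕ) : RAM Unit := do
  let x ← find v
  let y ← find w
  if x ≠ y then
    writeAdj x y 1
    let px ← read .position x
    let py ← read .position y
    if py < px then
      let (k, tF, tB) ← topologicalSearch n x y
      collect tF tB
      let new ← findComponent (tF + tB) x y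
      reorderForward n k tF
      reorderBackward n k tB
      if new then
        let c ← read .vertex k
        formComponent n (tF + tB) c

end TopSearch

/-! # Strong components and the specification -/

section Spec

variable {n : ℕ}

/-- `w` is reachable from `v` in the directed graph with the given arcs. -/
def Reachable (arcs : List (Fin n × Fin n)) (v w : Fin n) : Prop :=
  Relation.ReflTransGen (fun a b => (a, b) ∈ arcs) v w

/-- The vertex set of the strong component of `v`. -/
def strongComponent (arcs : List (Fin n × Fin n)) (v : Fin n) : Set (Fin n) :=
  {w | Reachable arcs v w ∧ Reachable arcs w v}

/-- The arcs of the graph of strong components. -/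
def ComponentArc (arcs : List (Fin n × Fin n)) (X Y : Set (Fin n)) : Prop :=
  X ≠ Y ∧ ∃ x ∈ X, ∃ y ∈ Y, (x, y) ∈ arcs

/-- The memory `s` correctly represents the strong components of the graph with the given arcs
and a topological order of them: the query `find` returns a canonical vertex `f v` of the
component of `v`; `vertex(1), …, vertex(N)` lists the canonical vertices, each once, with inverse
`position`, where `N` is the stored number of canonical vertices; and the listed order is a
topological order of the graph of strong components. -/
def Represents (arcs : List (Fin n × Fin n)) (s : Mem) : Prop :=
  ∃ f : Fin n → Fin n,
    (∀ v : Fin n, ∃ s', ((f v : ℕ), s') ∈ (TopSearch.find v).run s) ∧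
    (∀ v : Fin n, f v ∈ strongComponent arcs v) ∧
    (∀ v w : Fin n, strongComponent arcs v = strongComponent arcs w → f v = f w) ∧
    (∀ v : Fin n, 1 ≤ s.arr .position (f v) ∧ s.arr .position (f v) ≤ s.arr .count 0 ∧
      s.arr .vertex (s.arr .position (f v)) = f v) ∧
    (∀ i, 1 ≤ i → i ≤ s.arr .count 0 →
      ∃ v : Fin n, s.arr .vertex i = f v ∧ s.arr .position (f v) = i) ∧
    (∀ v w : Fin n, ComponentArc arcs (strongComponent arcs v) (strongComponent arcs w) →
      s.arr .position (f v) < s.arr .position (f w))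

end Spec

/-! Each program gets a total-correctness rule in terms of `wp`, so that termination, correctness
and running time are proved together.

Correctness. `Invariant` says that the matrix is the loop-free quotient of the arcs by the canonical
map and that positions increase along its entries. Suppose a new arc from `v` to `w` violates the
order, and let `k` be the position at which the search ends. `F` consists of vertices reached from
`w` and `B` of vertices reaching `v`; below `k`, `F` is closed under forward arcs, and above `k`,
`B` is closed under backward arcs. Reordering puts `F` at `k` and above and `B` below `k`, both in
queue order, and takes along the vertices that would otherwise be overtaken. Every arc then points
forward, except arcs from a searched vertex of `F` to one of `B` (`Reordered.lt_of_arc`), and these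
close a cycle through the new arc. If there is no cycle, the new order is topological. Otherwise the
vertices on cycles are contracted into `w`, which sits at `k` (`Reordered.pos_w`); arcs leaving them
end after `k` and arcs entering them start before `k` (`Reordered.lt_of_onCycle_left`,
`Reordered.lt_of_onCycle_right`).

Cost of one addition. Let `D` be the total distance by which vertices move up in the reordering; it
equals the total distance moved down. Search, depth-first search and reinsertion take time `O(D +
1)` (`Reordered.cost_le`). Forming a component takes `O(n)` for each canonical vertex that
disappears, hence `O(n^2)` altogether. Queries take `O(log n)`, and distinctness leaves at most
`n^2` additions. What remains is to bound the sum of all `D`, which is `sum_displacement_le`.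

Displacement. In hindsight, fix a ranking `r` with values at most `n` such that `r y < r x` whenever
`y` reaches `x` at some time while preceding it in the order (`exists_rank`). Look at the gap after
a position `g`. As many vertices cross it upward (a set `X`) as downward (a set `Y`), and every `y`
in `Y` now reaches every `x` in `X` through the new arc, but did not before. Given a threshold `T`,
either `r x` exceeds `r y` by at least `T`, or the pair is one of at most `n * T` close pairs and is
related for the first time; pairs inside the new component are exceptions. Averaging over `X` and
`Y` bounds `T` times the size of `X` by the difference of the rank sums plus `T` for each new close
pair (`card_mul_le_sum_sub_sum`). Summed over all gaps, the rank sums become the change of the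
potential `∑ r x * position x`, which is at most `n^3`, and the close pairs contribute `T * n` each.
Deleting or renumbering vertices costs `O(n^2)` per deletion, `O(n^3)` in all. So `T * ∑ D` is
`O(n^3 + T^2 * n^2)`, and taking `T` to be the integer square root of `n` gives `O(n^{5/2})`. -/

/-! ### Total-correctness rules for the machine -/

namespace RAM

/-- Total correctness: `p`, started in `s`, terminates with a result and a memory satisfying `Q`. -/
def wp {α : Type} (p : RAM α) (Q : α → Mem → Prop) (s : Mem) : Prop :=
  ∃ r ∈ p.run s, Q r.1 r.2

variable {α β : Type}

theorem wp_mono {p : RAM α} {Q Q' : α → Mem → Prop} {s : Mem} (h : wp p Q s)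
    (hQ : ∀ a s', Q a s' → Q' a s') : wp p Q' s := by
  obtain ⟨r, hr, h⟩ := h
  exact ⟨r, hr, hQ _ _ h⟩

theorem wp_pure (a : α) (Q : α → Mem → Prop) (s : Mem) : wp (pure a) Q s ↔ Q a s := by
  simp [wp, StateT.run_pure]

theorem wp_bind (p : RAM α) (g : α → RAM β) (Q : β → Mem → Prop) (s : Mem) :
    wp (p >>= g) Q s ↔ wp p (fun a s' => wp (g a) Q s') s := by
  simp only [wp, StateT.run_bind, Part.bind_eq_bind, Part.mem_bind_iff]
  constructor
  · rintro ⟨r, ⟨r', h1, h2⟩, h3⟩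
    exact ⟨r', h1, r, h2, h3⟩
  · rintro ⟨r', h1, r, h2, h3⟩
    exact ⟨r, ⟨r', h1, h2⟩, h3⟩

theorem wp_map (p : RAM α) (g : α → β) (Q : β → Mem → Prop) (s : Mem) :
    wp (g <$> p) Q s ↔ wp p (fun a s' => Q (g a) s') s := by
  rw [← bind_pure_comp, wp_bind]
  simp only [wp_pure]

theorem wp_if {c : Prop} [Decidable c] {p q : RAM α} {Q : α → Mem → Prop} {s : Mem}
    (hp : c → wp p Q s) (hq : ¬ c → wp q Q s) : wp (if c then p else q) Q s := by
  split_ifs with h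
  · exact hp h
  · exact hq h

theorem wp_tick (Q : Unit → Mem → Prop) (s : Mem) :
    wp tick Q s ↔ Q () { s with clock := s.clock + 1 } := by
  have : tick.run s = pure ((), { s with clock := s.clock + 1 }) := rfl
  simp [wp, this]

theorem wp_read (a : Arr) (i : ℕ) (Q : ℕ → Mem → Prop) (s : Mem) :
    wp (read a i) Q s ↔ Q (s.arr a i) { s with clock := s.clock + 1 } := by
  have : (read a i).run s = pure (s.arr a i, { s with clock := s.clock + 1 }) := by
    simp only [read, StateT.run_bind]
    rw [show tick.run s = pure ((), { s with clock := s.clock + 1 }) from rfl]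
    simp
  simp [wp, this]

theorem wp_write (a : Arr) (i x : ℕ) (Q : Unit → Mem → Prop) (s : Mem) :
    wp (write a i x) Q s ↔ Q () { s with
      arr := Function.update s.arr a (Function.update (s.arr a) i x), clock := s.clock + 1 } := by
  rw [write, wp_bind, wp_tick]
  constructor
  · rintro ⟨r, hr, h⟩
    cases (Part.mem_some_iff.mp hr)
    exact h
  · intro h
    exact ⟨_, Part.mem_some_iff.mpr rfl, h⟩

theorem wp_readAdj (x y : ℕ) (Q : ℕ → Mem → Prop) (s : Mem) :
    wp (readAdj x y) Q s ↔ Q (s.adj x y) { s with clock := s.clock + 1 } := by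
  rw [readAdj, wp_bind, wp_tick]
  constructor
  · rintro ⟨r, hr, h⟩
    simp at hr
    subst hr
    exact h
  · intro h
    exact ⟨_, by simp; rfl, h⟩

theorem wp_writeAdj (x y b : ℕ) (Q : Unit → Mem → Prop) (s : Mem) :
    wp (writeAdj x y b) Q s ↔ Q () { s with
      adj := Function.update s.adj x (Function.update (s.adj x) y b), clock := s.clock + 1 } := by
  rw [writeAdj, wp_bind, wp_tick]
  constructor
  · rintro ⟨r, hr, h⟩
    cases (Part.mem_some_iff.mp hr)
    exact h
  · intro h
    exact ⟨_, Part.mem_some_iff.mpr rfl, h⟩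

/-- The rule for loops: an invariant and a decreasing measure. -/
theorem wp_loop {body : β → RAM (α ⊕ β)} {Q : α → Mem → Prop} (I : β → Mem → Prop)
    (μ : β → Mem → ℕ)
    (step : ∀ b s, I b s → wp (body b)
      (fun r s' => Sum.elim (fun a => Q a s') (fun b' => I b' s' ∧ μ b' s' < μ b s) r)
      { s with clock := s.clock + 1 })
    {b : β} {s : Mem} (h : I b s) : wp (loop body b) Q s := by
  induction hm : μ b s using Nat.strong_induction_on generalizing b s with
  | _ m ih =>
    obtain ⟨⟨r, s'⟩, hr, hQ⟩ := step b s h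
    have hr' : (r, s') ∈ (tick >>= fun _ => body b).run s := by
      rw [StateT.run_bind, show tick.run s = pure ((), { s with clock := s.clock + 1 }) from rfl]
      simpa using hr
    cases r with
    | inl a =>
      exact ⟨(a, s'), PFun.mem_fix_iff.mpr (Or.inl
        (Part.mem_map _ hr')), hQ⟩
    | inr b' =>
      obtain ⟨r, hfix, hQ'⟩ := ih _ (hm ▸ hQ.2) hQ.1 rfl
      exact ⟨r, PFun.mem_fix_iff.mpr (Or.inr
        ⟨(b', s'), Part.mem_map _ hr', hfix⟩), hQ'⟩

/-- The rule for counted loops. -/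
theorem wp_forRange {k : ℕ} {body : ℕ → RAM Unit} {Q : Unit → Mem → Prop} (I : ℕ → Mem → Prop)
    (step : ∀ i < k, ∀ s, I i s → wp (body i) (fun _ s' => I (i + 1) s')
      { s with clock := s.clock + 1 })
    (hQ : ∀ s, I k s → Q () s)
    {s : Mem} (h : I 0 s) : wp (forRange k body) Q s := by
  suffices ∀ j ≤ k, wp (forRange j body) (fun _ s' => I j s') s from
    wp_mono (this k le_rfl) fun _ _ => hQ _
  intro j
  induction j with
  | zero => intro _; rw [forRange, wp_pure]; exact h
  | succ j ih =>
    intro hj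
    rw [forRange, wp_bind]
    refine wp_mono (ih (by omega)) fun _ s' hs' => ?_
    rw [wp_bind, wp_tick]
    exact step j hj s' hs'

end RAM

/-! ### Disjoint sets as a forest with union by rank -/

open RAM TopSearch

/-- The arrays `par`, `rk`, `can` store disjoint sets as a forest with union by rank; `rt v` is the
root of the tree containing `v`, and `f v` is the canonical element of its set. -/
structure DisjointSets (n : ℕ) (par rk can : ℕ → ℕ) (f rt : ℕ → ℕ) : Prop where
  par_lt : ∀ v < n, par v < n
  rt_lt : ∀ v < n, rt v < n
  par_rt : ∀ v < n, par (rt v) = rt v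
  rt_par : ∀ v < n, rt (par v) = rt v
  rt_root : ∀ v < n, par v = v → rt v = v
  rk_lt : ∀ v < n, par v ≠ v → rk v < rk (par v)
  rk_le : ∀ v < n, rk v ≤ rk (rt v)
  size : ∀ v < n, 2 ^ rk (rt v) ≤ ((Finset.range n).filter fun u => rt u = rt v).card
  can_rt : ∀ v < n, can (rt v) = f v
  f_lt : ∀ v < n, f v < n
  rt_f : ∀ v < n, rt (f v) = rt v

namespace DisjointSets

variable {n : ℕ} {par rk can f rt : ℕ → ℕ}

theorem rt_rt (h : DisjointSets n par rk can f rt) {v : ℕ} (hv : v < n) : rt (rt v) = rt v :=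
  h.rt_root _ (h.rt_lt v hv) (h.par_rt v hv)

theorem f_f (h : DisjointSets n par rk can f rt) {v : ℕ} (hv : v < n) : f (f v) = f v := by
  rw [← h.can_rt _ (h.f_lt v hv), h.rt_f v hv, h.can_rt v hv]

theorem f_eq_of_rt_eq (h : DisjointSets n par rk can f rt) {u v : ℕ} (hu : u < n) (hv : v < n)
    (e : rt u = rt v) : f u = f v := by
  rw [← h.can_rt u hu, ← h.can_rt v hv, e]

theorem rt_eq_iff (h : DisjointSets n par rk can f rt) {u v : ℕ} (hu : u < n) (hv : v < n) :
    rt u = rt v ↔ f u = f v :=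
  ⟨h.f_eq_of_rt_eq hu hv, fun e => by rw [← h.rt_f u hu, ← h.rt_f v hv, e]⟩

/-- A tree whose root has rank `k` has at least `2 ^ k` nodes, and there are only `n` nodes. -/
theorem rk_rt_le_log (h : DisjointSets n par rk can f rt) {v : ℕ} (hv : v < n) :
    rk (rt v) ≤ Nat.log 2 n := by
  refine Nat.le_log_of_pow_le (by norm_num) ((h.size v hv).trans ?_)
  exact (Finset.card_filter_le _ _).trans (Finset.card_range n).le

/-- The rank of `u` is below that of its root, so hanging `u` directly under the root keeps ranks
increasing along parents. Roots do not change, hence neither do the sets. -/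
theorem compress (h : DisjointSets n par rk can f rt) {u : ℕ} (hu : u < n) (hne : u ≠ rt u) :
    DisjointSets n (Function.update par u (rt u)) rk can f rt := by
  have hp : par u ≠ u := fun e => hne (h.rt_root u hu e).symm
  have hlt : rk u < rk (rt u) := by
    have := h.rk_le _ (h.par_lt u hu)
    rw [h.rt_par u hu] at this
    exact (h.rk_lt u hu hp).trans_le this
  refine { h with par_lt := ?_, par_rt := ?_, rt_par := ?_, rt_root := ?_, rk_lt := ?_ }
  · intro v hv
    by_cases e : v = u
    · subst e; simpa using h.rt_lt v hv
    · simpa [e] using h.par_lt v hv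
  · intro v hv
    by_cases e : rt v = u
    · exact absurd (by rw [← e, h.rt_rt hv]) hne
    · simpa [e] using h.par_rt v hv
  · intro v hv
    by_cases e : v = u
    · subst e; simpa using h.rt_rt hv
    · simpa [e] using h.rt_par v hv
  · intro v hv hpv
    by_cases e : v = u
    · subst e; simpa using hpv
    · rw [Function.update_of_ne e] at hpv; exact h.rt_root v hv hpv
  · intro v hv hpv
    by_cases e : v = u
    · subst e; simpa using hlt
    · rw [Function.update_of_ne e] at hpv ⊢; exact h.rk_lt v hv hpv

/-- Linking the root `rx` below the root `ry` of no smaller rank; the rank of `ry` becomes `k`. -/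
theorem link (h : DisjointSets n par rk can f rt) {rx ry c k : ℕ} (hx : rx < n) (hy : ry < n)
    (hrx : rt rx = rx) (hry : rt ry = ry) (hne : rx ≠ ry) (hc : c < n)
    (hcr : rt c = rx ∨ rt c = ry) (hk : rk rx < k) (hk' : rk ry ≤ k)
    (hsize : 2 ^ k ≤ 2 ^ rk rx + 2 ^ rk ry) :
    DisjointSets n (Function.update par rx ry) (Function.update rk ry k)
      (Function.update can ry c) (fun v => if rt v = rx ∨ rt v = ry then c else f v)
      (fun v => if rt v = rx then ry else rt v) := by
  have hpx : par rx = rx := by have := h.par_rt rx hx; rwa [hrx] at this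
  have hpy : par ry = ry := by have := h.par_rt ry hy; rwa [hry] at this
  have hroot : ∀ v < n, v ≠ rx → rt v ≠ v → par v ≠ v := fun v hv _ hr e => hr (h.rt_root v hv e)
  refine ⟨?_, ?_, ?_, ?_, ?_, ?_, ?_, ?_, ?_, ?_, ?_⟩
  · intro v hv
    simp only [Function.update_apply]
    split_ifs
    · exact hy
    · exact h.par_lt v hv
  · intro v hv
    split_ifs
    · exact hy
    · exact h.rt_lt v hv
  · intro v hv
    split_ifs with e
    · simp [hne.symm, hpy]
    · simpa [Function.update_apply, e] using h.par_rt v hv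
  · intro v hv
    by_cases e : v = rx
    · subst e; simp [hrx, hry, hne.symm]
    · simp [e, h.rt_par v hv]
  · intro v hv
    by_cases e : v = rx
    · subst e
      simp [hne.symm]
    · intro hp
      simp only [Function.update_of_ne e] at hp
      have := h.rt_root v hv hp
      simp [this, e]
  · intro v hv
    by_cases e : v = rx
    · subst e; simp [hne, hk]
    · intro hp
      simp only [Function.update_of_ne e] at hp ⊢
      have h1 := h.rk_lt v hv hp
      have hv' : v ≠ ry := by rintro rfl; exact hp hpy
      rw [Function.update_of_ne hv']
      by_cases e' : par v = ry
      · rw [e', Function.update_self]; rw [e'] at h1; omega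
      · rwa [Function.update_of_ne e']
  · intro v hv
    have h1 := h.rk_le v hv
    by_cases e : rt v = rx
    · simp only [e, if_true, Function.update_self]
      by_cases e' : v = ry
      · simp [e']
      · rw [Function.update_of_ne e']; rw [e] at h1; omega
    · simp only [e, if_false]
      by_cases e' : rt v = ry
      · rw [e', Function.update_self]
        by_cases e'' : v = ry
        · simp [e'']
        · rw [Function.update_of_ne e'']; rw [e'] at h1; omega
      · rw [Function.update_of_ne e', Function.update_of_ne]
        · exact h1
        · rintro rfl; exact e' hry
  · intro v hv
    have h1 := h.size v hv
    by_cases e : rt v = rx ∨ rt v = ry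
    · have e1 : (if rt v = rx then ry else rt v) = ry := by
        split_ifs with h2
        · rfl
        · exact e.resolve_left h2
      rw [e1, Function.update_self]
      -- The new tree is the disjoint union of the two old ones, so its size is at least the sum of
      -- the two powers in `hsize`.
      have e2 : ((Finset.range n).filter fun u => (if rt u = rx then ry else rt u) = ry)
          = ((Finset.range n).filter fun u => rt u = rx) ∪
            ((Finset.range n).filter fun u => rt u = ry) := by
        ext u
        simp only [Finset.mem_filter, Finset.mem_union]
        split_ifs <;> simp_all
      rw [e2, Finset.card_union_of_disjoint]
      · have hx' := h.size rx hx
        have hy' := h.size ry hy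
        rw [hrx] at hx'
        rw [hry] at hy'
        omega
      · rw [Finset.disjoint_filter]
        intro u _ h1 h2
        exact hne (h1.symm.trans h2)
    · push Not at e
      rw [if_neg e.1, Function.update_of_ne e.2]
      refine h1.trans (Finset.card_le_card ?_)
      intro u
      simp only [Finset.mem_filter]
      rintro ⟨h3, h4⟩
      refine ⟨h3, ?_⟩
      rw [if_neg (by rw [h4]; exact e.1), h4]
  · intro v hv
    by_cases e : rt v = rx
    · simp [e]
    · by_cases e' : rt v = ry
      · simp [e']
      · simp [e, e', h.can_rt v hv]
  · intro v hv
    split_ifs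
    · exact hc
    · exact h.f_lt v hv
  · intro v hv
    by_cases e : rt v = rx ∨ rt v = ry
    · simp only [e, if_true]
      rcases e with e | e <;> rcases hcr with h' | h' <;> simp [e, h']
    · simp only [e, if_false]
      rw [h.rt_f v hv]

end DisjointSets

/-! ### Frame conditions and the cost of the disjoint set operations -/

/-- The memories agree except for the clock and the arrays satisfying `A`. -/
structure AgreeExcept (A : Arr → Prop) (s s' : Mem) : Prop where
  arr : ∀ a, ¬ A a → s'.arr a = s.arr a
  adj : s'.adj = s.adj

theorem AgreeExcept.refl (A : Arr → Prop) (s : Mem) : AgreeExcept A s s := ⟨fun _ _ => rfl, rfl⟩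

theorem AgreeExcept.trans {A : Arr → Prop} {s s' s'' : Mem} (h : AgreeExcept A s s')
    (h' : AgreeExcept A s' s'') : AgreeExcept A s s'' :=
  ⟨fun a ha => (h'.arr a ha).trans (h.arr a ha), h'.adj.trans h.adj⟩

theorem AgreeExcept.mono {A A' : Arr → Prop} {s s' : Mem} (h : AgreeExcept A s s')
    (hA : ∀ a, A a → A' a) : AgreeExcept A' s s' :=
  ⟨fun a ha => h.arr a fun h' => ha (hA a h'), h.adj⟩

/-- The disjoint sets stored in the memory. -/
def Mem.Sets (n : ℕ) (s : Mem) (f rt : ℕ → ℕ) : Prop :=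
  DisjointSets n (s.arr .parent) (s.arr .rank) (s.arr .canon) f rt

/-- Ranks grow strictly along parents, so the rank still missing to that of the root bounds the rest
of the path in both walks; they take 2 and 3 steps per node. Path compression only has to be
harmless: the logarithmic bound from union by rank suffices. -/
theorem wp_findRoot {n : ℕ} {s : Mem} {f rt : ℕ → ℕ} (h : s.Sets n f rt) {v : ℕ} (hv : v < n)
    {Q : ℕ → Mem → Prop}
    (hQ : ∀ s', s'.Sets n f rt → AgreeExcept (· = .parent) s s' →
      s'.clock ≤ s.clock + (5 * Nat.log 2 n + 3) → Q (rt v) s') :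
    wp (findRoot v) Q s := by
  have hL := h.rk_rt_le_log hv
  set R := s.arr .rank (rt v) with hR
  rw [findRoot, wp_bind]
  refine wp_loop (fun u t => u < n ∧ rt u = rt v ∧
      t = { s with clock := t.clock } ∧ t.clock + 2 * (R - s.arr .rank u) ≤ s.clock + 2 * R)
    (fun u _ => R - s.arr .rank u) ?_ ⟨hv, rfl, rfl, by omega⟩
  rintro u t ⟨hu, hru, ht, hc⟩
  rw [ht]
  have h1 := h.rk_le u hu
  rw [hru] at h1
  simp only [wp_bind, wp_read]
  split_ifs with hp
  · simp only [wp_pure, Sum.elim_inl]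
    have hu' : u = rt v := by rw [← hru, h.rt_root u hu hp]
    refine wp_loop (fun u t => u < n ∧ rt u = rt v ∧ t.Sets n f rt ∧
        AgreeExcept (· = .parent) s t ∧
        t.clock + 3 * (R - s.arr .rank u) ≤ s.clock + 2 * R + 2 + 3 * R)
      (fun u _ => R - s.arr .rank u) ?_ ⟨hv, rfl, h, ⟨fun _ _ => rfl, rfl⟩, by simp; omega⟩
    rintro u' t' ⟨hu'', hru', hS, hA, hc'⟩
    split_ifs with he
    · simp only [wp_pure, Sum.elim_inl, hu']
      exact hQ _ hS ⟨hA.arr, hA.adj⟩ (by simp; omega)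
    · rw [hu'] at he
      simp only [wp_bind, wp_read, wp_write, wp_pure, Sum.elim_inr]
      have hrk : t'.arr .rank = s.arr .rank := hA.arr _ (by simp)
      have h2 := hS.rk_lt u' hu'' (fun e => he ((hS.rt_root u' hu'' e).symm.trans hru'))
      have h3 := hS.rk_le _ (hS.par_lt u' hu'')
      rw [hS.rt_par u' hu'', hru'] at h3
      rw [hrk] at h2 h3
      refine ⟨⟨hS.par_lt u' hu'', (hS.rt_par u' hu'').trans hru', ?_, ⟨?_, hA.adj⟩, ?_⟩, ?_⟩
      · have := hS.compress hu'' (by rw [hru']; exact he)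
        rw [hru', ← hu'] at this
        simpa [Mem.Sets, Function.update_of_ne] using this
      · intro a ha
        simp [Function.update_of_ne ha, hA.arr a ha]
      · omega
      · omega
  · simp only [wp_pure, Sum.elim_inr]
    have h2 := h.rk_lt u hu hp
    have h3 := h.rk_le _ (h.par_lt u hu)
    rw [h.rt_par u hu, hru] at h3
    exact ⟨⟨h.par_lt u hu, (h.rt_par u hu).trans hru, trivial, by omega⟩, by omega⟩

theorem wp_find {n : ℕ} {s : Mem} {f rt : ℕ → ℕ} (h : s.Sets n f rt) {v : ℕ} (hv : v < n)
    {Q : ℕ → Mem → Prop}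
    (hQ : ∀ s', s'.Sets n f rt → AgreeExcept (· = .parent) s s' →
      s'.clock ≤ s.clock + (5 * Nat.log 2 n + 4) → Q (f v) s') :
    wp (find v) Q s := by
  rw [find, wp_bind]
  refine wp_findRoot h hv fun s' hS hA hc => ?_
  rw [wp_read, hS.can_rt v hv]
  exact hQ _ hS ⟨hA.arr, hA.adj⟩ (by dsimp only; omega)

theorem wp_unite {n : ℕ} {s : Mem} {f rt : ℕ → ℕ} (h : s.Sets n f rt) {x y : ℕ} (hx : x < n)
    (hy : y < n) (hfx : f x = x) (hfy : f y = y) (hne : x ≠ y) {Q : Unit → Mem → Prop}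
    (hQ : ∀ s' rt', s'.Sets n (fun v => if f v = y then x else f v) rt' →
      AgreeExcept (fun a => a = .parent ∨ a = .rank ∨ a = .canon) s s' →
      s'.clock ≤ s.clock + (10 * Nat.log 2 n + 11) → Q () s') :
    wp (unite x y) Q s := by
  rw [unite, wp_bind]
  refine wp_findRoot h hx fun s1 h1 hA1 hc1 => ?_
  rw [wp_bind]
  refine wp_findRoot h1 hy fun s2 h2 hA2 hc2 => ?_
  simp only [wp_bind, wp_read]
  have hA : AgreeExcept (· = .parent) s s2 := hA1.trans hA2
  have hrne : rt x ≠ rt y := fun e => hne (by rw [← hfx, ← hfy, h.f_eq_of_rt_eq hx hy e])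
  have hcl : ∀ v < n, (rt v = rt x ∨ rt v = rt y ↔ f v = x ∨ f v = y) := fun v hv => by
    rw [h.rt_eq_iff hv hx, h.rt_eq_iff hv hy, hfx, hfy]
  -- `link` describes the new canonical map through roots, the goal through `f`. The two agree only
  -- below `n`, which is all that `DisjointSets` looks at.
  have hf : ∀ {g rt' : ℕ → ℕ} {s' : Mem},
      s'.Sets n g rt' → (∀ v < n, g v = if f v = y then x else f v) →
      s'.Sets n (fun v => if f v = y then x else f v) rt' := by
    intro g rt' s' hS hg
    refine { hS with can_rt := ?_, f_lt := ?_, rt_f := ?_ }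
    · intro v hv; rw [← hg v hv]; exact hS.can_rt v hv
    · intro v hv; rw [← hg v hv]; exact hS.f_lt v hv
    · intro v hv; rw [← hg v hv]; exact hS.rt_f v hv
  have hg1 : ∀ v < n, (if rt v = rt x ∨ rt v = rt y then x else f v) =
      if f v = y then x else f v := by
    intro v hv
    simp only [hcl v hv]
    split_ifs <;> tauto
  have hg2 : ∀ v < n, (if rt v = rt y ∨ rt v = rt x then x else f v) =
      if f v = y then x else f v := by
    intro v hv
    rw [← hg1 v hv]
    simp only [or_comm]
  have hag : ∀ (s' : Mem), (∀ a, ¬ (a = .parent ∨ a = .rank ∨ a = .canon) →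
      s'.arr a = s2.arr a) → s'.adj = s2.adj →
      AgreeExcept (fun a => a = .parent ∨ a = .rank ∨ a = .canon) s s' := by
    intro s' ha hadj
    exact ⟨fun a h' => (ha a h').trans (hA.arr a (by tauto)), hadj.trans hA.adj⟩
  have hlx := h.rt_lt x hx
  have hly := h.rt_lt y hy
  split_ifs with hk hk'
  · simp only [wp_bind, wp_write]
    have := h2.link hlx hly (h.rt_rt hx) (h.rt_rt hy) hrne hx (Or.inl rfl) hk le_rfl
      (Nat.le_add_left _ _)
    revert this
    generalize (fun v => if rt v = rt x then _ else _) = rt'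
    intro this
    refine hQ _ rt' (hf (s' := _) ?_ hg1) (hag _ ?_ rfl) ?_
    · simpa [Mem.Sets, Function.update_of_ne] using this
    · intro a ha
      push Not at ha
      simp [ha]
    · dsimp only; omega
  · simp only [wp_bind, wp_write]
    have := h2.link hly hlx (h.rt_rt hy) (h.rt_rt hx) hrne.symm hx (Or.inr rfl)
      (k := s2.arr .rank (rt x) + 1) (by omega) (by omega) (by rw [hk', pow_succ]; omega)
    revert this
    generalize (fun v => if rt v = rt y then _ else _) = rt'
    intro this
    refine hQ _ rt' (hf (s' := _) ?_ hg2) (hag _ ?_ rfl) ?_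
    · simpa [Mem.Sets, Function.update_of_ne] using this
    · intro a ha
      push Not at ha
      simp [ha]
    · dsimp only; omega
  · simp only [wp_bind, wp_write, wp_pure]
    have := h2.link hly hlx (h.rt_rt hy) (h.rt_rt hx) hrne.symm hx (Or.inr rfl)
      (k := s2.arr .rank (rt x)) (by omega) le_rfl (Nat.le_add_left _ _)
    rw [Function.update_eq_self] at this
    revert this
    generalize (fun v => if rt v = rt y then _ else _) = rt'
    intro this
    refine hQ _ rt' (hf (s' := _) ?_ hg2) (hag _ ?_ rfl) ?_
    · simpa [Mem.Sets, Function.update_of_ne] using this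
    · intro a ha
      push Not at ha
      simp [ha]
    · dsimp only; omega

/-! ### Scanning queues and positions -/

theorem wp_arcFromF {s : Mem} {lo hi x : ℕ} {Q : Bool → Mem → Prop}
    (hQ : ∀ b c, (b = true ↔ ∃ t, lo ≤ t ∧ t < hi ∧ s.adj (s.arr .fwd t) x = 1) →
      c ≤ s.clock + 3 * (hi - lo) + 1 → Q b { s with clock := c }) :
    wp (arcFromF lo hi x) Q s := by
  refine wp_loop (fun t s' => lo ≤ t ∧ (t ≤ hi ∨ t = lo) ∧
      (∀ u, lo ≤ u → u < t → s.adj (s.arr .fwd u) x ≠ 1) ∧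
      s' = { s with clock := s'.clock } ∧ s'.clock + 3 * (hi - t) ≤ s.clock + 3 * (hi - lo))
    (fun t _ => hi - t) ?_ ⟨le_rfl, Or.inr rfl, by omega, rfl, le_rfl⟩
  rintro t s' ⟨h1, h2, h3, hs, hc⟩
  rw [hs]
  split_ifs with ht
  · simp only [wp_bind, wp_read, wp_readAdj]
    split_ifs with hb
    · simp only [wp_pure, Sum.elim_inl]
      exact hQ _ _ (by simpa using ⟨t, h1, ht, hb⟩) (by omega)
    · simp only [wp_pure, Sum.elim_inr]
      refine ⟨⟨by omega, by omega, ?_, trivial, by omega⟩, by omega⟩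
      intro u hu hut
      rcases Nat.lt_succ_iff_lt_or_eq.mp hut with h | rfl
      · exact h3 u hu h
      · exact hb
  · simp only [wp_pure, Sum.elim_inl]
    refine hQ _ _ ?_ (by omega)
    simp only [Bool.false_eq_true, false_iff]
    rintro ⟨u, hu, hu', h⟩
    exact h3 u hu (by omega) h

theorem wp_arcToB {s : Mem} {lo hi x : ℕ} {Q : Bool → Mem → Prop}
    (hQ : ∀ b c, (b = true ↔ ∃ t, lo ≤ t ∧ t < hi ∧ s.adj x (s.arr .bwd t) = 1) →
      c ≤ s.clock + 3 * (hi - lo) + 1 → Q b { s with clock := c }) :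
    wp (arcToB lo hi x) Q s := by
  refine wp_loop (fun t s' => lo ≤ t ∧ (t ≤ hi ∨ t = lo) ∧
      (∀ u, lo ≤ u → u < t → s.adj x (s.arr .bwd u) ≠ 1) ∧
      s' = { s with clock := s'.clock } ∧ s'.clock + 3 * (hi - t) ≤ s.clock + 3 * (hi - lo))
    (fun t _ => hi - t) ?_ ⟨le_rfl, Or.inr rfl, by omega, rfl, le_rfl⟩
  rintro t s' ⟨h1, h2, h3, hs, hc⟩
  rw [hs]
  split_ifs with ht
  · simp only [wp_bind, wp_read, wp_readAdj]
    split_ifs with hb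
    · simp only [wp_pure, Sum.elim_inl]
      exact hQ _ _ (by simpa using ⟨t, h1, ht, hb⟩) (by omega)
    · simp only [wp_pure, Sum.elim_inr]
      refine ⟨⟨by omega, by omega, ?_, trivial, by omega⟩, by omega⟩
      intro u hu hut
      rcases Nat.lt_succ_iff_lt_or_eq.mp hut with h | rfl
      · exact h3 u hu h
      · exact hb
  · simp only [wp_pure, Sum.elim_inl]
    refine hQ _ _ ?_ (by omega)
    simp only [Bool.false_eq_true, false_iff]
    rintro ⟨u, hu, hu', h⟩
    exact h3 u hu (by omega) h

/-- A tick, a read and a scan of `F` make `3 * tF + 3` per position; the `+ 1` pays for the position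
at which the scan stops. -/
theorem wp_scanUp {s : Mem} {a j tF : ℕ} (haj : a ≤ j) {Q : ℕ → Mem → Prop}
    (hQ : ∀ i c, a ≤ i → i ≤ j →
      (∀ l, a ≤ l → l < i → ∀ t < tF, s.adj (s.arr .fwd t) (s.arr .vertex l) ≠ 1) →
      (i < j → ∃ t < tF, s.adj (s.arr .fwd t) (s.arr .vertex i) = 1) →
      c ≤ s.clock + (i - a + 1) * (3 * tF + 3) → Q i { s with clock := c }) :
    wp (scanUp a j tF) Q s := by
  refine wp_loop (fun i s' => a ≤ i ∧ i ≤ j ∧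
      (∀ l, a ≤ l → l < i → ∀ t < tF, s.adj (s.arr .fwd t) (s.arr .vertex l) ≠ 1) ∧
      s' = { s with clock := s'.clock } ∧ s'.clock ≤ s.clock + (i - a) * (3 * tF + 3))
    (fun i _ => j - i) ?_ ⟨le_rfl, haj, by omega, rfl, by omega⟩
  rintro i s' ⟨h1, h2, h3, hs, hc⟩
  rw [hs]
  split_ifs with hij
  · simp only [wp_bind, wp_read]
    refine wp_arcFromF fun b c hb hc' => ?_
    have hc'' : c ≤ s.clock + (i - a + 1) * (3 * tF + 3) := by
      rw [add_mul]; dsimp only at hc'; omega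
    split_ifs with hb'
    · simp only [wp_pure, Sum.elim_inl]
      obtain ⟨t, -, ht, hG⟩ := hb.mp hb'
      exact hQ _ _ h1 h2 h3 (fun _ => ⟨t, ht, hG⟩) hc''
    · simp only [wp_pure, Sum.elim_inr]
      refine ⟨⟨by omega, by omega, ?_, trivial, ?_⟩, by omega⟩
      · intro l hl hl' t ht hG
        rcases Nat.lt_succ_iff_lt_or_eq.mp hl' with h | rfl
        · exact h3 l hl h t ht hG
        · exact hb' (hb.mpr ⟨t, Nat.zero_le _, ht, hG⟩)
      · rwa [show i + 1 - a = i - a + 1 by omega]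
  · simp only [wp_pure, Sum.elim_inl]
    refine hQ _ _ h1 h2 h3 (by omega) ?_
    rw [add_mul]; omega

theorem wp_scanDown {s : Mem} {i a tB : ℕ} (hia : i ≤ a) {Q : ℕ → Mem → Prop}
    (hQ : ∀ j c, i ≤ j → j ≤ a →
      (∀ l, j < l → l ≤ a → ∀ t < tB, s.adj (s.arr .vertex l) (s.arr .bwd t) ≠ 1) →
      (i < j → ∃ t < tB, s.adj (s.arr .vertex j) (s.arr .bwd t) = 1) →
      c ≤ s.clock + (a - j + 1) * (3 * tB + 3) → Q j { s with clock := c }) :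
    wp (scanDown i a tB) Q s := by
  refine wp_loop (fun j s' => i ≤ j ∧ j ≤ a ∧
      (∀ l, j < l → l ≤ a → ∀ t < tB, s.adj (s.arr .vertex l) (s.arr .bwd t) ≠ 1) ∧
      s' = { s with clock := s'.clock } ∧ s'.clock ≤ s.clock + (a - j) * (3 * tB + 3))
    (fun j _ => j - i) ?_ ⟨hia, le_rfl, by omega, rfl, by omega⟩
  rintro j s' ⟨h1, h2, h3, hs, hc⟩
  rw [hs]
  split_ifs with hij
  · simp only [wp_bind, wp_read]
    refine wp_arcToB fun b c hb hc' => ?_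
    have hc'' : c ≤ s.clock + (a - j + 1) * (3 * tB + 3) := by
      rw [add_mul]; dsimp only at hc'; omega
    split_ifs with hb'
    · simp only [wp_pure, Sum.elim_inl]
      obtain ⟨t, -, ht, hG⟩ := hb.mp hb'
      exact hQ _ _ h1 h2 h3 (fun _ => ⟨t, ht, hG⟩) hc''
    · simp only [wp_pure, Sum.elim_inr]
      refine ⟨⟨by omega, by omega, ?_, trivial, ?_⟩, by omega⟩
      · intro l hl hl' t ht hG
        by_cases h : j < l
        · exact h3 l h hl' t ht hG
        · obtain rfl : l = j := by omega
          exact hb' (hb.mpr ⟨t, Nat.zero_le _, ht, hG⟩)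
      · rwa [show a - (j - 1) = a - j + 1 by omega]
  · simp only [wp_pure, Sum.elim_inl]
    refine hQ _ _ h1 h2 h3 (by omega) ?_
    rw [add_mul]; omega

/-! ### The two-way search -/

/-- `V 1, …, V N` lists the elements satisfying `C`, each once, and `P` is the inverse map. -/
structure IsNumbering (C : ℕ → Prop) (V P : ℕ → ℕ) (N : ℕ) : Prop where
  pos_ge : ∀ x, C x → 1 ≤ P x
  pos_le : ∀ x, C x → P x ≤ N
  vertex_pos : ∀ x, C x → V (P x) = x
  can_vertex : ∀ i, 1 ≤ i → i ≤ N → C (V i)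
  pos_vertex : ∀ i, 1 ≤ i → i ≤ N → P (V i) = i

theorem IsNumbering.inj {C : ℕ → Prop} {V P : ℕ → ℕ} {N : ℕ} (h : IsNumbering C V P N) {x y : ℕ}
    (hx : C x) (hy : C y) (e : P x = P y) : x = y := by
  rw [← h.vertex_pos x hx, ← h.vertex_pos y hy, e]

/-- A state of the two-way search: `F` and `B` are the queues, of sizes `tF` and `tB`, and the
positions up to `i` and from `j` on have been examined. -/
structure SearchState (n N : ℕ) (C : ℕ → Prop) (V P : ℕ → ℕ) (G : ℕ → ℕ → Prop) (v w : ℕ)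
    (i j tF tB : ℕ) (F B vx : ℕ → ℕ) : Prop where
  F_zero : F 0 = w
  B_zero : B 0 = v
  F_pos : 1 ≤ tF
  B_pos : 1 ≤ tB
  F_can : ∀ t < tF, C (F t)
  B_can : ∀ t < tB, C (B t)
  F_le : ∀ t < tF, P (F t) ≤ i
  B_ge : ∀ t < tB, j ≤ P (B t)
  F_mono : ∀ t t', t < t' → t' < tF → P (F t) < P (F t')
  B_anti : ∀ t t', t < t' → t' < tB → P (B t') < P (B t)
  F_lt_B : ∀ t < tF, ∀ t' < tB, P (F t) < P (B t')
  F_pred : ∀ t < tF, 0 < t → ∃ t' < t, G (F t') (F t)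
  B_pred : ∀ t < tB, 0 < t → ∃ t' < t, G (B t) (B t')
  vertex_null : ∀ t < tF, vx (P (F t)) = n
  vertex_null' : ∀ t < tB, vx (P (B t)) = n
  vertex_eq : ∀ l, 1 ≤ l → l ≤ N → (∀ t < tF, P (F t) ≠ l) → (∀ t < tB, P (B t) ≠ l) → vx l = V l
  F_closed : ∀ t < tF, ∀ x, C x → G (F t) x → P (F t) < P x → P x ≤ i → P x < j →
    ∃ t' < tF, F t' = x
  B_closed : ∀ t < tB, ∀ x, C x → G x (B t) → P x < P (B t) → j ≤ P x → i < P x →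
    ∃ t' < tB, B t' = x

namespace SearchState

variable {n N : ℕ} {C : ℕ → Prop} {V P : ℕ → ℕ} {G : ℕ → ℕ → Prop} {v w : ℕ}
  {i j tF tB : ℕ} {F B vx : ℕ → ℕ}

/-- The upward scan ran into `j` without a hit. Closure of `F` is only demanded for positions below
`j`, so the element at `j`, never tested against `F`, does not matter. -/
theorem skipF (h : SearchState n N C V P G v w i j tF tB F B vx) (hN : IsNumbering C V P N)
    {i' : ℕ} (hi : i ≤ i')
    (hno : ∀ l, i < l → l < i' → ∀ t < tF, ¬ G (F t) (V l))
    (hi' : i' = j) : SearchState n N C V P G v w i' j tF tB F B vx :=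
  { h with
    F_le := fun t ht => (h.F_le t ht).trans hi
    F_closed := fun t ht x hx hG hlt hle hlj => by
      by_cases hxi : P x ≤ i
      · exact h.F_closed t ht x hx hG hlt hxi hlj
      · refine absurd ?_ (hno (P x) (by omega) (by omega) t ht)
        rwa [hN.vertex_pos x hx]
    B_closed := fun t ht x hx hG hlt hle hlj =>
      h.B_closed t ht x hx hG hlt hle (by omega) }

theorem skipB (h : SearchState n N C V P G v w i j tF tB F B vx) (hN : IsNumbering C V P N)
    {j' : ℕ} (hj : j' ≤ j)
    (hno : ∀ l, j' < l → l < j → ∀ t < tB, ¬ G (V l) (B t))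
    (hj' : j' = i) : SearchState n N C V P G v w i j' tF tB F B vx :=
  { h with
    B_ge := fun t ht => hj.trans (h.B_ge t ht)
    B_closed := fun t ht x hx hG hlt hle hlj => by
      by_cases hxi : j ≤ P x
      · exact h.B_closed t ht x hx hG hlt hxi hlj
      · refine absurd ?_ (hno (P x) (by omega) (by omega) t ht)
        rwa [hN.vertex_pos x hx]
    F_closed := fun t ht x hx hG hlt hle hlj =>
      h.F_closed t ht x hx hG hlt hle (by omega) }

/-- The first hit after `i` is at `i'`: the positions in between receive no arc from `F`, so closure
extends up to `i'`, and appending keeps `F` increasing in position. -/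
theorem pushF (h : SearchState n N C V P G v w i j tF tB F B vx) (hN : IsNumbering C V P N)
    {i' : ℕ} (hi : i < i') (hij : i' < j) (hjN : j ≤ N)
    (hno : ∀ l, i < l → l < i' → ∀ t < tF, ¬ G (F t) (V l))
    (hG : ∃ t < tF, G (F t) (V i')) :
    SearchState n N C V P G v w i' j (tF + 1) tB (Function.update F tF (V i')) B
      (Function.update vx i' n) := by
  have hP : P (V i') = i' := hN.pos_vertex i' (by omega) (by omega)
  have hC : C (V i') := hN.can_vertex i' (by omega) (by omega)
  have hF : ∀ t < tF, Function.update F tF (V i') t = F t := fun t ht =>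
    Function.update_of_ne (by omega) _ _
  have hF' : Function.update F tF (V i') tF = V i' := Function.update_self ..
  have hcases : ∀ {t}, t < tF + 1 → t < tF ∨ t = tF := fun ht => by omega
  refine { F_zero := ?_, B_zero := h.B_zero, F_pos := by omega, B_pos := h.B_pos, F_can := ?_,
           B_can := h.B_can, F_le := ?_, B_ge := h.B_ge, F_mono := ?_, B_anti := h.B_anti,
           F_lt_B := ?_, F_pred := ?_, B_pred := h.B_pred, vertex_null := ?_,
           vertex_null' := ?_, vertex_eq := ?_, F_closed := ?_, B_closed := ?_ }
  · rw [hF 0 h.F_pos, h.F_zero]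
  · intro t ht
    rcases hcases ht with ht | rfl
    · rw [hF t ht]; exact h.F_can t ht
    · rw [hF']; exact hC
  · intro t ht
    rcases hcases ht with ht | rfl
    · rw [hF t ht]; exact (h.F_le t ht).trans hi.le
    · rw [hF', hP]
  · intro t t' htt ht'
    rcases hcases ht' with ht | rfl
    · rw [hF t' ht, hF t (by omega)]; exact h.F_mono t t' htt ht
    · rw [hF', hP, hF t htt]; exact (h.F_le t htt).trans_lt hi
  · intro t ht t' ht'
    rcases hcases ht with ht | rfl
    · rw [hF t ht]; exact h.F_lt_B t ht t' ht'
    · rw [hF', hP]; exact hij.trans_le (h.B_ge t' ht')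
  · intro t ht h0
    rcases hcases ht with ht | rfl
    · obtain ⟨t', ht', hG⟩ := h.F_pred t ht h0
      exact ⟨t', ht', by rw [hF t ht, hF t' (by omega)]; exact hG⟩
    · obtain ⟨t', ht', hG⟩ := hG
      exact ⟨t', ht', by rw [hF', hF t' ht']; exact hG⟩
  · intro t ht
    rcases hcases ht with ht | rfl
    · rw [hF t ht, Function.update_of_ne]
      · exact h.vertex_null t ht
      · have := h.F_le t ht; omega
    · rw [hF', hP, Function.update_self]
  · intro t ht
    rw [Function.update_of_ne]
    · exact h.vertex_null' t ht
    · have := h.B_ge t ht; omega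
  · intro l hl hl' h1 h2
    have h3 := h1 tF (by omega)
    rw [hF', hP] at h3
    rw [Function.update_of_ne (Ne.symm h3)]
    refine h.vertex_eq l hl hl' (fun t ht => ?_) h2
    have := h1 t (by omega)
    rwa [hF t ht] at this
  · intro t ht x hx hG' hlt hle hlj
    rcases hcases ht with ht | rfl
    · rw [hF t ht] at hG' hlt
      rcases hle.eq_or_lt with he | hl
      · exact ⟨tF, by omega, by rw [hF', ← he, hN.vertex_pos x hx]⟩
      · by_cases hxi : P x ≤ i
        · obtain ⟨t', ht', e⟩ := h.F_closed t ht x hx hG' hlt hxi hlj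
          exact ⟨t', by omega, by rw [hF t' ht', e]⟩
        · refine absurd ?_ (hno (P x) (by omega) (by omega) t ht)
          rwa [hN.vertex_pos x hx]
    · rw [hF', hP] at hlt; omega
  · intro t ht x hx hG' hlt hle hlj
    exact h.B_closed t ht x hx hG' hlt hle (by omega)

theorem pushB (h : SearchState n N C V P G v w i j tF tB F B vx) (hN : IsNumbering C V P N)
    {j' : ℕ} (hj : j' < j) (hij : i < j') (hjN : j ≤ N)
    (hno : ∀ l, j' < l → l < j → ∀ t < tB, ¬ G (V l) (B t))
    (hG : ∃ t < tB, G (V j') (B t)) :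
    SearchState n N C V P G v w i j' tF (tB + 1) F (Function.update B tB (V j'))
      (Function.update vx j' n) := by
  have hP : P (V j') = j' := hN.pos_vertex j' (by omega) (by omega)
  have hC : C (V j') := hN.can_vertex j' (by omega) (by omega)
  have hB : ∀ t < tB, Function.update B tB (V j') t = B t := fun t ht =>
    Function.update_of_ne (by omega) _ _
  have hB' : Function.update B tB (V j') tB = V j' := Function.update_self ..
  have hcases : ∀ {t}, t < tB + 1 → t < tB ∨ t = tB := fun ht => by omega
  refine { F_zero := h.F_zero, B_zero := ?_, F_pos := h.F_pos, B_pos := by omega,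
           F_can := h.F_can, B_can := ?_, F_le := h.F_le, B_ge := ?_, F_mono := h.F_mono,
           B_anti := ?_, F_lt_B := ?_, F_pred := h.F_pred, B_pred := ?_, vertex_null := ?_,
           vertex_null' := ?_, vertex_eq := ?_, F_closed := ?_, B_closed := ?_ }
  · rw [hB 0 h.B_pos, h.B_zero]
  · intro t ht
    rcases hcases ht with ht | rfl
    · rw [hB t ht]; exact h.B_can t ht
    · rw [hB']; exact hC
  · intro t ht
    rcases hcases ht with ht | rfl
    · rw [hB t ht]; exact hj.le.trans (h.B_ge t ht)
    · rw [hB', hP]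
  · intro t t' htt ht'
    rcases hcases ht' with ht | rfl
    · rw [hB t' ht, hB t (by omega)]; exact h.B_anti t t' htt ht
    · rw [hB', hP, hB t htt]; exact hj.trans_le (h.B_ge t htt)
  · intro t ht t' ht'
    rcases hcases ht' with ht' | rfl
    · rw [hB t' ht']; exact h.F_lt_B t ht t' ht'
    · rw [hB', hP]; exact (h.F_le t ht).trans_lt hij
  · intro t ht h0
    rcases hcases ht with ht | rfl
    · obtain ⟨t', ht', hG⟩ := h.B_pred t ht h0
      exact ⟨t', ht', by rw [hB t ht, hB t' (by omega)]; exact hG⟩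
    · obtain ⟨t', ht', hG⟩ := hG
      exact ⟨t', ht', by rw [hB', hB t' ht']; exact hG⟩
  · intro t ht
    rw [Function.update_of_ne]
    · exact h.vertex_null t ht
    · have := h.F_le t ht; omega
  · intro t ht
    rcases hcases ht with ht | rfl
    · rw [hB t ht, Function.update_of_ne]
      · exact h.vertex_null' t ht
      · have := h.B_ge t ht; omega
    · rw [hB', hP, Function.update_self]
  · intro l hl hl' h1 h2
    have h3 := h2 tB (by omega)
    rw [hB', hP] at h3
    rw [Function.update_of_ne (Ne.symm h3)]
    refine h.vertex_eq l hl hl' h1 (fun t ht => ?_)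
    have := h2 t (by omega)
    rwa [hB t ht] at this
  · intro t ht x hx hG' hlt hle hlj
    exact h.F_closed t ht x hx hG' hlt hle (by omega)
  · intro t ht x hx hG' hlt hle hlj
    rcases hcases ht with ht | rfl
    · rw [hB t ht] at hG' hlt
      rcases hle.eq_or_lt with he | hl
      · exact ⟨tB, by omega, by rw [hB', he, hN.vertex_pos x hx]⟩
      · by_cases hxi : j ≤ P x
        · obtain ⟨t', ht', e⟩ := h.B_closed t ht x hx hG' hlt hxi hlj
          exact ⟨t', by omega, by rw [hB t' ht', e]⟩
        · refine absurd ?_ (hno (P x) (by omega) (by omega) t ht)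
          rwa [hN.vertex_pos x hx]
    · rw [hB', hP] at hlt; omega

end SearchState

/-- Advancing `i` costs about the size of `F` per position, which is exactly what the sum of the
distances from the elements of `F` to `i` gains. This pays for the scans. -/
theorem sum_sub_add {P : ℕ → ℕ} {m i i' : ℕ} (h : ∀ t < m, P t ≤ i) (hi : i ≤ i') :
    ∑ t ∈ Finset.range m, (i' - P t) = ∑ t ∈ Finset.range m, (i - P t) + m * (i' - i) := by
  rw [show m * (i' - i) = ∑ _t ∈ Finset.range m, (i' - i) by simp, ← Finset.sum_add_distrib]
  refine Finset.sum_congr rfl fun t ht => ?_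
  have := h t (Finset.mem_range.mp ht)
  omega

theorem sum_sub_add' {P : ℕ → ℕ} {m j j' : ℕ} (h : ∀ t < m, j ≤ P t) (hj : j' ≤ j) :
    ∑ t ∈ Finset.range m, (P t - j') = ∑ t ∈ Finset.range m, (P t - j) + m * (j - j') := by
  rw [show m * (j - j') = ∑ _t ∈ Finset.range m, (j - j') by simp, ← Finset.sum_add_distrib]
  refine Finset.sum_congr rfl fun t ht => ?_
  have := h t (Finset.mem_range.mp ht)
  omega

theorem sum_range_update (g : ℕ → ℕ) (F : ℕ → ℕ) (m x : ℕ) :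
    ∑ t ∈ Finset.range (m + 1), g (Function.update F m x t) =
      ∑ t ∈ Finset.range m, g (F t) + g x := by
  rw [Finset.sum_range_succ, Function.update_self]
  congr 1
  refine Finset.sum_congr rfl fun t ht => ?_
  rw [Function.update_of_ne (Finset.mem_range.mp ht).ne]

/-- The outcome of the search: the queues `F` and `B`, the meeting point `k`, and the positions
`vx` from which the elements of the queues are removed. -/
structure SearchResult (n N : ℕ) (C : ℕ → Prop) (V P : ℕ → ℕ) (G : ℕ → ℕ → Prop) (v w : ℕ)
    (k tF tB : ℕ) (F B vx : ℕ → ℕ) : Prop where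
  state : SearchState n N C V P G v w k k tF tB F B vx
  meet : (tF = tB ∧ (∃ t < tB, P (B t) = k) ∧ ∀ t < tF, P (F t) < k) ∨
    (tF = tB + 1 ∧ (∃ t < tF, P (F t) = k) ∧ ∀ t < tB, k < P (B t))
  pos_lt : P w < k
  le_pos : k ≤ P v

/-- The time is charged to the distances between the elements of the queues and the meeting point.
Every searched element is later moved across that distance, so this turns into a bound by the
displacement. -/
theorem wp_topologicalSearch {n N v w : ℕ} {C : ℕ → Prop} {s : Mem}
    (hN : IsNumbering C (s.arr .vertex) (s.arr .position) N) (hv : C v) (hw : C w)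
    (hlt : s.arr .position w < s.arr .position v) {Q : ℕ × ℕ × ℕ → Mem → Prop}
    (hQ : ∀ k tF tB s', SearchResult n N C (s.arr .vertex) (s.arr .position)
        (fun x y => s.adj x y = 1) v w k tF tB (s'.arr .fwd) (s'.arr .bwd) (s'.arr .vertex) →
      AgreeExcept (fun a => a = .fwd ∨ a = .bwd ∨ a = .vertex) s s' →
      s'.clock ≤ s.clock + 6 +
        10 * (∑ t ∈ Finset.range tF, (k - s.arr .position (s'.arr .fwd t)) +
          ∑ t ∈ Finset.range tB, (s.arr .position (s'.arr .bwd t) - k)) → Q (k, tF, tB) s') :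
    wp (topologicalSearch n v w) Q s := by
  set P := s.arr .position
  set V := s.arr .vertex
  set G : ℕ → ℕ → Prop := fun x y => s.adj x y = 1 with hG
  simp only [topologicalSearch, wp_bind, wp_write, wp_read]
  -- After a full round the queues have equal sizes and `i`, `j` are positions of elements of `F`,
  -- `B`. This yields the two forms of `SearchResult.meet` at the two exits.
  let I : ℕ × ℕ × ℕ × ℕ → Mem → Prop := fun c t =>
    SearchState n N C V P G v w c.1 c.2.1 c.2.2.1 c.2.2.2
      (t.arr .fwd) (t.arr .bwd) (t.arr .vertex) ∧
    c.2.2.1 = c.2.2.2 ∧ c.1 < c.2.1 ∧ c.2.1 ≤ P v ∧ P w ≤ c.1 ∧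
    (∃ u < c.2.2.1, P (t.arr .fwd u) = c.1) ∧ (∃ u < c.2.2.2, P (t.arr .bwd u) = c.2.1) ∧
    AgreeExcept (fun a => a = .fwd ∨ a = .bwd ∨ a = .vertex) s t ∧
    t.clock ≤ s.clock + 6 +
        10 * (∑ u ∈ Finset.range c.2.2.1, (c.1 - P (t.arr .fwd u)) +
          ∑ u ∈ Finset.range c.2.2.2, (P (t.arr .bwd u) - c.2.1))
  have hPv := hN.pos_le v hv
  have hPw := hN.pos_ge w hw
  refine wp_loop I (fun c _ => c.2.1 - c.1) ?_ ?_
  · rintro ⟨i, j, tF, tB⟩ t ⟨hS, htt, hij, hjv, hwi, hF, hB, hA, hc⟩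
    dsimp only at hS htt hij hjv hwi hF hB hc ⊢
    subst htt
    have hadj : t.adj = s.adj := hA.adj
    have hvx : ∀ l, i < l → l < j → t.arr .vertex l = V l := fun l h1 h2 =>
      hS.vertex_eq l (by omega) (by omega) (fun u hu => by have := hS.F_le u hu; omega)
        (fun u hu => by have := hS.B_ge u hu; omega)
    have hpos := hS.F_pos
    rw [wp_bind]
    refine wp_scanUp (by omega) fun i' c h1 h2 h3 h4 h5 => ?_
    dsimp only at h3 h4 h5
    have hno : ∀ l, i < l → l < i' → ∀ u < tF, ¬ G (t.arr .fwd u) (V l) := fun l hl hl' u hu => by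
      rw [← hvx l hl (by omega)]; simpa [hG, hadj] using h3 l hl hl' u hu
    have hsum := sum_sub_add (P := fun u => P (t.arr .fwd u)) hS.F_le (by omega : i ≤ i')
    -- `F` is nonempty and at least one position is passed, so the scan takes at most `6 * tF * (i'
    -- - i)` steps; the slack up to `10` covers the tick of the loop and three more accesses.
    have hcost : c + 3 ≤ t.clock + 10 * (tF * (i' - i)) := by
      have e1 : (i' - (i + 1) + 1) * (3 * tF + 3) = 3 * (tF * (i' - i)) + 3 * (i' - i) := by
        rw [show i' - (i + 1) + 1 = i' - i by omega]; ring
      have e2 : i' - i ≤ tF * (i' - i) := Nat.le_mul_of_pos_left _ hpos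
      rw [e1] at h5
      omega
    split_ifs with hend
    -- Exit on the way up: `k` is the position of an element of `B`, and the queues have equal
    -- sizes.
    · simp only [wp_pure, Sum.elim_inl]
      subst hend
      refine hQ _ _ _ _ ⟨hS.skipF hN (by omega) hno rfl, Or.inl ⟨rfl, hB, fun u hu => ?_⟩,
        by omega, hjv⟩ ⟨hA.arr, hA.adj⟩ ?_
      · have := hS.F_le u hu
        dsimp only; omega
      · dsimp only at hsum ⊢
        rw [hsum]; omega
    · have hi'j : i' < j := by omega
      simp only [wp_bind, wp_read, wp_write]
      have hG' : ∃ u < tF, G (t.arr .fwd u) (V i') := by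
        obtain ⟨u, hu, h⟩ := h4 hi'j
        rw [hvx i' (by omega) hi'j] at h
        exact ⟨u, hu, by simpa [hG, hadj] using h⟩
      have hS' := hS.pushF hN (by omega) hi'j (by omega) hno hG'
      have hPi' : P (V i') = i' := hN.pos_vertex i' (by omega) (by omega)
      -- The new element lies at `i'` itself and adds distance zero.
      have hsum' : ∑ u ∈ Finset.range (tF + 1),
          (i' - P (Function.update (t.arr .fwd) tF (V i') u)) =
          ∑ u ∈ Finset.range tF, (i - P (t.arr .fwd u)) + tF * (i' - i) := by
        rw [sum_range_update (fun x => i' - P x), hPi', ← hsum]; simp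
      have hvi := hvx i' (by omega) hi'j
      have hi'0 : 0 < i' - i := by omega
      refine wp_scanDown (by omega) fun j' c' k1 k2 k3 k4 k5 => ?_
      simp [Function.update_of_ne] at k3 k4 k5 ⊢
      rw [hvi]
      have hvx' : ∀ l, i' < l → l < j → Function.update (t.arr .vertex) i' n l = V l :=
        fun l h1 h2 => by rw [Function.update_of_ne (by omega)]; exact hvx l (by omega) h2
      have hno' : ∀ l, j' < l → l < j → ∀ u < tF, ¬ G (V l) (t.arr .bwd u) :=
        fun l hl hl' u hu => by
          rw [← hvx' l (k1.trans_lt hl) hl']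
          simpa [hG, hadj] using k3 l hl (Nat.le_sub_one_of_lt hl') u hu
      have hsumB := sum_sub_add' (P := fun u => P (t.arr .bwd u)) hS.B_ge
        (k2.trans (Nat.sub_le _ _))
      have hcost' : c' + 3 ≤ c + 2 + 10 * (tF * (j - j')) := by
        have e1 : (j - 1 - j' + 1) * (3 * tF + 3) = 3 * (tF * (j - j')) + 3 * (j - j') := by
          rw [show j - 1 - j' + 1 = j - j' by clear k4; omega]; ring
        have e2 : j - j' ≤ tF * (j - j') := Nat.le_mul_of_pos_left _ hpos
        rw [e1] at k5
        omega
      split_ifs with hend'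
      -- Exit on the way down: `k` is the position of the element just appended to `F`, which is now
      -- longer than `B` by one.
      · simp only [wp_pure, Sum.elim_inl]
        subst hend'
        refine hQ _ _ _ _ ⟨?_, Or.inr ⟨rfl, ⟨tF, by omega, ?_⟩, fun u hu => ?_⟩,
          by omega, by omega⟩ ⟨?_, hA.adj⟩ ?_
        · simpa [Function.update_of_ne] using hS'.skipB hN (by omega) hno' rfl
        · simpa [Function.update_of_ne] using hPi'
        · have := hS.B_ge u hu
          simp [Function.update_of_ne]; omega
        · intro a ha
          have := hA.arr a ha
          push Not at ha
          simpa [ha] using this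
        · simp [Function.update_of_ne]
          rw [hsum', hsumB]
          omega
      · simp only [wp_bind, wp_map, wp_read, wp_write, Sum.elim_inr]
        have hij' : i' < j' := by omega
        have hB'' : ∃ u < tF, G (V j') (t.arr .bwd u) := by
          obtain ⟨u, hu, h⟩ := k4 hij'
          rw [hvx' j' hij' (by omega)] at h
          exact ⟨u, hu, by simpa [hG, hadj] using h⟩
        have hS'' := hS'.pushB hN (by omega) hij' (by omega) hno' hB''
        have hPj' : P (V j') = j' := hN.pos_vertex j' (by omega) (by omega)
        have hsumB' : ∑ u ∈ Finset.range (tF + 1),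
            (P (Function.update (t.arr .bwd) tF (V j') u) - j') =
            ∑ u ∈ Finset.range tF, (P (t.arr .bwd u) - j) + tF * (j - j') := by
          rw [sum_range_update (fun x => P x - j'), hPj', ← hsumB]; simp
        have hvj := hvx' j' hij' (by omega)
        simp [Function.update_of_ne, I]
        rw [hvj]
        refine ⟨⟨hS'', hij', by omega, by omega, ⟨tF, by omega, ?_⟩, ⟨tF, by omega, ?_⟩, ⟨?_, hA.adj⟩, ?_⟩, by omega⟩
        · simpa using hPi'
        · simpa using hPj'
        · intro a ha
          have := hA.arr a ha
          push Not at ha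
          simpa [ha] using this
        · rw [hsum', hsumB']; omega
  · have hne : w ≠ v := by rintro rfl; omega
    simp [I, Function.update_of_ne]
    refine ⟨?_, hlt, le_refl (P v), le_refl (P w), rfl, rfl, ?_, rfl⟩
    · have h1 : ∀ {t}, t < 1 → t = 0 := fun h => by omega
      have hF : ∀ {t}, t < 1 → Function.update (s.arr .fwd) 0 w t = w := fun h => by
        rw [h1 h, Function.update_self]
      have hB : ∀ {t}, t < 1 → Function.update (s.arr .bwd) 0 v t = v := fun h => by
        rw [h1 h, Function.update_self]
      refine { F_zero := hF one_pos, B_zero := hB one_pos, F_pos := le_rfl, B_pos := le_rfl,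
               F_can := ?_, B_can := ?_, F_le := ?_, B_ge := ?_, F_mono := by omega,
               B_anti := by omega, F_lt_B := ?_, F_pred := by omega, B_pred := by omega,
               vertex_null := ?_, vertex_null' := ?_, vertex_eq := ?_, F_closed := ?_,
               B_closed := ?_ }
      · intro t ht; rwa [hF ht]
      · intro t ht; rwa [hB ht]
      · intro t ht; rw [hF ht]
      · intro t ht; rw [hB ht]
      · intro t ht t' ht'; rwa [hF ht, hB ht']
      · intro t ht; rw [hF ht, Function.update_of_ne hlt.ne, Function.update_self]
      · intro t ht; rw [hB ht, Function.update_self]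
      · intro l _ _ h2 h3
        have h2 := h2 0 one_pos
        have h3 := h3 0 one_pos
        rw [hF one_pos] at h2
        rw [hB one_pos] at h3
        rw [Function.update_of_ne h3.symm, Function.update_of_ne h2.symm]
      · intro t ht x _ _ h2 h3; rw [hF ht] at h2; exact absurd h3 h2.not_ge
      · intro t ht x _ _ h2 h3; rw [hB ht] at h2; exact absurd h3 h2.not_ge
    · intro a ha
      push Not at ha
      simp [ha]

/-! ### Depth-first search for the new component -/

theorem wp_collect {s : Mem} {tF tB : ℕ} {Q : Unit → Mem → Prop}
    (hQ : ∀ s', (∀ t < tF, s'.arr .found t = s.arr .fwd t) →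
      (∀ t < tB, s'.arr .found (tF + t) = s.arr .bwd t) →
      (∀ t < tF + tB, s'.arr .visited (s'.arr .found t) = 0 ∧ s'.arr .mark (s'.arr .found t) = 0 ∧
        s'.arr .next (s'.arr .found t) = 0) →
      AgreeExcept (fun a => a = .found ∨ a = .visited ∨ a = .mark ∨ a = .next) s s' →
      s'.clock ≤ s.clock + 8 * (tF + tB) → Q () s') :
    wp (collect tF tB) Q s := by
  rw [collect, wp_bind]
  refine wp_forRange (fun i s' => (∀ t < i, s'.arr .found t = s.arr .fwd t) ∧
    AgreeExcept (· = .found) s s' ∧ s'.clock ≤ s.clock + 3 * i) ?_ ?_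
    ⟨by omega, AgreeExcept.refl _ _, by omega⟩
  · rintro i hi s' ⟨h1, h2, h3⟩
    simp only [wp_bind, wp_read, wp_write]
    refine ⟨fun t ht => ?_, ⟨fun a ha => ?_, h2.adj⟩, by omega⟩
    · rw [Function.update_self]
      rcases Nat.lt_succ_iff_lt_or_eq.mp ht with h | rfl
      · rw [Function.update_of_ne h.ne, h1 t h]
      · rw [Function.update_self, h2.arr .fwd (by simp)]
    · exact (Function.update_of_ne ha _ _).trans (h2.arr a ha)
  rintro s1 ⟨h1, hA1, hc1⟩
  rw [wp_bind]
  refine wp_forRange (fun i s' => (∀ t < tF, s'.arr .found t = s.arr .fwd t) ∧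
    (∀ t < i, s'.arr .found (tF + t) = s.arr .bwd t) ∧
    AgreeExcept (· = .found) s s' ∧ s'.clock ≤ s.clock + 3 * (tF + i)) ?_ ?_
    ⟨h1, by omega, hA1, hc1⟩
  · rintro i hi s' ⟨h1, h2, hA, h3⟩
    simp only [wp_bind, wp_read, wp_write]
    refine ⟨fun t ht => ?_, fun t ht => ?_, ⟨fun a ha => ?_, hA.adj⟩, by omega⟩
    · rw [Function.update_self, Function.update_of_ne (by omega), h1 t ht]
    · rw [Function.update_self]
      rcases Nat.lt_succ_iff_lt_or_eq.mp ht with h | rfl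
      · rw [Function.update_of_ne (by omega), h2 t h]
      · rw [Function.update_self, hA.arr .bwd (by simp)]
    · exact (Function.update_of_ne ha _ _).trans (hA.arr a ha)
  rintro s2 ⟨hF, hB, hA2, hc2⟩
  refine wp_forRange (fun i s' => s'.arr .found = s2.arr .found ∧
    (∀ t < i, s'.arr .visited (s2.arr .found t) = 0 ∧ s'.arr .mark (s2.arr .found t) = 0 ∧
      s'.arr .next (s2.arr .found t) = 0) ∧
    AgreeExcept (fun a => a = .found ∨ a = .visited ∨ a = .mark ∨ a = .next) s s' ∧
    s'.clock ≤ s2.clock + 5 * i) ?_ ?_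
    ⟨rfl, by omega, hA2.mono fun _ h => Or.inl h, by omega⟩
  · rintro i hi s' ⟨h1, h2, hA, h3⟩
    simp only [wp_bind, wp_read, wp_write]
    refine ⟨by simpa using h1, fun t ht => ?_, ⟨fun a ha => ?_, hA.adj⟩, by omega⟩
    · have : t < i ∨ t = i := by omega
      rcases this with h | rfl
      · obtain ⟨h4, h5, h6⟩ := h2 t h
        simp [Function.update_apply, h4, h5, h6]
      · simp [h1]
    · have := hA.arr a ha
      push Not at ha
      simpa [ha] using this
  rintro s3 ⟨hf, h0, hA3, hc3⟩
  refine hQ s3 ?_ ?_ ?_ hA3 (by omega)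
  · intro t ht; rw [hf, hF t ht]
  · intro t ht; rw [hf, hB t ht]
  · intro t ht; rw [hf]; exact h0 t ht

/-- `x` is among the first `size` entries of `fd`. -/
def Listed (size : ℕ) (fd : ℕ → ℕ) (x : ℕ) : Prop := ∃ t < size, fd t = x

/-- Reachability in the graph induced by the first `size` entries of `fd`. -/
def ReachIn (size : ℕ) (fd : ℕ → ℕ) (G : ℕ → ℕ → Prop) : ℕ → ℕ → Prop :=
  Relation.ReflTransGen fun x y => Listed size fd x ∧ Listed size fd y ∧ G x y

/-- A state of the depth-first search with stack `st 0, …, st (h - 1)`. -/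
structure DFSState (size : ℕ) (fd : ℕ → ℕ) (G : ℕ → ℕ → Prop) (P : ℕ → ℕ) (v w h : ℕ)
    (st nx vis mk : ℕ → ℕ) : Prop where
  stack_mem : ∀ l < h, Listed size fd (st l)
  stack_vis : ∀ l < h, vis (st l) = 1
  stack_mono : ∀ l l', l < l' → l' < h → P (st l) < P (st l')
  stack_arc : ∀ l, l + 1 < h → G (st l) (st (l + 1))
  vis_start : vis w = 1
  reach : ∀ x, Listed size fd x → vis x = 1 → ReachIn size fd G w x
  sound : ∀ x, Listed size fd x → mk x = 1 → vis x = 1 ∧ ReachIn size fd G x v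
  mark_target : vis v = 1 → mk v = 1
  closed : ∀ x, Listed size fd x → vis x = 1 → ∀ t < nx x, G x (fd t) → vis (fd t) = 1 ∧
    (x ≠ v → (∃ l, l + 1 < h ∧ st l = x ∧ st (l + 1) = fd t) ∨
      ((∀ l < h, st l ≠ fd t) ∧ (mk (fd t) = 1 → mk x = 1)))
  done : ∀ x, Listed size fd x → vis x = 1 → (∀ l < h, st l ≠ x) → nx x = size
  next_le : ∀ x, Listed size fd x → nx x ≤ size
  next_zero : ∀ x, Listed size fd x → vis x ≠ 1 → nx x = 0

namespace DFSState

variable {size : ℕ} {fd : ℕ → ℕ} {G : ℕ → ℕ → Prop} {P : ℕ → ℕ} {v w h : ℕ}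
  {st nx vis mk : ℕ → ℕ}

theorem init (hw : Listed size fd w) (hvw : v ≠ w) {st0 : ℕ → ℕ}
    (hvis : ∀ x, Listed size fd x → vis x = 0) (hmk : ∀ x, Listed size fd x → mk x = 0)
    (hnx : ∀ x, Listed size fd x → nx x = 0) (hv : Listed size fd v) :
    DFSState size fd G P v w 1 (Function.update st0 0 w) nx (Function.update vis w 1) mk := by
  have h0 : ∀ {l}, l < 1 → Function.update st0 0 w l = w := fun h => by
    rw [show _ = 0 from Nat.lt_one_iff.mp h, Function.update_self]
  have hvis' : ∀ x, Listed size fd x → Function.update vis w 1 x = 1 → x = w := by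
    intro x hx h
    by_contra hne
    rw [Function.update_of_ne hne, hvis x hx] at h
    omega
  refine { stack_mem := ?_, stack_vis := ?_, stack_mono := by omega, stack_arc := by omega,
           vis_start := by simp, reach := ?_, sound := ?_, mark_target := ?_, closed := ?_,
           done := ?_, next_le := ?_, next_zero := fun x hx _ => hnx x hx }
  · intro l hl; rwa [h0 hl]
  · intro l hl; simp [h0 hl]
  · intro x hx hv; rw [hvis' x hx hv]; exact Relation.ReflTransGen.refl
  · intro x hx hm; rw [hmk x hx] at hm; omega
  · intro h; exact absurd (hvis' v hv h) hvw
  · intro x hx _ t ht; rw [hnx x hx] at ht; omega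
  · intro x hx h h'; exact absurd ((h0 one_pos).trans (hvis' x hx h).symm) (h' 0 one_pos)
  · intro x hx; rw [hnx x hx]; omega

variable (H : DFSState size fd G P v w h st nx vis mk)

include H in
-- The stack is increasing in `P`, and so are all arcs except the one from `v` to `w`. Hence an arc
-- from the top, if the top is not `v`, cannot lead back into the stack. The mark of a vertex seen
-- again is therefore already final.
theorem not_onStack (hpos : 0 < h)
    (hP : ∀ x z, Listed size fd x → Listed size fd z → G x z → P x < P z ∨ x = v ∧ z = w)
    {x : ℕ} (hx : Listed size fd x) (hG : G (st (h - 1)) x) (hv : st (h - 1) ≠ v) :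
    ∀ l < h, st l ≠ x := by
  rintro l hl rfl
  have h1 : P (st (h - 1)) < P (st l) :=
    (hP _ _ (H.stack_mem _ (by omega)) hx hG).resolve_right fun h => hv h.1
  rcases (show l ≤ h - 1 by omega).eq_or_lt with rfl | hlt
  · omega
  · have := H.stack_mono l (h - 1) hlt (by omega)
    omega

include H in
/-- The next candidate is skipped, or it has been visited before. -/
theorem advance (hpos : 0 < h) (hlt : nx (st (h - 1)) < size)
    (hP : ∀ x z, Listed size fd x → Listed size fd z → G x z → P x < P z ∨ x = v ∧ z = w)
    {mk' : ℕ → ℕ} (hmk : ∀ y, mk' y = mk y ∨ y = st (h - 1) ∧ mk' y = 1 ∧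
      G y (fd (nx (st (h - 1)))) ∧ mk (fd (nx (st (h - 1)))) = 1)
    (hvis : G (st (h - 1)) (fd (nx (st (h - 1)))) → vis (fd (nx (st (h - 1)))) = 1 ∧
      (mk (fd (nx (st (h - 1)))) = 1 → mk' (st (h - 1)) = 1)) :
    DFSState size fd G P v w h st
      (Function.update nx (st (h - 1)) (nx (st (h - 1)) + 1)) vis mk' := by
  set u := st (h - 1) with hu
  have huS : Listed size fd u := H.stack_mem _ (by omega)
  have huV : vis u = 1 := H.stack_vis _ (by omega)
  have hmono : ∀ y, mk y = 1 → mk' y = 1 := by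
    intro y hy
    rcases hmk y with h | h
    · rw [h, hy]
    · exact h.2.1
  have hxS : Listed size fd (fd (nx u)) := ⟨_, hlt, rfl⟩
  have hmkne : ∀ y, y ≠ u → mk' y = mk y := fun y hy =>
    (hmk y).resolve_right fun h => hy h.1
  refine { H with sound := ?_, mark_target := fun hv => hmono v (H.mark_target hv), closed := ?_,
                  done := ?_, next_le := ?_, next_zero := ?_ }
  · intro x hx hm
    rcases hmk x with h | ⟨rfl, _, hG, hm'⟩
    · exact H.sound x hx (h ▸ hm)
    · exact ⟨huV, Relation.ReflTransGen.head ⟨hx, hxS, hG⟩ (H.sound _ hxS hm').2⟩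
  · intro x hx hv t ht hG
    -- The arc being processed is the only new one. Its head is off the stack, so in particular it
    -- is not `u`, and its mark is not affected by marking `u`.
    by_cases hxu : x = u ∧ t = nx u
    · obtain ⟨rfl, rfl⟩ := hxu
      obtain ⟨h1, h2⟩ := hvis hG
      refine ⟨h1, fun hne => Or.inr ⟨H.not_onStack hpos hP hxS hG hne, fun hm => h2 ?_⟩⟩
      rwa [hmkne] at hm
      exact fun he => H.not_onStack hpos hP hxS hG hne (h - 1) (by omega) (hu ▸ he.symm)
    · have ht' : t < nx x := by
        by_cases e : x = u
        · rw [e, Function.update_self] at ht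
          have : t ≠ nx u := fun e' => hxu ⟨e, e'⟩
          rw [e]; omega
        · rwa [Function.update_of_ne e] at ht
      obtain ⟨h1, h2⟩ := H.closed x hx hv t ht' hG
      refine ⟨h1, fun hne => (h2 hne).imp_right fun ⟨h3, h4⟩ => ⟨h3, fun hm => ?_⟩⟩
      rw [hmkne _ fun e => h3 (h - 1) (by omega) (hu ▸ e.symm)] at hm
      exact hmono x (h4 hm)
  · intro x hx hv hns
    rw [Function.update_of_ne fun e => hns (h - 1) (by omega) (hu ▸ e.symm)]
    exact H.done x hx hv hns
  · intro x hx
    by_cases e : x = u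
    · rw [e, Function.update_self]; omega
    · rw [Function.update_of_ne e]; exact H.next_le x hx
  · intro x hx hv
    have : x ≠ u := by rintro rfl; exact hv huV
    rw [Function.update_of_ne this]; exact H.next_zero x hx hv

include H in
-- The new arc from `u` to the fresh vertex joins the stack alternative of `closed`: its mark is to
-- be passed on at retreat.
theorem push (hpos : 0 < h) (hlt : nx (st (h - 1)) < size)
    (hP : ∀ x z, Listed size fd x → Listed size fd z → G x z → P x < P z ∨ x = v ∧ z = w)
    (hG : G (st (h - 1)) (fd (nx (st (h - 1))))) (hnv : vis (fd (nx (st (h - 1)))) ≠ 1)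
    {mk' : ℕ → ℕ} (hmkv : fd (nx (st (h - 1))) = v → mk' v = 1)
    (hmk : ∀ y, mk' y = mk y ∨ y = v ∧ y = fd (nx (st (h - 1)))) :
    DFSState size fd G P v w (h + 1) (Function.update st h (fd (nx (st (h - 1)))))
      (Function.update nx (st (h - 1)) (nx (st (h - 1)) + 1))
      (Function.update vis (fd (nx (st (h - 1)))) 1) mk' := by
  set u := st (h - 1) with hu
  set x₀ := fd (nx u) with hx₀
  have huS : Listed size fd u := H.stack_mem _ (by omega)
  have huV : vis u = 1 := H.stack_vis _ (by omega)
  have hxS : Listed size fd x₀ := ⟨_, hlt, rfl⟩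
  have hxu : u ≠ x₀ := fun e => hnv (e ▸ huV)
  -- The start is visited from the beginning, so a fresh vertex is not `w`; the arc is then not the
  -- exceptional one and `P` increases along the stack.
  have hxw : x₀ ≠ w := fun e => hnv (e ▸ H.vis_start)
  have hPux : P u < P x₀ := (hP u x₀ huS hxS hG).resolve_right fun h => hxw h.2
  have hst : ∀ l < h, Function.update st h x₀ l = st l := fun l hl =>
    Function.update_of_ne hl.ne _ _
  have hst' : Function.update st h x₀ h = x₀ := Function.update_self ..
  have hvis : ∀ y, vis y = 1 → Function.update vis x₀ 1 y = 1 := fun y hy => by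
    rw [Function.update_apply]; split_ifs
    · rfl
    · exact hy
  have hvis' : ∀ y, Function.update vis x₀ 1 y = 1 → y = x₀ ∨ vis y = 1 := fun y hy => by
    by_cases e : y = x₀
    · exact Or.inl e
    · rw [Function.update_of_ne e] at hy; exact Or.inr hy
  have hmkne : ∀ y, y ≠ x₀ → mk' y = mk y := fun y hy => (hmk y).resolve_right fun h => hy h.2
  have hcases : ∀ {l}, l < h + 1 → l < h ∨ l = h := fun hl => by omega
  have hreach : ReachIn size fd G w x₀ := (H.reach u huS huV).tail ⟨huS, hxS, hG⟩
  refine { stack_mem := ?_, stack_vis := ?_, stack_mono := ?_, stack_arc := ?_,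
           vis_start := hvis _ H.vis_start, reach := ?_, sound := ?_, mark_target := ?_,
           closed := ?_, done := ?_, next_le := ?_, next_zero := ?_ }
  · intro l hl
    rcases hcases hl with hl | rfl
    · rw [hst l hl]; exact H.stack_mem l hl
    · rwa [hst']
  · intro l hl
    rcases hcases hl with hl | rfl
    · rw [hst l hl]; exact hvis _ (H.stack_vis l hl)
    · rw [hst', Function.update_self]
  · intro l l' hll hl
    rcases hcases hl with hl | rfl
    · rw [hst l' hl, hst l (by omega)]; exact H.stack_mono l l' hll hl
    · rw [hst', hst l hll]
      rcases (show l ≤ l' - 1 by omega).eq_or_lt with rfl | hlt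
      · exact hPux
      · exact (H.stack_mono l (l' - 1) hlt (by omega)).trans hPux
  · intro l hl
    rcases hcases hl with hl | hl
    · rw [hst _ hl, hst l (by omega)]; exact H.stack_arc l hl
    · rw [hl, hst', hst l (by omega), show l = h - 1 by omega]; exact hG
  · intro x hx hv
    rcases hvis' x hv with rfl | hv
    · exact hreach
    · exact H.reach x hx hv
  · intro x hx hm
    rcases hmk x with e | ⟨rfl, e⟩
    · have := H.sound x hx (e ▸ hm)
      exact ⟨hvis _ this.1, this.2⟩
    · exact ⟨by rw [e, Function.update_self], Relation.ReflTransGen.refl⟩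
  · intro hv
    rcases hvis' v hv with e | hv
    · exact hmkv e.symm
    · rw [hmkne v fun e => hnv (e ▸ hv)]; exact H.mark_target hv
  · intro x hx hv t ht hGt
    rcases hvis' x hv with rfl | hv
    · rw [Function.update_of_ne hxu.symm, H.next_zero _ hx hnv] at ht; omega
    have hxx₀ : x ≠ x₀ := fun e => hnv (e ▸ hv)
    by_cases hxt : x = u ∧ t = nx u
    · obtain ⟨rfl, rfl⟩ := hxt
      refine ⟨by rw [← hx₀, Function.update_self], fun _ => Or.inl ⟨h - 1, by omega, ?_, ?_⟩⟩
      · rw [hst _ (by omega)]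
      · rw [show h - 1 + 1 = h by omega, hst']
    · have ht' : t < nx x := by
        by_cases e : x = u
        · rw [e, Function.update_self] at ht
          have : t ≠ nx u := fun e' => hxt ⟨e, e'⟩
          rw [e]; omega
        · rwa [Function.update_of_ne e] at ht
      obtain ⟨h1, h2⟩ := H.closed x hx hv t ht' hGt
      have hne : fd t ≠ x₀ := fun e => hnv (e ▸ h1)
      refine ⟨hvis _ h1, fun hxv => ?_⟩
      rcases h2 hxv with ⟨l, hl, e1, e2⟩ | ⟨h3, h4⟩
      · exact Or.inl ⟨l, by omega, by rw [hst _ (by omega), e1], by rw [hst _ hl, e2]⟩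
      · refine Or.inr ⟨fun l hl => ?_, fun hm => ?_⟩
        · rcases hcases hl with hl | rfl
          · rw [hst l hl]; exact h3 l hl
          · rw [hst']; exact hne.symm
        · rw [hmkne x hxx₀]
          rw [hmkne _ hne] at hm
          exact h4 hm
  · intro x hx hv hns
    have h1 : x ≠ x₀ := fun e => hns h (by omega) (by rw [hst', e])
    have h2 : ∀ l < h, st l ≠ x := fun l hl => by
      have := hns l (by omega); rwa [hst l hl] at this
    rw [Function.update_of_ne fun e => h2 (h - 1) (by omega) (hu ▸ e.symm)]
    exact H.done x hx ((hvis' x hv).resolve_left h1) h2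
  · intro x hx
    by_cases e : x = u
    · rw [e, Function.update_self]; omega
    · rw [Function.update_of_ne e]; exact H.next_le x hx
  · intro x hx hv
    have h1 : vis x ≠ 1 := fun e => hv (hvis x e)
    have : x ≠ u := by rintro rfl; exact h1 huV
    rw [Function.update_of_ne this]; exact H.next_zero x hx h1

include H in
-- The top has tried every candidate. Handing its mark to the vertex below turns the stack
-- alternative of `closed` for that tree arc into the finished one.
theorem pop (hpos : 0 < h) (hge : ¬ nx (st (h - 1)) < size) {mk' : ℕ → ℕ}
    (hmk : ∀ y, mk' y = mk y ∨ 1 < h ∧ y = st (h - 2) ∧ mk' y = 1 ∧ mk (st (h - 1)) = 1)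
    (hmk' : 1 < h → mk (st (h - 1)) = 1 → mk' (st (h - 2)) = 1) :
    DFSState size fd G P v w (h - 1) st nx vis mk' := by
  have huS : Listed size fd (st (h - 1)) := H.stack_mem _ (by omega)
  have hmono : ∀ y, mk y = 1 → mk' y = 1 := by
    intro y hy
    rcases hmk y with h | h
    · rw [h, hy]
    · exact h.2.2.1
  have hmkne : ∀ y, (∀ l < h, st l ≠ y) → mk' y = mk y := fun y hy =>
    (hmk y).resolve_right fun h => hy _ (by omega) h.2.1.symm
  refine { H with stack_mem := fun l hl => H.stack_mem l (by omega),
                  stack_vis := fun l hl => H.stack_vis l (by omega),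
                  stack_mono := fun l l' hll hl => H.stack_mono l l' hll (by omega),
                  stack_arc := fun l hl => H.stack_arc l (by omega),
                  sound := ?_, mark_target := fun hv => hmono v (H.mark_target hv),
                  closed := ?_, done := ?_ }
  · intro x hx hm
    rcases hmk x with e | ⟨h1, rfl, _, hm'⟩
    · exact H.sound x hx (e ▸ hm)
    · refine ⟨H.stack_vis _ (by omega), Relation.ReflTransGen.head ⟨hx, huS, ?_⟩
        (H.sound _ huS hm').2⟩
      have := H.stack_arc (h - 2) (by omega)
      rwa [show h - 2 + 1 = h - 1 by omega] at this
  · intro x hx hv t ht hG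
    obtain ⟨h1, h2⟩ := H.closed x hx hv t ht hG
    refine ⟨h1, fun hne => ?_⟩
    rcases h2 hne with ⟨l, hl, e1, e2⟩ | ⟨h3, h4⟩
    · by_cases hl' : l + 1 < h - 1
      · exact Or.inl ⟨l, hl', e1, e2⟩
      · obtain rfl : l = h - 2 := by omega
        rw [show h - 2 + 1 = h - 1 by omega] at e2
        refine Or.inr ⟨fun l hl' e => ?_, fun hm => ?_⟩
        · have := H.stack_mono l (h - 1) hl' (by omega)
          rw [e, e2] at this
          omega
        · rw [← e1]
          refine hmk' (by omega) ?_
          rw [e2]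
          rcases hmk (fd t) with e | ⟨_, e, _⟩
          · rwa [← e]
          · have := H.stack_mono (h - 2) (h - 1) (by omega) (by omega)
            rw [← e, e2] at this
            omega
    · refine Or.inr ⟨fun l hl => h3 l (by omega), fun hm => ?_⟩
      rw [hmkne _ h3] at hm
      exact hmono x (h4 hm)
  · intro x hx hv hns
    by_cases e : st (h - 1) = x
    · have := H.next_le x hx
      rw [e] at hge
      omega
    · refine H.done x hx hv fun l hl => ?_
      by_cases hl' : l < h - 1
      · exact hns l hl'
      · rwa [show l = h - 1 by omega]

/-- With an empty stack every visited vertex has tried all its arcs. So the visited set contains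
everything reachable from `w`, and marks propagate backwards along any path to `v`, whose own mark
was set on arrival. -/
theorem mark_iff (H : DFSState size fd G P v w 0 st nx vis mk) {x : ℕ}
    (hw : Listed size fd w) (hx : Listed size fd x) :
    mk x = 1 ↔ ReachIn size fd G w x ∧ ReachIn size fd G x v := by
  constructor
  · intro hm
    have := H.sound x hx hm
    exact ⟨H.reach x hx this.1, this.2⟩
  · rintro ⟨h1, h2⟩
    have hvis : vis x = 1 := by
      clear h2
      suffices Listed size fd x ∧ vis x = 1 from this.2
      induction h1 with
      | refl => exact ⟨hw, H.vis_start⟩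
      | tail _ h2 ih =>
        obtain ⟨hy, ⟨t, ht, rfl⟩, hG⟩ := h2
        refine ⟨⟨t, ht, rfl⟩, (H.closed _ hy (ih hy).2 t ?_ hG).1⟩
        rw [H.done _ hy (ih hy).2 (by omega)]
        exact ht
    clear h1
    induction h2 using Relation.ReflTransGen.head_induction_on with
    | refl => exact H.mark_target hvis
    | head h _ ih =>
      obtain ⟨hy, ⟨t, ht, rfl⟩, hG⟩ := h
      obtain ⟨h1, h2⟩ := H.closed _ hy hvis t (by rw [H.done _ hy hvis (by omega)]; exact ht) hG
      rename_i y _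
      by_cases e : y = v
      · rw [e] at hvis ⊢; exact H.mark_target hvis
      · rcases h2 e with ⟨l, hl, _⟩ | ⟨_, h3⟩
        · omega
        · exact h3 (ih ⟨t, ht, rfl⟩ h1)

end DFSState

theorem sum_sub_update_succ {S : Finset ℕ} {nx : ℕ → ℕ} {m u : ℕ} (hu : u ∈ S) (hlt : nx u < m) :
    ∑ x ∈ S, (m - Function.update nx u (nx u + 1) x) + 1 = ∑ x ∈ S, (m - nx x) := by
  rw [← Finset.add_sum_erase _ _ hu, ← Finset.add_sum_erase S (fun x => m - nx x) hu,
    Function.update_self]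
  have : ∑ x ∈ S.erase u, (m - Function.update nx u (nx u + 1) x) =
      ∑ x ∈ S.erase u, (m - nx x) :=
    Finset.sum_congr rfl fun x hx => by rw [Function.update_of_ne (Finset.ne_of_mem_erase hx)]
  rw [this]
  omega

theorem wp_findComponent {s : Mem} {size v w : ℕ} {P : ℕ → ℕ} (hvw : v ≠ w)
    (hv : Listed size (s.arr .found) v) (hw : Listed size (s.arr .found) w)
    (h0 : ∀ t < size, s.arr .visited (s.arr .found t) = 0 ∧ s.arr .mark (s.arr .found t) = 0 ∧
      s.arr .next (s.arr .found t) = 0)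
    (hP : ∀ x z, Listed size (s.arr .found) x → Listed size (s.arr .found) z → s.adj x z = 1 →
      P x < P z ∨ x = v ∧ z = w) {Q : Bool → Mem → Prop}
    (hQ : ∀ b s', (b = true ↔ s'.arr .mark w = 1) →
      (∀ x, Listed size (s.arr .found) x → (s'.arr .mark x = 1 ↔
        ReachIn size (s.arr .found) (fun x y => s.adj x y = 1) w x ∧
        ReachIn size (s.arr .found) (fun x y => s.adj x y = 1) x v)) →
      AgreeExcept (fun a => a = .visited ∨ a = .mark ∨ a = .next ∨ a = .stack) s s' →
      s'.clock ≤ s.clock + 20 * (size * size) + 20 → Q b s') :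
    wp (findComponent size v w) Q s := by
  simp only [findComponent, wp_bind, wp_write]
  set fd := s.arr .found with hfd
  set S : Finset ℕ := (Finset.range size).image fd with hS
  have hmem : ∀ x, x ∈ S ↔ Listed size fd x := by simp [hS, Listed]
  let I : ℕ → Mem → Prop := fun h t =>
    DFSState size fd (fun x y => s.adj x y = 1) P v w h (t.arr .stack) (t.arr .next)
      (t.arr .visited) (t.arr .mark) ∧
    AgreeExcept (fun a => a = .visited ∨ a = .mark ∨ a = .next ∨ a = .stack) s t ∧
    t.clock + 10 * (2 * ∑ x ∈ S, (size - t.arr .next x) + h) ≤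
      s.clock + 2 + 10 * (2 * (size * size) + 1)
  -- Trying a candidate lowers the sum by one and may lengthen the stack by one; a retreat shortens
  -- the stack. The potential thus drops in every iteration, and an iteration takes at most 10
  -- steps.
  refine wp_loop I (fun h t => 2 * ∑ x ∈ S, (size - t.arr .next x) + h) ?_ ?_
  · rintro h t ⟨H, hA, hc⟩
    have hf : t.arr .found = fd := hA.arr _ (by simp)
    have hadj : t.adj = s.adj := hA.adj
    have hA' : ∀ t' : Mem, t'.adj = t.adj →
        (∀ a, ¬(a = .visited ∨ a = .mark ∨ a = .next ∨ a = .stack) → t'.arr a = t.arr a) →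
        AgreeExcept (fun a => a = .visited ∨ a = .mark ∨ a = .next ∨ a = .stack) s t' :=
      fun t' h1 h2 => ⟨fun a ha => (h2 a ha).trans (hA.arr a ha), h1.trans hA.adj⟩
    refine wp_if (fun hh => ?_) (fun hh => ?_)
    · subst hh
      simp only [wp_pure, Sum.elim_inl, wp_read]
      refine hQ _ _ (by simp) (fun x hx => H.mark_iff hw hx) ⟨hA.arr, hA.adj⟩ ?_
      dsimp only
      omega
    · have hpos : 0 < h := Nat.pos_of_ne_zero hh
      simp only [wp_bind, wp_read]
      set u := t.arr .stack (h - 1) with hu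
      have huS : Listed size fd u := H.stack_mem _ (by omega)
      refine wp_if (fun hlt => ?_) (fun hlt => ?_)
      · have hsum := sum_sub_update_succ ((hmem u).mpr huS) hlt
        simp only [wp_bind, wp_write, wp_read, wp_readAdj, Function.update_of_ne (show Arr.found ≠ Arr.next by decide), hf, hadj]
        set x := fd (t.arr .next u) with hx
        refine wp_if (fun hb => ?_) (fun hb => ?_)
        · simp only [wp_bind, wp_read, Function.update_of_ne (show Arr.visited ≠ Arr.next by decide)]
          refine wp_if (fun hseen => ?_) (fun hseen => ?_)
          · simp only [wp_bind, wp_read, Function.update_of_ne (show Arr.mark ≠ Arr.next by decide)]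
            refine wp_if (fun hm => ?_) (fun hm => ?_)
            · simp only [wp_bind, wp_write, wp_pure, Sum.elim_inr]
              refine ⟨⟨?_, ?_, ?_⟩, ?_⟩
              · have := H.advance hpos hlt hP (mk' := Function.update (t.arr .mark) u 1)
                  (fun y => ?_) (fun _ => ⟨hseen, fun _ => Function.update_self ..⟩)
                · simpa using this
                · by_cases e : y = u
                  · right; subst e; exact ⟨rfl, by simp, hb, hm⟩
                  · left; rw [Function.update_of_ne e]
              · refine hA' _ hadj.symm fun a ha => ?_
                push Not at ha
                simp [ha]
              · simp; omega
              · simp; omega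
            · simp only [wp_pure, Sum.elim_inr]
              refine ⟨⟨?_, ?_, ?_⟩, ?_⟩
              · have := H.advance hpos hlt hP (mk' := t.arr .mark)
                  (fun y => Or.inl rfl) (fun _ => ⟨hseen, fun h => absurd h hm⟩)
                simpa using this
              · refine hA' _ hadj.symm fun a ha => ?_
                push Not at ha
                simp [ha]
              · simp; omega
              · simp; omega
          · simp only [wp_bind, wp_write]
            refine wp_if (fun hxv => ?_) (fun hxv => ?_)
            · simp only [wp_bind, wp_write, wp_pure, Sum.elim_inr]
              refine ⟨⟨?_, ?_, ?_⟩, ?_⟩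
              · have := H.push hpos hlt hP hb hseen (mk' := Function.update (t.arr .mark) x 1)
                  (fun _ => by rw [← hxv, Function.update_self]) (fun y => ?_)
                · simpa using this
                · by_cases e : y = x
                  · right; exact ⟨e.trans hxv, e⟩
                  · left; rw [Function.update_of_ne e]
              · refine hA' _ hadj.symm fun a ha => ?_
                push Not at ha
                simp [ha]
              · simp; omega
              · simp; omega
            · simp only [wp_bind, wp_write, wp_pure, Sum.elim_inr]
              refine ⟨⟨?_, ?_, ?_⟩, ?_⟩
              · have := H.push hpos hlt hP hb hseen (mk' := t.arr .mark)
                  (fun e => absurd e hxv) (fun y => Or.inl rfl)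
                simpa using this
              · refine hA' _ hadj.symm fun a ha => ?_
                push Not at ha
                simp [ha]
              · simp; omega
              · simp; omega
        · simp only [wp_pure, Sum.elim_inr]
          refine ⟨⟨?_, ?_, ?_⟩, ?_⟩
          · have := H.advance hpos hlt hP (mk' := t.arr .mark)
              (fun y => Or.inl rfl) (fun h => absurd h hb)
            simpa using this
          · refine hA' _ hadj.symm fun a ha => ?_
            push Not at ha
            simp [ha]
          · simp; omega
          · simp; omega
      · refine wp_if (fun h1 => ?_) (fun h1 => ?_)
        · simp only [wp_bind, wp_read]
          refine wp_if (fun hm => ?_) (fun hm => ?_)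
          · simp only [wp_bind, wp_write, wp_pure, Sum.elim_inr]
            refine ⟨⟨?_, ?_, ?_⟩, ?_⟩
            · have := H.pop hpos hlt
                (mk' := Function.update (t.arr .mark) (t.arr .stack (h - 2)) 1)
                (fun y => ?_) (fun _ _ => Function.update_self ..)
              · simpa using this
              · by_cases e : y = t.arr .stack (h - 2)
                · right; subst e; exact ⟨h1, rfl, by simp, hm⟩
                · left; rw [Function.update_of_ne e]
            · refine hA' _ rfl fun a ha => ?_
              push Not at ha
              simp [ha]
            · simp; omega
            · simp; omega
          · simp only [wp_pure, Sum.elim_inr]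
            refine ⟨⟨?_, ?_, ?_⟩, ?_⟩
            · exact H.pop hpos hlt (fun y => Or.inl rfl) (fun _ h => absurd h hm)
            · exact hA' _ rfl fun a ha => rfl
            · dsimp only; omega
            · omega
        · simp only [wp_pure, Sum.elim_inr]
          refine ⟨⟨?_, ?_, ?_⟩, ?_⟩
          · exact H.pop hpos hlt (fun y => Or.inl rfl) (fun h => absurd h h1)
          · exact hA' _ rfl fun a ha => rfl
          · dsimp only; omega
          · omega
  · have hz : ∀ x, Listed size fd x → s.arr .visited x = 0 ∧ s.arr .mark x = 0 ∧
        s.arr .next x = 0 := by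
      rintro x ⟨t, ht, rfl⟩; exact h0 t ht
    refine ⟨?_, ⟨fun a ha => ?_, rfl⟩, ?_⟩
    · have := DFSState.init (G := fun x y => s.adj x y = 1) (P := P) (st0 := s.arr .stack) hw hvw
        (fun x hx => (hz x hx).1) (fun x hx => (hz x hx).2.1) (fun x hx => (hz x hx).2.2) hv
      simpa using this
    · push Not at ha
      simp [ha]
    · have h1 : ∑ x ∈ S, (size - s.arr .next x) ≤ size * size := by
        calc ∑ x ∈ S, (size - s.arr .next x) ≤ ∑ _x ∈ S, size :=
              Finset.sum_le_sum fun x _ => Nat.sub_le _ _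
          _ = S.card * size := by simp
          _ ≤ size * size := Nat.mul_le_mul_right _
              (Finset.card_image_le.trans (Finset.card_range _).le)
      simp
      omega

/-! ### Vacant positions and the forward reordering -/

/-- The number of null entries of `vx` among the positions `a, …, b`. -/
def nullCount (n : ℕ) (vx : ℕ → ℕ) (a b : ℕ) : ℕ := ((Finset.Icc a b).filter fun l => vx l = n).card

theorem nullCount_congr {n a b : ℕ} {vx vx' : ℕ → ℕ} (h : ∀ l, a ≤ l → l ≤ b → vx l = vx' l) :
    nullCount n vx a b = nullCount n vx' a b := by
  unfold nullCount
  congr 1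
  refine Finset.filter_congr fun l hl => ?_
  rw [Finset.mem_Icc] at hl
  rw [h l hl.1 hl.2]

theorem nullCount_left {n a b : ℕ} {vx : ℕ → ℕ} (h : a ≤ b) :
    nullCount n vx a b = (if vx a = n then 1 else 0) + nullCount n vx (a + 1) b := by
  unfold nullCount
  rw [← Finset.insert_Icc_succ_left_eq_Icc h, Finset.filter_insert]
  split_ifs with h'
  · rw [Finset.card_insert_of_notMem (by simp)]
    exact add_comm _ _
  · exact (zero_add _).symm

theorem nullCount_right {n a b : ℕ} {vx : ℕ → ℕ} (h : a ≤ b + 1) :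
    nullCount n vx a (b + 1) = (if vx (b + 1) = n then 1 else 0) + nullCount n vx a b := by
  unfold nullCount
  rw [← Finset.insert_Icc_right_eq_Icc_add_one h, Finset.filter_insert]
  split_ifs with h'
  · rw [Finset.card_insert_of_notMem (by simp)]
    exact add_comm _ _
  · exact (zero_add _).symm

theorem le_of_nullCount_pos {n a b : ℕ} {vx : ℕ → ℕ} (h : 0 < nullCount n vx a b) : a ≤ b := by
  by_contra hlt
  rw [nullCount, Finset.Icc_eq_empty hlt] at h
  simp at h

theorem ne_of_nullCount_eq_zero {n a b : ℕ} {vx : ℕ → ℕ} (h : nullCount n vx a b = 0) {l : ℕ}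
    (hl : a ≤ l) (hl' : l ≤ b) : vx l ≠ n := by
  intro he
  rw [nullCount, Finset.card_eq_zero] at h
  have : l ∈ (Finset.Icc a b).filter fun l => vx l = n := by simp [hl, hl', he]
  rw [h] at this
  simp at this

/-- What is known about the order when reordering starts: `P` gives the old positions, `V0` the
old order with the searched elements removed. -/
structure Gapped (n N : ℕ) (C : ℕ → Prop) (P V0 : ℕ → ℕ) : Prop where
  can_lt : ∀ x, C x → x < n
  inj : ∀ x y, C x → C y → P x = P y → x = y
  spec : ∀ l, 1 ≤ l → l ≤ N → V0 l ≠ n → C (V0 l) ∧ P (V0 l) = l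

/-- A state of the forward part of the reordering. The positions `k, …, i - 1` are done, the queue
occupies the cells `h, …, t - 1` of `F`, and the cells `0, …, h - 1` hold the elements that have
been reinserted. -/
structure FwdState (n N k : ℕ) (C : ℕ → Prop) (P V0 : ℕ → ℕ) (G : ℕ → ℕ → Prop) (F0 : ℕ → ℕ)
    (m i h t : ℕ) (F vx ps : ℕ → ℕ) : Prop where
  k_le : k ≤ i
  i_le : i ≤ N + 1
  h_le : h ≤ t
  m_le : m ≤ t
  can : ∀ a < t, C (F a)
  mono : ∀ a b, a < b → b < t → P (F a) < P (F b)
  le : ∀ a < t, P (F a) ≤ k ∨ P (F a) < i ∨ (P (F a) = i ∧ vx i = n ∧ h < a)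
  orig : ∀ a < m, F a = F0 a
  pulled : ∀ a, m ≤ a → a < t → k ≤ P (F a) ∧ V0 (P (F a)) = F a ∧ ∃ b < a, G (F b) (F a)
  count : t = h + nullCount n vx i N
  placed : ∀ a < h, k ≤ ps (F a) ∧ ps (F a) < i ∧ vx (ps (F a)) = F a ∧ P (F a) < ps (F a)
  placed_mono : ∀ a b, a < b → b < h → ps (F a) < ps (F b)
  rest : ∀ l, i ≤ l → vx l = V0 l ∨ (l = i ∧ vx l = n ∧ ∃ a < t, F a = V0 l)
  before : ∀ l < k, vx l = V0 l
  passed : ∀ l, k ≤ l → l < i →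
    ((∃ a < h, ps (F a) = l) ∧ (V0 l ≠ n → ∃ a < t, F a = V0 l)) ∨
    (vx l = V0 l ∧ V0 l ≠ n ∧ (∀ a < t, F a ≠ V0 l) ∧
      ∀ a < t, P (F a) < l → G (F a) (V0 l) → a < h ∧ ps (F a) < l)
  pos_eq : ∀ x, C x → (∀ a < h, F a ≠ x) → ps x = P x

namespace FwdState

variable {n N k : ℕ} {C : ℕ → Prop} {P V0 : ℕ → ℕ} {G : ℕ → ℕ → Prop} {F0 : ℕ → ℕ}
  {m i h t : ℕ} {F vx ps : ℕ → ℕ}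

/-- There are as many waiting elements as vacant positions from `i` on. A nonempty queue therefore
has a vacancy ahead, and the loop cannot run off the end of the order. -/
theorem i_le_N (H : FwdState n N k C P V0 G F0 m i h t F vx ps) (hlt : h < t) : i ≤ N :=
  le_of_nullCount_pos (n := n) (vx := vx) (by have := H.count; omega)

/-- Lifting a vertex out creates one vacancy and one waiting element, so the count stays balanced.
The last alternative of `le` describes precisely the moment between lifting the vertex at `i` and
refilling its cell. -/
theorem pull (H : FwdState n N k C P V0 G F0 m i h t F vx ps) (hg : Gapped n N C P V0)
    (hk : 1 ≤ k) (hV0k : V0 k = n) (hlt : h < t) (hx : vx i ≠ n)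
    (hG : ∃ a, h ≤ a ∧ a < t ∧ G (F a) (vx i)) :
    FwdState n N k C P V0 G F0 m i h (t + 1) (Function.update F t (vx i))
      (Function.update vx i n) ps := by
  have hiN := H.i_le_N hlt
  have hki := H.k_le
  have hvx : vx i = V0 i := (H.rest i le_rfl).resolve_right fun h => hx h.2.1
  obtain ⟨hC, hP⟩ := hg.spec i (hk.trans hki) hiN (hvx ▸ hx)
  rw [← hvx] at hC hP
  -- Position `k` is vacant when reordering starts, so a vertex met in place lies strictly beyond
  -- it.
  have hki' : k < i := by
    rcases hki.eq_or_lt with e | h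
    · rw [← e, hV0k] at hvx; rw [← e] at hx; exact absurd hvx hx
    · exact h
  have hF : ∀ a < t, Function.update F t (vx i) a = F a := fun a ha =>
    Function.update_of_ne ha.ne _ _
  have hF' : Function.update F t (vx i) t = vx i := Function.update_self ..
  have hlast : ∀ a < t, P (F a) < i := fun a ha => by
    rcases H.le a ha with h | h | h
    · omega
    · exact h
    · exact absurd h.2.1 hx
  have hcases : ∀ {a}, a < t + 1 → a < t ∨ a = t := fun h => by omega
  have hex : ∀ {x}, (∃ a < t, F a = x) → ∃ a < t + 1, Function.update F t (vx i) a = x :=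
    fun ⟨a, ha, e⟩ => ⟨a, by omega, by rw [hF a ha, e]⟩
  refine { k_le := hki, i_le := H.i_le, h_le := by omega, m_le := by have := H.m_le; omega,
           can := ?_, mono := ?_, le := ?_, orig := ?_, pulled := ?_, count := ?_, placed := ?_,
           placed_mono := ?_, rest := ?_, before := ?_, passed := ?_, pos_eq := ?_ }
  · intro a ha
    rcases hcases ha with ha | rfl
    · rw [hF a ha]; exact H.can a ha
    · rwa [hF']
  · intro a b hab hb
    rcases hcases hb with hb | rfl
    · rw [hF b hb, hF a (by omega)]; exact H.mono a b hab hb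
    · rw [hF', hP, hF a hab]; exact hlast a hab
  · intro a ha
    rcases hcases ha with ha | rfl
    · rw [hF a ha]; exact Or.inr (Or.inl (hlast a ha))
    · rw [hF', hP]; exact Or.inr (Or.inr ⟨rfl, Function.update_self .., hlt⟩)
  · intro a ha
    rw [hF a (ha.trans_le H.m_le)]; exact H.orig a ha
  · intro a hma ha
    rcases hcases ha with ha | rfl
    · rw [hF a ha]
      obtain ⟨h1, h2, b, hb, h3⟩ := H.pulled a hma ha
      exact ⟨h1, h2, b, hb, by rwa [hF b (by omega)]⟩
    · rw [hF', hP]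
      obtain ⟨b, _, hb, h3⟩ := hG
      exact ⟨hki, hvx.symm, b, hb, by rwa [hF b hb]⟩
  · have h1 := H.count
    rw [nullCount_left hiN, if_neg hx] at h1
    rw [nullCount_left hiN, Function.update_self, if_pos rfl,
      nullCount_congr (vx' := vx) fun l hl _ => Function.update_of_ne (by omega) _ _]
    omega
  · intro a ha
    obtain ⟨h1, h2, h3, h4⟩ := H.placed a ha
    rw [hF a (by omega), Function.update_of_ne h2.ne]
    exact ⟨h1, h2, h3, h4⟩
  · intro a b hab hb
    rw [hF a (by omega), hF b (by omega)]; exact H.placed_mono a b hab hb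
  · intro l hl
    by_cases e : l = i
    · subst e
      exact Or.inr ⟨rfl, Function.update_self .., t, by omega, by rw [hF', hvx]⟩
    · rw [Function.update_of_ne e]
      exact Or.inl ((H.rest l hl).resolve_right fun h => e h.1)
  · intro l hl
    rw [Function.update_of_ne (by omega)]; exact H.before l hl
  · intro l hl hl'
    rcases H.passed l hl hl' with ⟨⟨a, ha, h1⟩, h2⟩ | ⟨h1, h2, h3, h4⟩
    · exact Or.inl ⟨⟨a, ha, by rw [hF a (by omega), h1]⟩, fun hn => hex (h2 hn)⟩
    · refine Or.inr ⟨by rw [Function.update_of_ne hl'.ne, h1], h2, ?_, ?_⟩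
      · intro a ha
        rcases hcases ha with ha | rfl
        · rw [hF a ha]; exact h3 a ha
        · rw [hF']
          intro e
          have := (hg.spec l (by omega) (by omega) h2).2
          rw [← e, hP] at this
          omega
      · intro a ha hPa hGa
        rcases hcases ha with ha | rfl
        · rw [hF a ha] at hPa hGa ⊢; exact h4 a ha hPa hGa
        · rw [hF', hP] at hPa; omega
  · intro x hx hne
    exact H.pos_eq x hx fun a ha => by have := hne a ha; rwa [hF a (by omega)] at this

/-- Filling the vacancy at `i` with the front element removes one vacancy and one waiting element,
and the front element moves strictly upward. -/
theorem place (H : FwdState n N k C P V0 G F0 m i h t F vx ps) (hg : Gapped n N C P V0)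
    (hlt : h < t) (hx : vx i = n) (h0 : P (F 0) < k) :
    FwdState n N k C P V0 G F0 m (i + 1) (h + 1) t F (Function.update vx i (F h))
      (Function.update ps (F h) i) := by
  have hiN := H.i_le_N hlt
  have hki := H.k_le
  have hne : ∀ a < h, F a ≠ F h := fun a ha e => by
    have := H.mono a h ha hlt
    rw [e] at this
    omega
  -- For the first element this is `h0`. Later ones have `k < i` because something was placed
  -- before, and an element just lifted from `i` is excluded since it stands behind the front.
  have hPh : P (F h) < i := by
    rcases Nat.eq_zero_or_pos h with rfl | hpos
    · omega
    · have := H.placed 0 hpos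
      rcases H.le h hlt with h | h | h <;> omega
  have hFn : F h ≠ n := (hg.can_lt _ (H.can h hlt)).ne
  have hcases : ∀ {a}, a < h + 1 → a < h ∨ a = h := fun h => by omega
  refine { k_le := by omega, i_le := by omega, h_le := hlt, m_le := H.m_le, can := H.can,
           mono := H.mono, le := ?_, orig := H.orig, pulled := H.pulled, count := ?_,
           placed := ?_, placed_mono := ?_, rest := ?_, before := ?_, passed := ?_,
           pos_eq := ?_ }
  · intro a ha
    rcases H.le a ha with h | h | h
    · exact Or.inl h
    · exact Or.inr (Or.inl (by omega))
    · exact Or.inr (Or.inl (by omega))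
  · have h1 := H.count
    rw [nullCount_left hiN, if_pos hx] at h1
    rw [nullCount_congr (vx' := vx) fun l hl _ => Function.update_of_ne (by omega) _ _]
    omega
  · intro a ha
    rcases hcases ha with ha | rfl
    · obtain ⟨h1, h2, h3, h4⟩ := H.placed a ha
      rw [Function.update_of_ne (hne a ha), Function.update_of_ne h2.ne]
      exact ⟨h1, by omega, h3, h4⟩
    · rw [Function.update_self, Function.update_self]
      exact ⟨hki, by omega, rfl, hPh⟩
  · intro a b hab hb
    rcases hcases hb with hb | rfl
    · rw [Function.update_of_ne (hne b hb), Function.update_of_ne (hne a (by omega))]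
      exact H.placed_mono a b hab hb
    · rw [Function.update_self, Function.update_of_ne (hne a hab)]
      exact (H.placed a hab).2.1
  · intro l hl
    rw [Function.update_of_ne (by omega)]
    exact Or.inl ((H.rest l (by omega)).resolve_right fun h => by omega)
  · intro l hl
    rw [Function.update_of_ne (by omega)]; exact H.before l hl
  · intro l hl hl'
    by_cases e : l = i
    · subst e
      refine Or.inl ⟨⟨h, by omega, Function.update_self ..⟩, fun hn => ?_⟩
      rcases H.rest l le_rfl with h1 | h1
      · exact absurd (h1 ▸ hx) hn
      · exact h1.2.2
    · rcases H.passed l hl (by omega) with ⟨⟨a, ha, h1⟩, h2⟩ | ⟨h1, h2, h3, h4⟩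
      · exact Or.inl ⟨⟨a, by omega, by rw [Function.update_of_ne (hne a ha), h1]⟩, h2⟩
      · refine Or.inr ⟨by rw [Function.update_of_ne e, h1], h2, h3, fun a ha hPa hGa => ?_⟩
        obtain ⟨h5, h6⟩ := h4 a ha hPa hGa
        exact ⟨by omega, by rwa [Function.update_of_ne (hne a h5)]⟩
  · intro x hx hxne
    rw [Function.update_of_ne (hxne h (by omega)).symm]
    exact H.pos_eq x hx fun a ha => hxne a (by omega)

/-- No waiting element has an arc to the vertex left in place, so arcs into it from the moved
elements that preceded it come from elements already reinserted, at positions below `i`. -/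
theorem skip (H : FwdState n N k C P V0 G F0 m i h t F vx ps) (hg : Gapped n N C P V0)
    (hk : 1 ≤ k) (hV0k : V0 k = n) (hlt : h < t) (hx : vx i ≠ n)
    (hG : ∀ a, h ≤ a → a < t → ¬ G (F a) (vx i)) :
    FwdState n N k C P V0 G F0 m (i + 1) h t F vx ps := by
  have hiN := H.i_le_N hlt
  have hki := H.k_le
  have hvx : vx i = V0 i := (H.rest i le_rfl).resolve_right fun h => hx h.2.1
  obtain ⟨hC, hP⟩ := hg.spec i (hk.trans hki) hiN (hvx ▸ hx)
  have hki' : k < i := by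
    rcases hki.eq_or_lt with e | h
    · rw [← e, hV0k] at hvx; rw [← e] at hx; exact absurd hvx hx
    · exact h
  have hlast : ∀ a < t, P (F a) < i := fun a ha => by
    rcases H.le a ha with h | h | h
    · omega
    · exact h
    · exact absurd h.2.1 hx
  refine { H with k_le := by omega, i_le := by omega, le := ?_, count := ?_, placed := ?_,
                  rest := ?_, passed := ?_ }
  · exact fun a ha => Or.inr (Or.inl ((hlast a ha).trans (by omega)))
  · have h1 := H.count
    rwa [nullCount_left hiN, if_neg hx, zero_add] at h1
  · intro a ha
    obtain ⟨h1, h2, h3, h4⟩ := H.placed a ha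
    exact ⟨h1, by omega, h3, h4⟩
  · intro l hl
    exact Or.inl ((H.rest l (by omega)).resolve_right fun h => by omega)
  · intro l hl hl'
    by_cases e : l = i
    · subst e
      refine Or.inr ⟨hvx, hvx ▸ hx, fun a ha e => ?_, fun a ha _ hGa => ?_⟩
      · have := hlast a ha
        rw [e, hP] at this
        omega
      · by_cases hah : a < h
        · exact ⟨hah, (H.placed a hah).2.1⟩
        · exact absurd (hvx ▸ hGa) (hG a (by omega) ha)
    · exact H.passed l hl (by omega)

end FwdState

/-- The work done so far by the forward part of the reordering, as the distance covered. -/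
def fwdWork (P F ps : ℕ → ℕ) (i h t : ℕ) : ℕ :=
  ∑ a ∈ Finset.range h, (ps (F a) + 1 - P (F a)) + ∑ a ∈ Finset.Ico h t, (i - P (F a))

/-- An element joins the queue at the current position, at distance zero. -/
theorem fwdWork_pull {P F ps : ℕ → ℕ} {i h t x : ℕ} (hht : h ≤ t) (hx : P x = i) :
    fwdWork P (Function.update F t x) ps i h (t + 1) = fwdWork P F ps i h t := by
  have e : ∀ a < t, Function.update F t x a = F a := fun a ha => Function.update_of_ne ha.ne _ _
  unfold fwdWork
  rw [Finset.sum_Ico_succ_top hht, Function.update_self, hx, Nat.sub_self, add_zero]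
  congr 1
  · exact Finset.sum_congr rfl fun a ha => by rw [e a (by simp at ha; omega)]
  · exact Finset.sum_congr rfl fun a ha => by rw [e a (by simp at ha; omega)]

theorem sum_Ico_sub_succ {P F : ℕ → ℕ} {i h t : ℕ} (hP : ∀ a < t, P (F a) ≤ i) :
    ∑ a ∈ Finset.Ico h t, (i + 1 - P (F a)) = ∑ a ∈ Finset.Ico h t, (i - P (F a)) + (t - h) := by
  rw [show t - h = ∑ _a ∈ Finset.Ico h t, 1 by simp, ← Finset.sum_add_distrib]
  refine Finset.sum_congr rfl fun a ha => ?_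
  have := hP a (by simp at ha; omega)
  omega

/-- Passing a position takes each waiting element one step further; the gain is the length of the
queue that was scanned for this position. -/
theorem fwdWork_skip {P F ps : ℕ → ℕ} {i h t : ℕ} (hP : ∀ a < t, P (F a) ≤ i) :
    fwdWork P F ps (i + 1) h t = fwdWork P F ps i h t + (t - h) := by
  unfold fwdWork
  rw [sum_Ico_sub_succ hP, add_assoc]

theorem fwdWork_place {P F ps : ℕ → ℕ} {i h t : ℕ} (hht : h < t) (hP : ∀ a < t, P (F a) ≤ i)
    (hne : ∀ a < h, F a ≠ F h) :
    fwdWork P F (Function.update ps (F h) i) (i + 1) (h + 1) t =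
      fwdWork P F ps i h t + (t - h) := by
  unfold fwdWork
  rw [sum_Ico_sub_succ hP, Finset.sum_range_succ, Function.update_self,
    Finset.sum_eq_sum_Ico_succ_bot hht]
  have : ∑ a ∈ Finset.range h, (Function.update ps (F h) i (F a) + 1 - P (F a)) =
      ∑ a ∈ Finset.range h, (ps (F a) + 1 - P (F a)) :=
    Finset.sum_congr rfl fun a ha => by
      rw [Function.update_of_ne (hne a (Finset.mem_range.mp ha))]
  rw [this]
  have := hP h hht
  omega

theorem FwdState.pos_le {n N k : ℕ} {C : ℕ → Prop} {P V0 : ℕ → ℕ} {G : ℕ → ℕ → Prop}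
    {F0 : ℕ → ℕ} {m i h t : ℕ} {F vx ps : ℕ → ℕ}
    (H : FwdState n N k C P V0 G F0 m i h t F vx ps) : ∀ a < t, P (F a) ≤ i := fun a ha => by
  have := H.k_le
  rcases H.le a ha with h | h | h <;> omega

/-- An iteration with `t - h > 0` waiting elements takes at most `3 * (t - h) + 9` steps, and the
work measure grows by at least `t - h`; hence the factor 12. Each final summand is the new position
plus one minus the old position. -/
theorem wp_reorderForward {n N k m : ℕ} {C : ℕ → Prop} {P : ℕ → ℕ} {s : Mem}
    (hg : Gapped n N C P (s.arr .vertex)) (hk : 1 ≤ k) (hkN : k ≤ N)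
    (hV0k : s.arr .vertex k = n) (hm : 0 < m) (h0 : P (s.arr .fwd 0) < k)
    (hpos : ∀ x, C x → s.arr .position x = P x)
    (hcan : ∀ a < m, C (s.arr .fwd a))
    (hmono : ∀ a b, a < b → b < m → P (s.arr .fwd a) < P (s.arr .fwd b))
    (hle : ∀ a < m, P (s.arr .fwd a) ≤ k)
    (hcount : m = nullCount n (s.arr .vertex) k N) {Q : Unit → Mem → Prop}
    (hQ : ∀ s' i t, FwdState n N k C P (s.arr .vertex) (fun x y => s.adj x y = 1) (s.arr .fwd) m
        i t t (s'.arr .fwd) (s'.arr .vertex) (s'.arr .position) →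
      AgreeExcept (fun a => a = .fwd ∨ a = .vertex ∨ a = .position) s s' →
      s'.clock ≤ s.clock + 1 + 12 * ∑ a ∈ Finset.range t,
        (s'.arr .position (s'.arr .fwd a) + 1 - P (s'.arr .fwd a)) → Q () s') :
    wp (reorderForward n k m) Q s := by
  set V0 := s.arr .vertex with hV0
  set F0 := s.arr .fwd with hF0
  let I : ℕ × ℕ × ℕ → Mem → Prop := fun c s' =>
    FwdState n N k C P V0 (fun x y => s.adj x y = 1) F0 m c.1 c.2.1 c.2.2
      (s'.arr .fwd) (s'.arr .vertex) (s'.arr .position) ∧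
    AgreeExcept (fun a => a = .fwd ∨ a = .vertex ∨ a = .position) s s' ∧
    s'.clock ≤ s.clock + 12 * fwdWork P (s'.arr .fwd) (s'.arr .position) c.1 c.2.1 c.2.2
  refine wp_loop I (fun c _ => N + 1 - c.1) ?_ ?_
  · rintro ⟨i, h, t⟩ s' ⟨H, hA, hc⟩
    dsimp only at H hc ⊢
    have hadj : s'.adj = s.adj := hA.adj
    have hFm : s'.arr .fwd 0 = F0 0 := H.orig 0 hm
    have hA' : ∀ t' : Mem, t'.adj = s'.adj →
        (∀ a, ¬(a = .fwd ∨ a = .vertex ∨ a = .position) → t'.arr a = s'.arr a) →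
        AgreeExcept (fun a => a = .fwd ∨ a = .vertex ∨ a = .position) s t' :=
      fun t' h1 h2 => ⟨fun a ha => (h2 a ha).trans (hA.arr a ha), h1.trans hA.adj⟩
    refine wp_if (fun hlt => ?_) (fun hlt => ?_)
    · have hiN := H.i_le_N hlt
      have hne : ∀ a < h, s'.arr .fwd a ≠ s'.arr .fwd h := fun a ha e => by
        have := H.mono a h ha hlt
        rw [e] at this
        omega
      simp only [wp_bind, wp_read]
      refine wp_if (fun hx => ?_) (fun hx => ?_)
      · rw [wp_bind]
        refine wp_arcFromF fun b c hb hc' => ?_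
        simp only [hadj] at hb hc' ⊢
        have hvx : s'.arr .vertex i = V0 i :=
          (H.rest i le_rfl).resolve_right fun h => hx h.2.1
        have hPx := (hg.spec i (hk.trans H.k_le) hiN (by rwa [← hvx])).2
        refine wp_if (fun hhit => ?_) (fun hhit => ?_)
        · have H' := H.pull hg hk hV0k hlt hx (hb.mp hhit)
          clear hb
          have H'' := H'.place hg (by omega) (by simp) (by
            rw [Function.update_of_ne (by omega), hFm]; exact h0)
          have hF : Function.update (s'.arr .fwd) t (s'.arr .vertex i) h = s'.arr .fwd h :=
            Function.update_of_ne hlt.ne _ _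
          have hw1 := fwdWork_place (h := h) (ps := s'.arr .position) (by omega) H'.pos_le (by
            intro a ha
            rw [hF, Function.update_of_ne (by omega)]
            exact hne a ha)
          rw [fwdWork_pull (x := s'.arr .vertex i) hlt.le (by rw [hvx, hPx]), hF] at hw1
          rw [hF] at H''
          simp only [hhit, if_true, wp_bind, wp_write, wp_read, wp_pure, Sum.elim_inr,
            Function.update_self, ne_eq, reduceCtorEq, not_false_eq_true, Function.update_of_ne,
            Function.update_idem]
          rw [hF]
          simp only [Function.update_idem] at H''
          refine ⟨⟨by simpa [Function.update_of_ne] using H'', hA' _ hadj.symm fun a ha => ?_, ?_⟩, by omega⟩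
          · push Not at ha
            simp [ha]
          · simp [Function.update_of_ne]
            rw [hw1]; omega
        · have hno : ∀ a, h ≤ a → a < t → ¬ s.adj (s'.arr .fwd a) (s'.arr .vertex i) = 1 :=
            fun a ha ha' hGa => hhit (hb.mpr ⟨a, ha, ha', hGa⟩)
          have H' := H.skip hg hk hV0k hlt hx hno
          clear hb
          have hw1 := fwdWork_skip (ps := s'.arr .position) (h := h) H.pos_le
          simp only [hhit, wp_bind, wp_read]
          refine wp_if (fun h => absurd h hx) fun _ => ?_
          simp only [wp_pure, Sum.elim_inr]
          refine ⟨⟨H', hA' _ hadj.symm fun a ha => rfl, ?_⟩, by omega⟩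
          simp
          rw [hw1]; omega
      · rw [not_not] at hx
        have H' := H.place hg hlt hx (by rw [hFm]; exact h0)
        have hw1 := fwdWork_place (ps := s'.arr .position) hlt H.pos_le hne
        simp only [wp_pure, Bool.false_eq_true, if_false, wp_bind, wp_read, hx, if_true, wp_write, Sum.elim_inr]
        refine ⟨⟨by simpa [Function.update_of_ne] using H', hA' _ rfl fun a ha => ?_, ?_⟩, by omega⟩
        · push Not at ha
          simp [ha]
        · simp [Function.update_of_ne]
          rw [hw1]; omega
    · simp only [wp_pure, Sum.elim_inl]
      obtain rfl : h = t := by have := H.h_le; omega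
      refine hQ _ i h H ⟨hA.arr, hA.adj⟩ ?_
      simp only [fwdWork, Finset.Ico_self, Finset.sum_empty, add_zero] at hc
      dsimp only
      omega
  · refine ⟨?_, AgreeExcept.refl _ _, Nat.le_add_right _ _⟩
    refine { k_le := le_rfl, i_le := by dsimp only; omega, h_le := Nat.zero_le _, m_le := le_rfl,
             can := hcan, mono := hmono, le := fun a ha => Or.inl (hle a ha),
             orig := fun _ _ => rfl, pulled := fun a h1 h2 => absurd h2 h1.not_gt,
             count := by simpa using hcount, placed := fun a ha => absurd ha (Nat.not_lt_zero _),
             placed_mono := fun a b _ hb => absurd hb (Nat.not_lt_zero _),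
             rest := fun l _ => Or.inl rfl, before := fun l _ => rfl,
             passed := fun l h1 h2 => absurd h2 h1.not_gt, pos_eq := fun x hx _ => hpos x hx }

/-! ### The backward reordering -/

/-- A state of the backward part of the reordering. The positions `j, …, k - 1` are done, the queue
occupies the cells `h, …, t - 1` of `B`, and the cells `0, …, h - 1` hold the elements that have
been reinserted. -/
structure BwdState (n k : ℕ) (C : ℕ → Prop) (P V0 ps0 : ℕ → ℕ) (G : ℕ → ℕ → Prop) (B0 : ℕ → ℕ)
    (m j h t : ℕ) (B vx ps : ℕ → ℕ) : Prop where
  le_k : j ≤ k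
  one_le : 1 ≤ j
  h_le : h ≤ t
  m_le : m ≤ t
  can : ∀ a < t, C (B a)
  anti : ∀ a b, a < b → b < t → P (B b) < P (B a)
  ge : ∀ a < t, j ≤ P (B a) ∨ (P (B a) + 1 = j ∧ vx (P (B a)) = n ∧ h < a)
  orig : ∀ a < m, B a = B0 a
  pulled : ∀ a, m ≤ a → a < t → P (B a) < k ∧ V0 (P (B a)) = B a ∧ ∃ b < a, G (B a) (B b)
  count : t = h + nullCount n vx 1 (j - 1)
  placed : ∀ a < h, j ≤ ps (B a) ∧ ps (B a) < k ∧ vx (ps (B a)) = B a ∧ ps (B a) < P (B a)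
  placed_anti : ∀ a b, a < b → b < h → ps (B b) < ps (B a)
  rest : ∀ l < j, vx l = V0 l ∨ (l + 1 = j ∧ vx l = n ∧ ∃ a < t, B a = V0 l)
  after : ∀ l, k ≤ l → vx l = V0 l
  passed : ∀ l, j ≤ l → l < k →
    ((∃ a < h, ps (B a) = l) ∧ (V0 l ≠ n → ∃ a < t, B a = V0 l)) ∨
    (vx l = V0 l ∧ V0 l ≠ n ∧ (∀ a < t, B a ≠ V0 l) ∧
      ∀ a < t, l < P (B a) → G (V0 l) (B a) → a < h ∧ l < ps (B a))
  pos_eq : ∀ x, (∀ a < h, B a ≠ x) → ps x = ps0 x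

namespace BwdState

variable {n k : ℕ} {C : ℕ → Prop} {P V0 ps0 : ℕ → ℕ} {G : ℕ → ℕ → Prop} {B0 : ℕ → ℕ}
  {m j h t : ℕ} {B vx ps : ℕ → ℕ}

/-- Mirror image of `FwdState.i_le_N`: a nonempty queue has a vacancy below. The lemmas take the
state at `j + 1` because the program decrements `j` before it looks at the position. -/
theorem one_le_pred (H : BwdState n k C P V0 ps0 G B0 m (j + 1) h t B vx ps) (hlt : h < t) :
    1 ≤ j :=
  le_of_nullCount_pos (n := n) (vx := vx) (by
    have := H.count
    rw [Nat.add_sub_cancel] at this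
    omega)

theorem pos_ge (H : BwdState n k C P V0 ps0 G B0 m (j + 1) h t B vx ps) :
    ∀ a < t, j ≤ P (B a) := fun a ha => by
  rcases H.ge a ha with h | h <;> omega

theorem pull (H : BwdState n k C P V0 ps0 G B0 m (j + 1) h t B vx ps)
    (hg : Gapped n (k - 1) C P V0)
    (hlt : h < t) (hx : vx j ≠ n) (hG : ∃ a, h ≤ a ∧ a < t ∧ G (vx j) (B a)) :
    BwdState n k C P V0 ps0 G B0 m (j + 1) h (t + 1) (Function.update B t (vx j))
      (Function.update vx j n) ps := by
  have hj1 := H.one_le_pred hlt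
  have hjk := H.le_k
  have hvx : vx j = V0 j := (H.rest j (by omega)).resolve_right fun h => hx h.2.1
  obtain ⟨hC, hP⟩ := hg.spec j hj1 (by omega) (hvx ▸ hx)
  rw [← hvx] at hC hP
  have hB : ∀ a < t, Function.update B t (vx j) a = B a := fun a ha =>
    Function.update_of_ne ha.ne _ _
  have hB' : Function.update B t (vx j) t = vx j := Function.update_self ..
  have hlast : ∀ a < t, j < P (B a) := fun a ha => by
    rcases H.ge a ha with h | h
    · exact h
    · have h1 : P (B a) = j := by omega
      exact absurd (h1 ▸ h.2.1) hx
  have hcases : ∀ {a}, a < t + 1 → a < t ∨ a = t := fun h => by omega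
  have hex : ∀ {x}, (∃ a < t, B a = x) → ∃ a < t + 1, Function.update B t (vx j) a = x :=
    fun ⟨a, ha, e⟩ => ⟨a, by omega, by rw [hB a ha, e]⟩
  refine { le_k := hjk, one_le := H.one_le, h_le := by omega,
           m_le := by have := H.m_le; omega,
           can := ?_, anti := ?_, ge := ?_, orig := ?_, pulled := ?_, count := ?_, placed := ?_,
           placed_anti := ?_, rest := ?_, after := ?_, passed := ?_, pos_eq := ?_ }
  · intro a ha
    rcases hcases ha with ha | rfl
    · rw [hB a ha]; exact H.can a ha
    · rwa [hB']
  · intro a b hab hb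
    rcases hcases hb with hb | rfl
    · rw [hB b hb, hB a (by omega)]; exact H.anti a b hab hb
    · rw [hB', hP, hB a hab]; exact hlast a hab
  · intro a ha
    rcases hcases ha with ha | rfl
    · rw [hB a ha]; exact Or.inl (hlast a ha)
    · rw [hB', hP]; exact Or.inr ⟨rfl, Function.update_self .., hlt⟩
  · intro a ha
    rw [hB a (ha.trans_le H.m_le)]; exact H.orig a ha
  · intro a hma ha
    rcases hcases ha with ha | rfl
    · rw [hB a ha]
      obtain ⟨h1, h2, b, hb, h3⟩ := H.pulled a hma ha
      exact ⟨h1, h2, b, hb, by rwa [hB b (by omega)]⟩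
    · rw [hB', hP]
      obtain ⟨b, _, hb, h3⟩ := hG
      exact ⟨hjk, hvx.symm, b, hb, by rwa [hB b hb]⟩
  · have h1 := H.count
    obtain ⟨j, rfl⟩ : ∃ j', j = j' + 1 := ⟨j - 1, by omega⟩
    rw [Nat.add_sub_cancel] at h1 ⊢
    rw [nullCount_right (by omega), if_neg hx] at h1
    rw [nullCount_right (by omega), Function.update_self, if_pos rfl,
      nullCount_congr (vx' := vx) fun l _ hl => Function.update_of_ne (by omega) _ _]
    omega
  · intro a ha
    obtain ⟨h1, h2, h3, h4⟩ := H.placed a ha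
    rw [hB a (by have := H.h_le; omega), Function.update_of_ne (by omega)]
    exact ⟨h1, h2, h3, h4⟩
  · intro a b hab hb
    rw [hB a (by omega), hB b (by omega)]; exact H.placed_anti a b hab hb
  · intro l hl
    by_cases e : l = j
    · subst e
      exact Or.inr ⟨rfl, Function.update_self .., t, by omega, by rw [hB', hvx]⟩
    · rw [Function.update_of_ne e]
      exact Or.inl ((H.rest l hl).resolve_right fun h => by omega)
  · intro l hl
    rw [Function.update_of_ne (by omega)]; exact H.after l hl
  · intro l hl hl'
    rcases H.passed l hl hl' with ⟨⟨a, ha, h1⟩, h2⟩ | ⟨h1, h2, h3, h4⟩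
    · exact Or.inl ⟨⟨a, ha, by rw [hB a (by omega), h1]⟩, fun hn => hex (h2 hn)⟩
    · refine Or.inr ⟨by rw [Function.update_of_ne (by omega), h1], h2, ?_, ?_⟩
      · intro a ha
        rcases hcases ha with ha | rfl
        · rw [hB a ha]; exact h3 a ha
        · rw [hB']
          intro e
          have := (hg.spec l (by omega) (by omega) h2).2
          rw [← e, hP] at this
          omega
      · intro a ha hPa hGa
        rcases hcases ha with ha | rfl
        · rw [hB a ha] at hPa hGa ⊢; exact h4 a ha hPa hGa
        · rw [hB', hP] at hPa; omega
  · intro x hne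
    exact H.pos_eq x fun a ha => by have := hne a ha; rwa [hB a (by omega)] at this

/-- The front element moves strictly downward by `hfst`. No analogue of `h0` is needed: searched
elements start at `k` or above, while the positions filled here lie below `k`. -/
theorem place (H : BwdState n k C P V0 ps0 G B0 m (j + 1) h t B vx ps) (hlt : h < t)
    (hx : vx j = n) (hfst : j < P (B h)) :
    BwdState n k C P V0 ps0 G B0 m j (h + 1) t B (Function.update vx j (B h))
      (Function.update ps (B h) j) := by
  have hj1 := H.one_le_pred hlt
  have hjk := H.le_k
  have hne : ∀ a < h, B a ≠ B h := fun a ha e => by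
    have := H.anti a h ha hlt
    rw [e] at this
    omega
  have hcases : ∀ {a}, a < h + 1 → a < h ∨ a = h := fun h => by omega
  refine { le_k := by omega, one_le := hj1, h_le := hlt, m_le := H.m_le, can := H.can,
           anti := H.anti, ge := ?_, orig := H.orig, pulled := H.pulled, count := ?_,
           placed := ?_, placed_anti := ?_, rest := ?_, after := ?_, passed := ?_,
           pos_eq := ?_ }
  · exact fun a ha => Or.inl (H.pos_ge a ha)
  · have h1 := H.count
    obtain ⟨j, rfl⟩ : ∃ j', j = j' + 1 := ⟨j - 1, by omega⟩
    rw [Nat.add_sub_cancel] at h1 ⊢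
    rw [nullCount_right (by omega), if_pos hx] at h1
    rw [nullCount_congr (vx' := vx) fun l _ hl => Function.update_of_ne (by omega) _ _]
    omega
  · intro a ha
    rcases hcases ha with ha | rfl
    · obtain ⟨h1, h2, h3, h4⟩ := H.placed a ha
      rw [Function.update_of_ne (hne a ha), Function.update_of_ne (by omega)]
      exact ⟨by omega, h2, h3, h4⟩
    · rw [Function.update_self, Function.update_self]
      exact ⟨le_rfl, by omega, rfl, hfst⟩
  · intro a b hab hb
    rcases hcases hb with hb | rfl
    · rw [Function.update_of_ne (hne b hb), Function.update_of_ne (hne a (by omega))]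
      exact H.placed_anti a b hab hb
    · rw [Function.update_self, Function.update_of_ne (hne a hab)]
      exact (H.placed a hab).1
  · intro l hl
    rw [Function.update_of_ne (by omega)]
    exact Or.inl ((H.rest l (by omega)).resolve_right fun h => by omega)
  · intro l hl
    rw [Function.update_of_ne (by omega)]; exact H.after l hl
  · intro l hl hl'
    by_cases e : l = j
    · subst e
      refine Or.inl ⟨⟨h, by omega, Function.update_self ..⟩, fun hn => ?_⟩
      rcases H.rest l (by omega) with h1 | h1
      · exact absurd (h1 ▸ hx) hn
      · exact h1.2.2
    · rcases H.passed l (by omega) hl' with ⟨⟨a, ha, h1⟩, h2⟩ | ⟨h1, h2, h3, h4⟩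
      · exact Or.inl ⟨⟨a, by omega, by rw [Function.update_of_ne (hne a ha), h1]⟩, h2⟩
      · refine Or.inr ⟨by rw [Function.update_of_ne e, h1], h2, h3, fun a ha hPa hGa => ?_⟩
        obtain ⟨h5, h6⟩ := h4 a ha hPa hGa
        exact ⟨by omega, by rwa [Function.update_of_ne (hne a h5)]⟩
  · intro x hxne
    rw [Function.update_of_ne (hxne h (by omega)).symm]
    exact H.pos_eq x fun a ha => hxne a (by omega)

theorem skip (H : BwdState n k C P V0 ps0 G B0 m (j + 1) h t B vx ps)
    (hg : Gapped n (k - 1) C P V0) (hlt : h < t) (hx : vx j ≠ n)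
    (hG : ∀ a, h ≤ a → a < t → ¬ G (vx j) (B a)) :
    BwdState n k C P V0 ps0 G B0 m j h t B vx ps := by
  have hj1 := H.one_le_pred hlt
  have hjk := H.le_k
  have hvx : vx j = V0 j := (H.rest j (by omega)).resolve_right fun h => hx h.2.1
  obtain ⟨hC, hP⟩ := hg.spec j hj1 (by omega) (hvx ▸ hx)
  have hlast : ∀ a < t, j < P (B a) := fun a ha => by
    rcases H.ge a ha with h | h
    · exact h
    · have h1 : P (B a) = j := by omega
      exact absurd (h1 ▸ h.2.1) hx
  refine { H with le_k := by omega, one_le := hj1, ge := ?_, count := ?_, placed := ?_,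
                  rest := ?_, passed := ?_ }
  · exact fun a ha => Or.inl (hlast a ha).le
  · have h1 := H.count
    obtain ⟨j, rfl⟩ : ∃ j', j = j' + 1 := ⟨j - 1, by omega⟩
    rw [Nat.add_sub_cancel] at h1 ⊢
    rwa [nullCount_right (by omega), if_neg hx, zero_add] at h1
  · intro a ha
    obtain ⟨h1, h2, h3, h4⟩ := H.placed a ha
    exact ⟨by omega, h2, h3, h4⟩
  · intro l hl
    exact Or.inl ((H.rest l (by omega)).resolve_right fun h => by omega)
  · intro l hl hl'
    by_cases e : l = j
    · subst e
      refine Or.inr ⟨hvx, hvx ▸ hx, fun a ha e => ?_, fun a ha _ hGa => ?_⟩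
      · have := hlast a ha
        rw [e, hP] at this
        omega
      · by_cases hah : a < h
        · exact ⟨hah, (H.placed a hah).1⟩
        · exact absurd (hvx ▸ hGa) (hG a (by omega) ha)
    · exact H.passed l (by omega) hl'

end BwdState

/-- The work done so far by the backward part of the reordering, as the distance covered. -/
def bwdWork (P B ps : ℕ → ℕ) (j h t : ℕ) : ℕ :=
  ∑ a ∈ Finset.range h, (P (B a) + 1 - ps (B a)) + ∑ a ∈ Finset.Ico h t, (P (B a) + 1 - j)

theorem bwdWork_pull {P B ps : ℕ → ℕ} {j h t x : ℕ} (hht : h ≤ t) (hx : P x = j) :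
    bwdWork P (Function.update B t x) ps (j + 1) h (t + 1) = bwdWork P B ps (j + 1) h t := by
  have e : ∀ a < t, Function.update B t x a = B a := fun a ha => Function.update_of_ne ha.ne _ _
  unfold bwdWork
  rw [Finset.sum_Ico_succ_top hht, Function.update_self, hx, Nat.sub_self, add_zero]
  congr 1
  · exact Finset.sum_congr rfl fun a ha => by rw [e a (by simp at ha; omega)]
  · exact Finset.sum_congr rfl fun a ha => by rw [e a (by simp at ha; omega)]

theorem sum_Ico_succ_sub {P B : ℕ → ℕ} {j h t : ℕ} (hP : ∀ a < t, j ≤ P (B a)) :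
    ∑ a ∈ Finset.Ico h t, (P (B a) + 1 - j) =
      ∑ a ∈ Finset.Ico h t, (P (B a) + 1 - (j + 1)) + (t - h) := by
  rw [show t - h = ∑ _a ∈ Finset.Ico h t, 1 by simp, ← Finset.sum_add_distrib]
  refine Finset.sum_congr rfl fun a ha => ?_
  have := hP a (by simp at ha; omega)
  omega

theorem bwdWork_skip {P B ps : ℕ → ℕ} {j h t : ℕ} (hP : ∀ a < t, j ≤ P (B a)) :
    bwdWork P B ps j h t = bwdWork P B ps (j + 1) h t + (t - h) := by
  unfold bwdWork
  rw [sum_Ico_succ_sub hP, add_assoc]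

theorem bwdWork_place {P B ps : ℕ → ℕ} {j h t : ℕ} (hht : h < t) (hP : ∀ a < t, j ≤ P (B a))
    (hne : ∀ a < h, B a ≠ B h) :
    bwdWork P B (Function.update ps (B h) j) j (h + 1) t =
      bwdWork P B ps (j + 1) h t + (t - h) := by
  rw [← bwdWork_skip hP]
  unfold bwdWork
  rw [Finset.sum_range_succ, Function.update_self, Finset.sum_eq_sum_Ico_succ_bot hht]
  have : ∑ a ∈ Finset.range h, (P (B a) + 1 - Function.update ps (B h) j (B a)) =
      ∑ a ∈ Finset.range h, (P (B a) + 1 - ps (B a)) :=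
    Finset.sum_congr rfl fun a ha => by
      rw [Function.update_of_ne (hne a (Finset.mem_range.mp ha))]
  rw [this, add_assoc]

theorem wp_reorderBackward {n k m : ℕ} {C : ℕ → Prop} {P : ℕ → ℕ} {s : Mem}
    (hg : Gapped n (k - 1) C P (s.arr .vertex)) (hk : 1 ≤ k)
    (hcan : ∀ a < m, C (s.arr .bwd a))
    (hanti : ∀ a b, a < b → b < m → P (s.arr .bwd b) < P (s.arr .bwd a))
    (hge : ∀ a < m, k ≤ P (s.arr .bwd a))
    (hcount : m = nullCount n (s.arr .vertex) 1 (k - 1)) {Q : Unit → Mem → Prop}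
    (hQ : ∀ s' j t, BwdState n k C P (s.arr .vertex) (s.arr .position) (fun x y => s.adj x y = 1)
        (s.arr .bwd) m j t t (s'.arr .bwd) (s'.arr .vertex) (s'.arr .position) →
      AgreeExcept (fun a => a = .bwd ∨ a = .vertex ∨ a = .position) s s' →
      s'.clock ≤ s.clock + 1 + 12 * ∑ a ∈ Finset.range t,
        (P (s'.arr .bwd a) + 1 - s'.arr .position (s'.arr .bwd a)) → Q () s') :
    wp (reorderBackward n k m) Q s := by
  set V0 := s.arr .vertex with hV0
  set B0 := s.arr .bwd with hB0
  let I : ℕ × ℕ × ℕ → Mem → Prop := fun c s' =>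
    BwdState n k C P V0 (s.arr .position) (fun x y => s.adj x y = 1) B0 m c.1 c.2.1 c.2.2
      (s'.arr .bwd) (s'.arr .vertex) (s'.arr .position) ∧
    AgreeExcept (fun a => a = .bwd ∨ a = .vertex ∨ a = .position) s s' ∧
    s'.clock ≤ s.clock + 12 * bwdWork P (s'.arr .bwd) (s'.arr .position) c.1 c.2.1 c.2.2
  refine wp_loop I (fun c _ => c.1) ?_ ?_
  · rintro ⟨j, h, t⟩ s' ⟨H, hA, hc⟩
    dsimp only at H hc ⊢
    have hadj : s'.adj = s.adj := hA.adj
    have hA' : ∀ t' : Mem, t'.adj = s'.adj →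
        (∀ a, ¬(a = .bwd ∨ a = .vertex ∨ a = .position) → t'.arr a = s'.arr a) →
        AgreeExcept (fun a => a = .bwd ∨ a = .vertex ∨ a = .position) s t' :=
      fun t' h1 h2 => ⟨fun a ha => (h2 a ha).trans (hA.arr a ha), h1.trans hA.adj⟩
    refine wp_if (fun hlt => ?_) (fun hlt => ?_)
    -- The loop variable stays positive, so the truncated subtraction in the program is a genuine
    -- decrement.
    · obtain ⟨j, rfl⟩ : ∃ j', j = j' + 1 := ⟨j - 1, by have := H.one_le; omega⟩
      have hj1 := H.one_le_pred hlt
      have hjk := H.le_k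
      have hne : ∀ a < h, s'.arr .bwd a ≠ s'.arr .bwd h := fun a ha e => by
        have := H.anti a h ha hlt
        rw [e] at this
        omega
      simp only [Nat.add_sub_cancel]
      simp only [wp_bind, wp_read]
      refine wp_if (fun hx => ?_) (fun hx => ?_)
      · rw [wp_bind]
        refine wp_arcToB fun b c hb hc' => ?_
        simp only [hadj] at hb hc' ⊢
        have hvx : s'.arr .vertex j = V0 j :=
          (H.rest j (by omega)).resolve_right fun h => hx h.2.1
        have hPx := (hg.spec j hj1 (by omega) (by rwa [← hvx])).2
        refine wp_if (fun hhit => ?_) (fun hhit => ?_)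
        · have H' := H.pull hg hlt hx (hb.mp hhit)
          have hfst : j < P (s'.arr .bwd h) := by
            rcases H.ge h hlt with h1 | h1
            · exact h1
            · omega
          clear hb
          have hB : Function.update (s'.arr .bwd) t (s'.arr .vertex j) h = s'.arr .bwd h :=
            Function.update_of_ne hlt.ne _ _
          have H'' := H'.place (by omega) (by simp) (by rwa [hB])
          have hw1 := bwdWork_place (h := h) (ps := s'.arr .position) (by omega) H'.pos_ge (by
            intro a ha
            rw [hB, Function.update_of_ne (by omega)]
            exact hne a ha)
          rw [bwdWork_pull (x := s'.arr .vertex j) hlt.le (by rw [hvx, hPx]), hB] at hw1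
          rw [hB] at H''
          simp only [hhit, if_true, wp_bind, wp_write, wp_read, wp_pure, Sum.elim_inr,
            Function.update_self, ne_eq, reduceCtorEq, not_false_eq_true, Function.update_of_ne,
            Function.update_idem]
          rw [hB]
          simp only [Function.update_idem] at H''
          refine ⟨⟨by simpa [Function.update_of_ne] using H'', hA' _ hadj.symm fun a ha => ?_, ?_⟩, by omega⟩
          · push Not at ha
            simp [ha]
          · simp [Function.update_of_ne]
            rw [hw1]; omega
        · have hno : ∀ a, h ≤ a → a < t → ¬ s.adj (s'.arr .vertex j) (s'.arr .bwd a) = 1 :=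
            fun a ha ha' hGa => hhit (hb.mpr ⟨a, ha, ha', hGa⟩)
          have H' := H.skip hg hlt hx hno
          have hw1 := bwdWork_skip (ps := s'.arr .position) (h := h) H.pos_ge
          clear hb
          simp only [hhit, wp_bind, wp_read]
          refine wp_if (fun h => absurd h hx) fun _ => ?_
          simp only [wp_pure, Sum.elim_inr]
          refine ⟨⟨H', hA' _ hadj.symm fun a ha => rfl, ?_⟩, by omega⟩
          simp
          rw [hw1]; omega
      · rw [not_not] at hx
        have hfst : j < P (s'.arr .bwd h) := by
          rcases H.ge h hlt with h1 | h1
          · exact h1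
          · omega
        have H' := H.place hlt hx hfst
        have hw1 := bwdWork_place (ps := s'.arr .position) hlt H.pos_ge hne
        simp only [wp_pure, Bool.false_eq_true, if_false, wp_bind, wp_read, hx, if_true, wp_write, Sum.elim_inr]
        refine ⟨⟨by simpa [Function.update_of_ne] using H', hA' _ rfl fun a ha => ?_, ?_⟩, by omega⟩
        · push Not at ha
          simp [ha]
        · simp [Function.update_of_ne]
          rw [hw1]; omega
    · simp only [wp_pure, Sum.elim_inl]
      obtain rfl : h = t := by have := H.h_le; omega
      refine hQ _ j h H ⟨hA.arr, hA.adj⟩ ?_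
      simp only [bwdWork, Finset.Ico_self, Finset.sum_empty, add_zero] at hc
      dsimp only
      omega
  · refine ⟨?_, AgreeExcept.refl _ _, Nat.le_add_right _ _⟩
    refine { le_k := le_rfl, one_le := hk, h_le := Nat.zero_le _, m_le := le_rfl,
             can := hcan, anti := hanti, ge := fun a ha => Or.inl (hge a ha),
             orig := fun _ _ => rfl, pulled := fun a h1 h2 => absurd h2 h1.not_gt,
             count := by simpa using hcount, placed := fun a ha => absurd ha (Nat.not_lt_zero _),
             placed_anti := fun a b _ hb => absurd hb (Nat.not_lt_zero _),
             rest := fun l _ => Or.inl rfl, after := fun l _ => rfl,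
             passed := fun l h1 h2 => absurd h2 h1.not_gt, pos_eq := fun x _ => rfl }

/-! ### Combining rows and columns, and renumbering -/

/-- The invariant describes the half-processed matrix: below `i`, row and column `x` have been moved
to `c` and cleared; from `i` on they are untouched. A loop at `c` may arise here; it is erased only
after all components have been combined. -/
theorem wp_combine {s : Mem} {n c x : ℕ} (hc : c ≠ x) (hx : s.adj x x ≠ 1)
    {Q : Unit → Mem → Prop}
    (hQ : ∀ s', s'.arr = s.arr →
      (∀ a < n, ∀ b < n, s'.adj a b = 1 ↔ a ≠ x ∧ b ≠ x ∧
        (s.adj a b = 1 ∨ a = c ∧ s.adj x b = 1 ∨ b = c ∧ s.adj a x = 1)) →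
      s'.clock ≤ s.clock + 7 * n → Q () s') :
    wp (combine n c x) Q s := by
  rw [combine]
  refine wp_forRange (fun i s' => s'.arr = s.arr ∧
    (∀ a b, s'.adj a b = 1 ↔ (a ≠ x ∧ b ≠ x ∧
      (s.adj a b = 1 ∨ a = c ∧ b < i ∧ s.adj x b = 1 ∨ b = c ∧ a < i ∧ s.adj a x = 1)) ∨
      (a = x ∧ b ≠ x ∧ i ≤ b ∧ s.adj x b = 1) ∨ (b = x ∧ a ≠ x ∧ i ≤ a ∧ s.adj a x = 1)) ∧
    s'.clock ≤ s.clock + 7 * i) ?_ ?_ ⟨rfl, ?_, le_rfl⟩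
  · rintro i hi s' ⟨h1, h2, h3⟩
    simp only [wp_bind, wp_readAdj]
    have hxi : s'.adj x i = 1 ↔ i ≠ x ∧ s.adj x i = 1 := by
      rw [h2]; by_cases e : i = x <;> simp [e]
    have hix : s'.adj i x = 1 ↔ i ≠ x ∧ s.adj i x = 1 := by
      rw [h2]; by_cases e : i = x <;> simp [e]
    -- The net effect of one iteration, stated for an arbitrary matrix, so that each of the four
    -- branches of the program only has to match it.
    have key : ∀ A : ℕ → ℕ → ℕ, (∀ a b, A a b = 1 ↔
        (((a = c ∧ b = i ∧ s'.adj x i = 1) ∨ (a = i ∧ b = c ∧ s'.adj i x = 1) ∨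
          s'.adj a b = 1) ∧ ¬ (a = x ∧ b = i) ∧ ¬ (a = i ∧ b = x))) →
        (∀ a b, A a b = 1 ↔ (a ≠ x ∧ b ≠ x ∧
          (s.adj a b = 1 ∨ a = c ∧ b < i + 1 ∧ s.adj x b = 1 ∨
            b = c ∧ a < i + 1 ∧ s.adj a x = 1)) ∨
          (a = x ∧ b ≠ x ∧ i + 1 ≤ b ∧ s.adj x b = 1) ∨
          (b = x ∧ a ≠ x ∧ i + 1 ≤ a ∧ s.adj a x = 1)) := by
      intro A hA a b
      rw [hA, h2 a b, hxi, hix]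
      have e1 : b < i + 1 ↔ b < i ∨ b = i := Nat.lt_succ_iff_lt_or_eq
      have e2 : a < i + 1 ↔ a < i ∨ a = i := Nat.lt_succ_iff_lt_or_eq
      have e3 : i ≤ b ↔ i + 1 ≤ b ∨ b = i := by clear h2 hA; omega
      have e4 : i ≤ a ↔ i + 1 ≤ a ∨ a = i := by clear h2 hA; omega
      rw [e1, e2, e3, e4]
      clear hA hxi hix h2 hQ e1 e2 e3 e4 h1 h3 hi
      have hci : c = i → ¬ i + 1 ≤ c := by omega
      by_cases hax : a = x
      · by_cases hbx : b = x
        · simp [hax, hbx, hc.symm]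
        · have : ¬ (a = i ∧ b = x) := fun h => hbx h.2
          simp only [hax, hbx, hc.symm, true_and, false_and, ne_eq, not_true_eq_false,
            not_false_eq_true, false_or, or_false, and_true, and_false]
          have : b = i → ¬ i + 1 ≤ b := by omega
          by_cases hbc : b = c
          · by_cases hxi : x = i
            · simp only [hbc, hxi, not_true_eq_false, false_and, and_false, false_or]
              tauto
            · simp only [hxi, false_and, false_or]
              tauto
          · simp only [hbc, false_and, and_false, false_or]
            tauto
      · by_cases hbx : b = x
        · simp only [hax, hbx, hc.symm, true_and, false_and, ne_eq, not_true_eq_false,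
            not_false_eq_true, false_or, or_false, and_true, and_false]
          have : a = i → ¬ i + 1 ≤ a := by omega
          by_cases hac : a = c
          · by_cases hxi : x = i
            · simp only [hac, hxi, not_true_eq_false, false_and, and_false, false_or]
              tauto
            · simp only [hxi, false_and, and_false, false_or]
              tauto
          · simp only [hac, false_and, false_or]
            tauto
        · simp only [hax, hbx, true_and, false_and, ne_eq, and_false,
            not_false_eq_true, or_false, and_true]
          constructor
          · rintro (⟨h1, rfl, h2, h3⟩ | ⟨rfl, h1, h2, h3⟩ | h | h | h)
            · exact Or.inr (Or.inl ⟨h1, Or.inr rfl, h3⟩)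
            · exact Or.inr (Or.inr ⟨h1, Or.inr rfl, h3⟩)
            · exact Or.inl h
            · exact Or.inr (Or.inl ⟨h.1, Or.inl h.2.1, h.2.2⟩)
            · exact Or.inr (Or.inr ⟨h.1, Or.inl h.2.1, h.2.2⟩)
          · rintro (h | ⟨h1, h2 | rfl, h3⟩ | ⟨h1, h2 | rfl, h3⟩)
            · exact Or.inr (Or.inr (Or.inl h))
            · exact Or.inr (Or.inr (Or.inr (Or.inl ⟨h1, h2, h3⟩)))
            · exact Or.inl ⟨h1, rfl, hbx, h3⟩
            · exact Or.inr (Or.inr (Or.inr (Or.inr ⟨h1, h2, h3⟩)))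
            · exact Or.inr (Or.inl ⟨rfl, h1, hax, h3⟩)
    have hne : s'.adj x i = 1 → i ≠ x := fun h => (hxi.1 h).1
    clear hxi hix h2 hQ
    refine wp_if (fun hb => ?_) (fun hb => ?_)
    · simp only [wp_bind, wp_writeAdj, wp_readAdj]
      refine wp_if (fun hb' => ?_) (fun hb' => ?_)
      · simp only [wp_bind, wp_writeAdj]
        refine ⟨h1, key _ fun a b => ?_, by omega⟩
        clear key
        simp only [Function.update_apply, ite_apply] at hb' ⊢
        grind
      · simp only [wp_pure]
        refine ⟨h1, key _ fun a b => ?_, by omega⟩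
        clear key
        simp only [Function.update_apply, ite_apply] at hb' ⊢
        grind
    · simp only [wp_bind, wp_readAdj]
      refine wp_if (fun hb' => ?_) (fun hb' => ?_)
      · simp only [wp_bind, wp_writeAdj]
        refine ⟨h1, key _ fun a b => ?_, by omega⟩
        clear key
        simp only [Function.update_apply, ite_apply] at hb' ⊢
        grind
      · simp only [wp_pure]
        refine ⟨h1, key _ fun a b => ?_, by omega⟩
        clear key
        grind
  · rintro s' ⟨h1, h2, h3⟩
    refine hQ s' h1 (fun a ha b hb => ?_) h3
    rw [h2]
    constructor
    · rintro (h | h | h)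
      · tauto
      · omega
      · omega
    · rintro ⟨h4, h5, h6⟩
      exact Or.inl ⟨h4, h5, by tauto⟩
  · intro a b
    by_cases ha : a = x <;> by_cases hb : b = x
    · subst ha hb; simp [hx]
    · subst ha; simp [hb]
    · subst hb; simp [ha]
    · simp [ha, hb]

/-- The canonical elements after the sets with canonical elements in `R` have been united with
that of `c`. -/
def merged (R : Finset ℕ) (c : ℕ) (f : ℕ → ℕ) (v : ℕ) : ℕ :=
  if f v ∈ R then c else f v

/-- The marked elements other than `c` among the first `t` entries of a list. -/
def absorbed (fd mk : ℕ → ℕ) (c t : ℕ) : Finset ℕ :=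
  ((Finset.range t).image fd).filter fun x => mk x = 1 ∧ x ≠ c

theorem mem_absorbed {fd mk : ℕ → ℕ} {c t x : ℕ} :
    x ∈ absorbed fd mk c t ↔ Listed t fd x ∧ mk x = 1 ∧ x ≠ c := by
  simp [absorbed, Listed]

theorem absorbed_succ (fd mk : ℕ → ℕ) (c t : ℕ) :
    absorbed fd mk c (t + 1) =
      if mk (fd t) = 1 ∧ fd t ≠ c then insert (fd t) (absorbed fd mk c t)
      else absorbed fd mk c t := by
  unfold absorbed
  rw [Finset.range_add_one, Finset.image_insert, Finset.filter_insert]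

/-- The number of entries of `vx` among `1, …, l` that are not null. -/
def rankAt (n : ℕ) (vx : ℕ → ℕ) (l : ℕ) : ℕ := ((Finset.Icc 1 l).filter fun l => vx l ≠ n).card

theorem rankAt_succ (n : ℕ) (vx : ℕ → ℕ) (l : ℕ) :
    rankAt n vx (l + 1) = (if vx (l + 1) ≠ n then 1 else 0) + rankAt n vx l := by
  unfold rankAt
  rw [← Finset.insert_Icc_right_eq_Icc_add_one (by omega), Finset.filter_insert]
  split_ifs with h'
  · rw [Finset.card_insert_of_notMem (by simp)]
    exact add_comm _ _
  · exact (zero_add _).symm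

theorem rankAt_mono (n : ℕ) (vx : ℕ → ℕ) : Monotone (rankAt n vx) :=
  fun _ _ h => Finset.card_le_card (Finset.filter_subset_filter _ (Finset.Icc_subset_Icc_right h))

theorem rankAt_le (n : ℕ) (vx : ℕ → ℕ) (l : ℕ) : rankAt n vx l ≤ l :=
  (Finset.card_filter_le _ _).trans (by simp)

theorem rankAt_lt {n : ℕ} {vx : ℕ → ℕ} {l l' : ℕ} (h : l < l') (hl : vx l' ≠ n) :
    rankAt n vx l < rankAt n vx l' := by
  obtain ⟨l', rfl⟩ : ∃ m, l' = m + 1 := ⟨l' - 1, by omega⟩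
  rw [rankAt_succ, if_pos hl]
  have := rankAt_mono n vx (show l ≤ l' by omega)
  omega

/-- Renumbering lowers a position by exactly the number of vacancies up to it; this controls the
shift caused by deletions. -/
theorem rankAt_add_nullCount (n : ℕ) (vx : ℕ → ℕ) (l : ℕ) :
    rankAt n vx l + nullCount n vx 1 l = l := by
  unfold rankAt nullCount
  rw [add_comm, Finset.card_filter_add_card_filter_not]
  simp

/-- The new number of an entry is its rank among the entries that are not null, at most its old
number. Writing thus never overtakes reading, and clearing the cell first makes the case of equal
indices harmless. -/
theorem wp_renumber {s : Mem} {n N : ℕ} {C : ℕ → Prop} {P : ℕ → ℕ}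
    (hN : s.arr .count 0 = N)
    (hC : ∀ x, C x → 1 ≤ P x ∧ P x ≤ N ∧ s.arr .vertex (P x) = x ∧ x ≠ n)
    (hV : ∀ l, 1 ≤ l → l ≤ N → s.arr .vertex l ≠ n → C (s.arr .vertex l) ∧
      P (s.arr .vertex l) = l) {Q : Unit → Mem → Prop}
    (hQ : ∀ s', IsNumbering C (s'.arr .vertex) (s'.arr .position) (s'.arr .count 0) →
      (∀ x, C x → s'.arr .position x = rankAt n (s.arr .vertex) (P x)) →
      AgreeExcept (fun a => a = .vertex ∨ a = .position ∨ a = .count) s s' →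
      s'.clock ≤ s.clock + (5 * N + 3) → Q () s') :
    wp (renumber n) Q s := by
  simp only [renumber, wp_bind, wp_read, hN]
  set vx := s.arr .vertex with hvx
  have hinj : ∀ x y, C x → C y → P x = P y → x = y := fun x y hx hy e => by
    rw [← (hC x hx).2.2.1, ← (hC y hy).2.2.1, e]
  let I : ℕ × ℕ → Mem → Prop := fun c t => 1 ≤ c.1 ∧ c.1 ≤ N + 1 ∧ c.2 = rankAt n vx (c.1 - 1) ∧
    (∀ l, c.1 ≤ l → l ≤ N → t.arr .vertex l = vx l) ∧
    (∀ x, C x → P x < c.1 → t.arr .position x = rankAt n vx (P x) ∧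
      t.arr .vertex (rankAt n vx (P x)) = x) ∧
    (∀ r, 1 ≤ r → r ≤ c.2 → ∃ x, C x ∧ P x < c.1 ∧ rankAt n vx (P x) = r) ∧
    AgreeExcept (fun a => a = .vertex ∨ a = .position) s t ∧
    t.clock ≤ s.clock + 1 + 5 * (c.1 - 1)
  refine wp_loop I (fun c _ => N + 1 - c.1) ?_ ?_
  · rintro ⟨i, k⟩ t ⟨h1, h2, h3, h4, h5, h6, hA, hc⟩
    dsimp only at h1 h2 h3 h4 h5 h6 hc ⊢
    obtain ⟨i, rfl⟩ : ∃ m, i = m + 1 := ⟨i - 1, by omega⟩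
    rw [Nat.add_sub_cancel] at h3 hc
    refine wp_if (fun hi => ?_) (fun hi => ?_)
    · simp only [wp_bind, wp_read]
      rw [h4 _ le_rfl hi]
      have hr := rankAt_succ n vx i
      have hki := rankAt_le n vx i
      refine wp_if (fun hx => ?_) (fun hx => ?_)
      · simp only [wp_pure, Sum.elim_inr]
        rw [if_neg (by simpa using hx), zero_add] at hr
        have hlt : ∀ x, C x → P x < i + 1 + 1 → P x < i + 1 := fun x hx' h => by
          rcases (show P x ≤ i + 1 by omega).eq_or_lt with e | h
          · have := hC x hx'
            rw [e, hx] at this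
            exact absurd this.2.2.1.symm this.2.2.2
          · exact h
        refine ⟨⟨by omega, by omega, by simp [hr, h3], fun l hl => h4 l (by omega),
          fun x hx' h => h5 x hx' (hlt x hx' h), fun r hr1 hr2 => ?_, ⟨hA.arr, hA.adj⟩, ?_⟩,
          by omega⟩
        · obtain ⟨x, hx', h, e⟩ := h6 r hr1 hr2
          exact ⟨x, hx', by omega, e⟩
        · dsimp only; omega
      · rw [if_pos hx] at hr
        obtain ⟨hCx, hPx⟩ := hV (i + 1) (by omega) hi hx
        simp only [wp_bind, wp_write, wp_pure, Sum.elim_inr]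
        simp only [Function.update_self, Function.update_of_ne, ne_eq, reduceCtorEq,
          not_false_eq_true]
        have hk1 : k + 1 = rankAt n vx (i + 1) := by omega
        have hcase : ∀ x, C x → P x < i + 1 + 1 → x = vx (i + 1) ∨ P x < i + 1 := fun x hx' h => by
          rcases (show P x ≤ i + 1 by omega).eq_or_lt with e | h
          · exact Or.inl (hinj _ _ hx' hCx (by rw [e, hPx]))
          · exact Or.inr h
        refine ⟨⟨by omega, by omega, by simpa using hk1, fun l hl hl' => ?_, fun x hx' h => ?_,
          fun r hr1 hr2 => ?_, ⟨fun a ha => ?_, hA.adj⟩, by dsimp only; omega⟩, by omega⟩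
        · simp
          rw [Function.update_of_ne (by omega), Function.update_of_ne (by omega)]
          exact h4 l (by omega) hl'
        · simp
          rcases hcase x hx' h with rfl | h
          · rw [Function.update_self, hPx, ← hk1, Function.update_self]
            exact ⟨rfl, rfl⟩
          · have hne : x ≠ vx (i + 1) := by rintro rfl; omega
            have hle := rankAt_mono n vx (show P x ≤ i by omega)
            rw [Function.update_of_ne hne, Function.update_of_ne (by omega),
              Function.update_of_ne (by omega)]
            exact h5 x hx' h
        · rcases (show r ≤ k ∨ r = k + 1 by omega) with h | rfl
          · obtain ⟨x, hx', h, e⟩ := h6 r hr1 h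
            exact ⟨x, hx', by omega, e⟩
          · exact ⟨_, hCx, by omega, by rw [hPx, hk1]⟩
        · have := hA.arr a ha
          push Not at ha
          simpa [ha] using this
    · simp only [wp_pure, Sum.elim_inl, wp_write]
      obtain rfl : i = N := by omega
      have hlt : ∀ x, C x → P x < i + 1 := fun x hx => by have := hC x hx; omega
      refine hQ _ ?_ ?_ ⟨fun a ha => ?_, hA.adj⟩ ?_
      · simp [Function.update_of_ne]
        refine ⟨fun x hx => ?_, fun x hx => ?_, fun x hx => ?_, fun r h1 h2 => ?_,
          fun r h1 h2 => ?_⟩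
        · rw [(h5 x hx (hlt x hx)).1]
          obtain ⟨h7, _, h8, h9⟩ := hC x hx
          have := rankAt_lt (n := n) (vx := vx) (show 0 < P x by omega) (by rwa [h8])
          omega
        · rw [(h5 x hx (hlt x hx)).1, h3]
          exact rankAt_mono _ _ (hC x hx).2.1
        · rw [(h5 x hx (hlt x hx)).1, (h5 x hx (hlt x hx)).2]
        · obtain ⟨x, hx, h, rfl⟩ := h6 r h1 h2
          rwa [(h5 x hx h).2]
        · obtain ⟨x, hx, h, rfl⟩ := h6 r h1 h2
          rw [(h5 x hx h).2, (h5 x hx h).1]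
      · intro x hx
        simpa [Function.update_of_ne] using (h5 x hx (hlt x hx)).1
      · have := hA.arr a (by tauto)
        push Not at ha
        simpa [ha] using this
      · dsimp only; omega
  · refine ⟨le_rfl, by dsimp only; omega, by simp [rankAt], fun l _ _ => rfl, fun x hx h => ?_,
      fun r h1 h2 => by dsimp only at h2; omega, ⟨fun _ _ => rfl, rfl⟩, le_rfl⟩
    have := hC x hx
    dsimp only at h
    omega

/-! ### Forming the new component -/

/-- The matrix of the graph whose vertices are the classes of `f`, without loops. -/
def IsQuotientMatrix (n : ℕ) (E : ℕ → ℕ → Prop) (f : ℕ → ℕ) (adj : ℕ → ℕ → ℕ) : Prop :=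
  ∀ a < n, ∀ b < n, adj a b = 1 ↔ a ≠ b ∧ ∃ a' b', E a' b' ∧ f a' = a ∧ f b' = b

/-- Absorbing one component means one union, one pass over a row and a column, and two accesses to
delete the vertex from the order. Renumbering happens once at the end and preserves relative order.
-/
theorem wp_formComponent {s : Mem} {n N size c : ℕ} {f rt : ℕ → ℕ} {E : ℕ → ℕ → Prop}
    (hs : s.Sets n f rt)
    (hfd : ∀ t < size, s.arr .found t < n ∧ f (s.arr .found t) = s.arr .found t)
    (hfi : ∀ t < size, ∀ t' < size, s.arr .found t = s.arr .found t' → t = t')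
    (hc : c < n) (hfc : f c = c) (hN : s.arr .count 0 = N)
    (hnum : IsNumbering (fun x => x < n ∧ f x = x) (s.arr .vertex) (s.arr .position) N)
    (hadj : IsQuotientMatrix n E f s.adj) {Q : Unit → Mem → Prop}
    (hQ : ∀ s' rt' R, R = absorbed (s.arr .found) (s.arr .mark) c size →
      s'.Sets n (merged R c f) rt' →
      IsNumbering (fun x => x < n ∧ merged R c f x = x) (s'.arr .vertex) (s'.arr .position)
        (s'.arr .count 0) →
      IsQuotientMatrix n E (merged R c f) s'.adj →
      (∀ x < n, (merged R c f x = x ↔ f x = x ∧ x ∉ R)) →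
      (∀ x y, f x = x → x ∉ R → f y = y → y ∉ R → x < n → y < n →
        s.arr .position x < s.arr .position y → s'.arr .position x < s'.arr .position y) →
      (∀ x < n, f x = x → x ∉ R → s'.arr .position x ≤ s.arr .position x ∧
        s.arr .position x ≤ s'.arr .position x + R.card) →
      s'.clock ≤ s.clock + (3 * size + R.card * (7 * n + 10 * Nat.log 2 n + 13) + 5 * N + 4) →
      Q () s') :
    wp (formComponent n size c) Q s := by
  simp only [formComponent, wp_bind]
  set fd := s.arr .found with hfd'
  set mk := s.arr .mark with hmk'
  -- The listed vertices are distinct, so none is absorbed twice.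
  have hnot : ∀ t < size, fd t ∉ absorbed fd mk c t := by
    intro t ht h
    obtain ⟨⟨t', h1, h2⟩, -⟩ := mem_absorbed.1 h
    have := hfi t' (by omega) t ht h2
    omega
  have hcR : ∀ t, c ∉ absorbed fd mk c t := fun t h => (mem_absorbed.1 h).2.2 rfl
  -- Quotient entries are maintained off the diagonal only: the diagonal entry at `c` may become 1
  -- on the way, whereas no other diagonal entry does.
  refine wp_forRange (fun t s' => (∃ rt', s'.Sets n (merged (absorbed fd mk c t) c f) rt') ∧
    (∀ l, 1 ≤ l → l ≤ N → s'.arr .vertex l =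
      if s.arr .vertex l ∈ absorbed fd mk c t then n else s.arr .vertex l) ∧
    (∀ a < n, ∀ b < n, a ≠ b → (s'.adj a b = 1 ↔ ∃ a' b', E a' b' ∧
      merged (absorbed fd mk c t) c f a' = a ∧ merged (absorbed fd mk c t) c f b' = b)) ∧
    (∀ a < n, a ≠ c → s'.adj a a ≠ 1) ∧
    (∀ a, a ≠ .parent → a ≠ .rank → a ≠ .canon → a ≠ .vertex → s'.arr a = s.arr a) ∧
    s'.clock ≤ s.clock + 3 * t +
      (absorbed fd mk c t).card * (7 * n + 10 * Nat.log 2 n + 13)) ?_ ?_ ?_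
  · rintro t ht s' ⟨⟨rt', h1⟩, h2, h3, h4, h5, h6⟩
    simp only [wp_bind, wp_read]
    rw [h5 .found (by decide) (by decide) (by decide) (by decide),
      h5 .mark (by decide) (by decide) (by decide) (by decide), ← hfd', ← hmk',
      absorbed_succ]
    have hnt := hnot t ht
    have hct := hcR t
    obtain ⟨hxn, hfx⟩ := hfd t ht
    set x := fd t
    set R := absorbed fd mk c t
    refine wp_if (fun hm => ?_) (fun hm => ?_)
    · rw [if_pos hm]
      simp only [wp_bind]
      have hmer : (fun v => if merged R c f v = x then c else merged R c f v) =
          merged (insert x R) c f := by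
        funext v
        unfold merged
        by_cases e : f v = x
        · simp [e, hnt]
        · by_cases e' : f v ∈ R
          · simp [e', hm.2.symm]
          · simp [e', e]
      refine wp_unite (s := ⟨s'.arr, s'.adj, s'.clock + 1 + 1 + 1⟩) (f := merged R c f)
        (rt := rt') h1 hc hxn ?_ ?_ hm.2.symm ?_
      · simp [merged, hfc, hct]
      · simp [merged, hfx, hnt]
      rintro s2 rt2 hs2 hA2 hc2
      rw [hmer] at hs2
      have hadj2 : s2.adj = s'.adj := hA2.adj
      refine wp_combine hm.2.symm (by rw [hadj2]; exact h4 x hxn hm.2) ?_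
      intro s3 hs3 ha3 hc3
      rw [wp_read, wp_write]
      have hpos : s3.arr .position = s.arr .position := by
        rw [hs3, hA2.arr .position (by decide)]
        exact h5 .position (by decide) (by decide) (by decide) (by decide)
      have hver : s3.arr .vertex = s'.arr .vertex := by
        rw [hs3, hA2.arr .vertex (by decide)]
      rw [hpos]
      refine ⟨⟨rt2, ?_⟩, ?_, ?_, ?_, ?_, ?_⟩
      · have : s3.Sets n (merged (insert x R) c f) rt2 := by
          unfold Mem.Sets at hs2 ⊢
          rwa [hs3]
        unfold Mem.Sets at this ⊢
        simpa [Function.update_of_ne] using this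
      · intro l hl1 hl2
        simp only [Function.update_self, hver]
        by_cases e : l = s.arr .position x
        · subst e
          rw [Function.update_self, hnum.vertex_pos x ⟨hxn, hfx⟩, if_pos (by simp)]
        · rw [Function.update_of_ne e, h2 l hl1 hl2]
          have : s.arr .vertex l ≠ x := fun h => e (by rw [← h, hnum.pos_vertex l hl1 hl2])
          simp [this]
      · intro a ha b hb hab
        dsimp only
        rw [ha3 a ha b hb, hadj2, ← hmer]
        have hm2 := hm.2
        clear_value x R
        clear hA2 hs2 hs3 ha3 hc3 hc2 hpos hver hfd' hmk' h6 h5 h2 h1 hQ hadj hfi hfd hnot hcR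
        dsimp only
        constructor
        · rintro ⟨hax, hbx, h | ⟨rfl, h⟩ | ⟨rfl, h⟩⟩
          · obtain ⟨a', b', h', rfl, rfl⟩ := (h3 a ha b hb hab).1 h
            exact ⟨a', b', h', by rw [if_neg hax], by rw [if_neg hbx]⟩
          · obtain ⟨a', b', h', e, rfl⟩ := (h3 x hxn b hb (Ne.symm hbx)).1 h
            exact ⟨a', b', h', by rw [if_pos e], by rw [if_neg hbx]⟩
          · obtain ⟨a', b', h', rfl, e⟩ := (h3 a ha x hxn hax).1 h
            exact ⟨a', b', h', by rw [if_neg hax], by rw [if_pos e]⟩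
        · rintro ⟨a', b', h, e1, e2⟩
          have hax : a ≠ x := by rintro rfl; split_ifs at e1 <;> simp_all
          have hbx : b ≠ x := by rintro rfl; split_ifs at e2 <;> simp_all
          refine ⟨hax, hbx, ?_⟩
          split_ifs at e1 e2 with h7 h8 h8
          · exact absurd (e1.symm.trans e2) hab
          · exact Or.inr (Or.inl ⟨e1.symm, (h3 x hxn b hb hbx.symm).2 ⟨a', b', h, h7, e2⟩⟩)
          · exact Or.inr (Or.inr ⟨e2.symm, (h3 a ha x hxn hax).2 ⟨a', b', h, e1, h8⟩⟩)
          · exact Or.inl ((h3 a ha b hb hab).2 ⟨a', b', h, e1, e2⟩)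
      · intro a ha hac
        dsimp only
        rw [ne_eq, ha3 a ha a ha, hadj2]
        have := h4 a ha hac
        tauto
      · intro a ha1 ha2 ha3 ha4
        dsimp only
        rw [Function.update_of_ne ha4, hs3, hA2.arr a (by tauto)]
        exact h5 a ha1 ha2 ha3 ha4
      · dsimp only at hc2 hc3 ⊢
        rw [Finset.card_insert_of_notMem hnt, add_mul]
        omega
    · rw [if_neg hm, wp_pure]
      refine ⟨⟨rt', h1⟩, h2, h3, h4, h5, ?_⟩
      dsimp only
      omega
  · rintro s' ⟨⟨rt', h1⟩, h2, h3, h4, h5, h6⟩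
    have hcc := hcR size
    rw [wp_writeAdj]
    set R := absorbed fd mk c size with hR
    have hcan : ∀ x < n, (merged R c f x = x ↔ f x = x ∧ x ∉ R) := by
      intro x hx
      unfold merged
      split_ifs with h
      · constructor
        · rintro rfl
          rw [hfc] at h
          exact absurd h hcc
        · rintro ⟨h7, h8⟩
          rw [h7] at h
          exact absurd h h8
      · constructor
        · intro h7
          exact ⟨h7, h7 ▸ h⟩
        · exact fun h => h.1
    have hpos := h5 .position (by decide) (by decide) (by decide) (by decide)
    have hvn : ∀ l, 1 ≤ l → l ≤ N → s.arr .vertex l ≠ n := fun l h7 h8 => by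
      have := (hnum.can_vertex l h7 h8).1; omega
    refine wp_renumber (N := N) (C := fun x => x < n ∧ merged R c f x = x)
      (P := s.arr .position) ?_ ?_ ?_ ?_
    · dsimp only
      rw [h5 .count (by decide) (by decide) (by decide) (by decide), hN]
    · rintro x ⟨hx, hfx⟩
      obtain ⟨h7, h8⟩ := (hcan x hx).1 hfx
      have h9 := hnum.pos_ge x ⟨hx, h7⟩
      have h10 := hnum.pos_le x ⟨hx, h7⟩
      refine ⟨h9, h10, ?_, by omega⟩
      dsimp only
      rw [h2 _ h9 h10, hnum.vertex_pos x ⟨hx, h7⟩, if_neg h8]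
    · intro l hl1 hl2
      dsimp only
      rw [h2 l hl1 hl2]
      split_ifs with h
      · simp
      · intro _
        obtain ⟨h7, h8⟩ := hnum.can_vertex l hl1 hl2
        exact ⟨⟨h7, (hcan _ h7).2 ⟨h8, h⟩⟩, hnum.pos_vertex l hl1 hl2⟩
    · intro s2 hn2 hp2 hA2 hc2
      dsimp only at hp2 hc2
      have hsets : s2.Sets n (merged R c f) rt' := by
        unfold Mem.Sets at h1 ⊢
        rw [hA2.arr .parent (by decide), hA2.arr .rank (by decide), hA2.arr .canon (by decide)]
        exact h1
      refine hQ s2 rt' R rfl hsets hn2 ?_ hcan ?_ ?_ ?_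
      · have hadj2 := hA2.adj
        dsimp only at hadj2
        intro a ha b hb
        rw [hadj2]
        by_cases hab : a = b
        · subst hab
          simp only [ne_eq, not_true_eq_false, false_and, iff_false]
          by_cases hac : a = c
          · subst hac; simp
          · rw [Function.update_of_ne hac]
            exact h4 a ha hac
        · rw [← h3 a ha b hb hab, and_iff_right hab]
          by_cases hac : a = c
          · subst hac
            rw [Function.update_self, Function.update_of_ne (Ne.symm hab)]
          · rw [Function.update_of_ne hac]
      · intro x y hx hxR hy hyR hxn hyn hlt
        rw [hp2 x ⟨hxn, (hcan x hxn).2 ⟨hx, hxR⟩⟩, hp2 y ⟨hyn, (hcan y hyn).2 ⟨hy, hyR⟩⟩]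
        have h9 := hnum.pos_ge y ⟨hyn, hy⟩
        have h10 := hnum.pos_le y ⟨hyn, hy⟩
        refine rankAt_lt hlt ?_
        rw [h2 _ h9 h10, hnum.vertex_pos y ⟨hyn, hy⟩, if_neg hyR]
        omega
      · intro x hxn hx hxR
        rw [hp2 x ⟨hxn, (hcan x hxn).2 ⟨hx, hxR⟩⟩]
        have h9 := hnum.pos_ge x ⟨hxn, hx⟩
        have h10 := hnum.pos_le x ⟨hxn, hx⟩
        have h11 := rankAt_add_nullCount n (s'.arr .vertex) (s.arr .position x)
        -- The vacancies up to a position were created by absorbed vertices, and the old order maps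
        -- them injectively into `R`.
        have h12 : nullCount n (s'.arr .vertex) 1 (s.arr .position x) ≤ R.card := by
          unfold nullCount
          refine Finset.card_le_card_of_injOn (s.arr .vertex) ?_ ?_
          · intro l hl
            simp only [Finset.coe_filter, Finset.mem_Icc, Set.mem_ofPred_eq] at hl
            have h13 := h2 l hl.1.1 (by omega)
            rw [hl.2] at h13
            by_contra h14
            rw [Finset.mem_coe] at h14
            rw [if_neg h14] at h13
            exact hvn l hl.1.1 (by omega) h13.symm
          · intro l hl l' hl' e
            simp only [Finset.coe_filter, Finset.mem_Icc, Set.mem_ofPred_eq] at hl hl'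
            rw [← hnum.pos_vertex l hl.1.1 (by omega), ← hnum.pos_vertex l' hl'.1.1 (by omega), e]
        omega
      · omega
  · have h0 : absorbed fd mk c 0 = ∅ := by simp [absorbed]
    have hm : merged ∅ c f = f := by funext v; simp [merged]
    rw [h0, hm]
    refine ⟨⟨rt, hs⟩, fun l _ _ => by simp, fun a ha b hb hab => ?_, fun a ha hac => ?_,
      fun _ _ _ _ _ => rfl, by simp⟩
    · rw [hadj a ha b hb, and_iff_right hab]
    · rw [ne_eq, hadj a ha a ha]
      simp

/-! ### Amortized bound on the total displacement -/

/-- If most pairs in `Y × X` have values differing by at least `T`, then the sum of the values over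
`X` exceeds that over `Y` by almost `T * #X`. -/
theorem card_mul_le_sum_sub_sum {X Y K : Finset ℕ} {B : Finset (ℕ × ℕ)} {r : ℕ → ℤ} {n T : ℤ}
    (hT : 0 ≤ T) (hcard : X.card = Y.card) (h0 : ∀ x, 0 ≤ r x) (hn : ∀ x ∈ Y, r x ≤ n)
    (hn0 : 0 ≤ n)
    (h : ∀ x ∈ X, ∀ y ∈ Y, x ∈ K ∨ r y + T ≤ r x ∨ (y, x) ∈ B ∧ r y ≤ r x) :
    T * X.card ≤ ∑ x ∈ X, r x - ∑ y ∈ Y, r y + T * B.card + (T + n) * K.card := by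
  rcases X.eq_empty_or_nonempty with rfl | hX
  · have : Y = ∅ := Finset.card_eq_zero.1 (by rw [← hcard]; rfl)
    subst this
    have : 0 ≤ T * B.card + (T + n) * K.card := by positivity
    simpa using this
  have hc : (0 : ℤ) < X.card := by exact_mod_cast hX.card_pos
  -- Pointwise, `T` is paid by the difference of the values, by membership in `B`, or by membership
  -- in `K`; in the last case the difference may be as low as `-n`. Summing over all pairs gives the
  -- claim multiplied by the size of `X`.
  have h1 : ∀ x ∈ X, ∀ y ∈ Y, T ≤ (r x - r y) + T * (if (y, x) ∈ B then 1 else 0) +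
      (T + n) * (if x ∈ K then 1 else 0) := by
    intro x hx y hy
    have h2 := h0 x
    have h3 := hn y hy
    rcases h x hx y hy with h4 | h4 | ⟨h4, h5⟩
    · rw [if_pos h4]; split_ifs <;> linarith
    · split_ifs <;> linarith
    · rw [if_pos h4]; split_ifs <;> linarith
  have h2 := Finset.sum_le_sum fun x hx => Finset.sum_le_sum (h1 x hx)
  simp only [Finset.sum_add_distrib, Finset.sum_sub_distrib, Finset.sum_const, ← Finset.mul_sum,
    nsmul_eq_mul] at h2
  have h3 : ∑ x ∈ X, ∑ y ∈ Y, (if (y, x) ∈ B then (1 : ℤ) else 0) ≤ B.card := by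
    rw [Finset.sum_comm, ← Finset.sum_product', Finset.sum_boole]
    exact_mod_cast Finset.card_le_card fun p hp => (Finset.mem_filter.1 hp).2
  have h4 : ∑ x ∈ X, (if x ∈ K then (1 : ℤ) else 0) ≤ K.card := by
    rw [Finset.sum_boole]
    exact_mod_cast Finset.card_le_card fun p hp => (Finset.mem_filter.1 hp).2
  rw [← hcard] at h2
  -- Pairs in `B` are counted once in the double sum, so here a factor of the size of `X`, at least
  -- 1, is given away.
  have h5 : T * ∑ x ∈ X, ∑ y ∈ Y, (if (y, x) ∈ B then (1 : ℤ) else 0) ≤ X.card * (T * B.card) := by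
    calc _ ≤ T * B.card := by gcongr
      _ ≤ _ := le_mul_of_one_le_left (by positivity) (by omega)
  have h6 : (T + n) * (X.card * ∑ x ∈ X, (if x ∈ K then (1 : ℤ) else 0)) ≤
      X.card * ((T + n) * K.card) := by
    rw [mul_left_comm]
    gcongr
  refine le_of_mul_le_mul_left ?_ hc
  linarith

/-- Double counting: an element that moves from `a x` up to `b x` crosses exactly `b x - a x` gaps,
where gap `g` separates the positions up to `g` from those beyond. -/
theorem sum_sum_filter_Ico {S : Finset ℕ} {a b : ℕ → ℕ} {r : ℕ → ℤ} {n : ℕ}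
    (h : ∀ x ∈ S, b x ≤ n) :
    ∑ g ∈ Finset.range n, ∑ x ∈ S.filter (fun x => a x ≤ g ∧ g < b x), r x =
      ∑ x ∈ S, r x * ((b x - a x : ℕ) : ℤ) := by
  simp only [Finset.sum_filter]
  rw [Finset.sum_comm]
  refine Finset.sum_congr rfl fun x hx => ?_
  rw [← Finset.sum_filter, Finset.sum_const, nsmul_eq_mul, mul_comm, ← Nat.card_Ico]
  congr 3
  ext g
  have := h x hx
  simp only [Finset.mem_filter, Finset.mem_range, Finset.mem_Ico]
  omega

/-- One step of the maintenance of a topological order: the elements of `can`, ordered by `q`, are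
reordered by `mid`; those outside `can'` are deleted, and the others are renumbered by `q'`. Of
two elements that change sides across a gap, the one moved down now reaches the one moved up, and
the final numbering respects this unless both are in `K`. -/
structure OrderStep (n : ℕ) (can can' K : Finset ℕ) (q mid q' : ℕ → ℕ) (reach' : ℕ → ℕ → Prop) :
    Prop where
  sub : can' ⊆ can
  mid_le : ∀ x ∈ can, mid x ≤ n
  card_eq : ∀ g, (can.filter fun x => q x ≤ g).card = (can.filter fun x => mid x ≤ g).card
  cross : ∀ x ∈ can, ∀ y ∈ can, q x < mid x → mid y < q y →
    reach' y x ∧ (¬ (x ∈ K ∧ y ∈ K) → q' y < q' x)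
  card_K : K.card ≤ 2 * (can \ can').card
  shift : ∀ x ∈ can', q' x ≤ mid x ∧ mid x ≤ q' x + (can \ can').card

open Classical in
-- The inequality of one step in the potential argument. It applies `card_mul_le_sum_sub_sum` at
-- each gap, with `X` the elements crossing upward and `Y` those crossing downward, and sums over
-- the gaps.
theorem OrderStep.mul_le {n T : ℕ} {can can' K : Finset ℕ} {q mid q' : ℕ → ℕ}
    {reach reach' : ℕ → ℕ → Prop} {r : ℕ → ℕ} {S : Finset (ℕ × ℕ)}
    (h : OrderStep n can can' K q mid q' reach') (hcan : ∀ x ∈ can, x < n)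
    (hq : ∀ x ∈ can, q x ≤ n)
    (hreach : ∀ x ∈ can, ∀ y ∈ can, reach y x → q y ≤ q x) (hmono : ∀ y x, reach y x → reach' y x)
    (hr : ∀ x, r x ≤ n)
    (hr' : ∀ x < n, ∀ y < n, reach' y x → q' y < q' x → r y < r x)
    (hS : ∀ x < n, ∀ y < n, r y < r x → r x < r y + T → (y, x) ∈ S) :
    (T : ℤ) * ∑ x ∈ can, ((mid x - q x : ℕ) : ℤ) ≤
      ∑ x ∈ can', (r x : ℤ) * q' x - ∑ x ∈ can, (r x : ℤ) * q x +
      T * n * ((S.filter fun p => reach' p.1 p.2).card - (S.filter fun p => reach p.1 p.2).card) +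
      (4 * n ^ 2 + 2 * n * T) * (can \ can').card := by
  -- Close pairs that become related in this step. The relation only grows, so over all steps each
  -- close pair is counted at most once.
  set B := S.filter fun p => reach' p.1 p.2 ∧ ¬ reach p.1 p.2 with hB
  have hBc : (B.card : ℤ) = (S.filter fun p => reach' p.1 p.2).card -
      (S.filter fun p => reach p.1 p.2).card := by
    have := Finset.card_filter_add_card_filter_not (s := S.filter fun p => reach' p.1 p.2)
      (fun p => reach p.1 p.2)
    rw [Finset.filter_filter, Finset.filter_filter] at this
    have e : (S.filter fun p => reach' p.1 p.2 ∧ reach p.1 p.2) = S.filter fun p => reach p.1 p.2 :=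
      Finset.filter_congr fun p _ => ⟨And.right, fun h => ⟨hmono _ _ h, h⟩⟩
    rw [e, add_comm] at this
    have h1 : B.card + (S.filter fun p => reach p.1 p.2).card =
        (S.filter fun p => reach' p.1 p.2).card := by convert this
    omega
  -- As many elements cross a gap upward as downward, because the number of elements below the gap
  -- does not change.
  have hgap : ∀ g ∈ Finset.range n, (T : ℤ) * ((can.filter fun x => q x ≤ g ∧ g < mid x).card : ℤ) ≤
      ∑ x ∈ can.filter (fun x => q x ≤ g ∧ g < mid x), (r x : ℤ) -
      ∑ x ∈ can.filter (fun x => mid x ≤ g ∧ g < q x), (r x : ℤ) + T * B.card + (T + n) * K.card := by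
    intro g _
    refine card_mul_le_sum_sub_sum (by positivity) ?_ (fun x => by positivity)
      (fun x _ => by exact_mod_cast hr x) (by positivity) ?_
    · have h1 := h.card_eq g
      rw [← Finset.card_filter_add_card_filter_not (s := can.filter fun x => q x ≤ g)
        (fun x => mid x ≤ g), ← Finset.card_filter_add_card_filter_not
        (s := can.filter fun x => mid x ≤ g) (fun x => q x ≤ g), Finset.filter_filter,
        Finset.filter_filter, Finset.filter_filter, Finset.filter_filter] at h1
      simp only [not_le] at h1
      have e : (can.filter fun x => mid x ≤ g ∧ q x ≤ g) = can.filter fun x => q x ≤ g ∧ mid x ≤ g :=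
        Finset.filter_congr fun p _ => and_comm
      rw [e] at h1
      omega
    · intro x hx y hy
      simp only [Finset.mem_filter] at hx hy
      obtain ⟨h1, h2⟩ := h.cross x hx.1 y hy.1 (by omega) (by omega)
      by_cases hK : x ∈ K ∧ y ∈ K
      · exact Or.inl hK.1
      have h3 := hr' x (hcan x hx.1) y (hcan y hy.1) h1 (h2 hK)
      by_cases hT : r y + T ≤ r x
      · exact Or.inr (Or.inl (by exact_mod_cast hT))
      · refine Or.inr (Or.inr ⟨Finset.mem_filter.2 ⟨hS x (hcan x hx.1) y (hcan y hy.1) h3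
          (by omega), h1, fun h4 => ?_⟩, by exact_mod_cast h3.le⟩)
        -- The pair is new: before the step `x` was below the gap and `y` above it, so `y` did not
        -- reach `x`.
        have := hreach x hx.1 y hy.1 h4
        omega
  have hsum := Finset.sum_le_sum hgap
  rw [← Finset.mul_sum] at hsum
  simp only [Finset.sum_add_distrib, Finset.sum_sub_distrib, Finset.sum_const, Finset.card_range,
    nsmul_eq_mul] at hsum
  rw [sum_sum_filter_Ico h.mid_le, sum_sum_filter_Ico hq] at hsum
  have h1 : ∑ g ∈ Finset.range n, ((can.filter fun x => q x ≤ g ∧ g < mid x).card : ℤ) =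
      ∑ x ∈ can, ((mid x - q x : ℕ) : ℤ) := by
    have := sum_sum_filter_Ico (a := q) (r := fun _ => 1) h.mid_le
    simpa using this
  rw [h1] at hsum
  -- Upward minus downward displacement is the signed displacement, which makes the rank sums
  -- telescope.
  have h2 : ∑ x ∈ can, (r x : ℤ) * ((mid x - q x : ℕ) : ℤ) -
      ∑ x ∈ can, (r x : ℤ) * ((q x - mid x : ℕ) : ℤ) =
      ∑ x ∈ can, (r x : ℤ) * mid x - ∑ x ∈ can, (r x : ℤ) * q x := by
    rw [← Finset.sum_sub_distrib, ← Finset.sum_sub_distrib]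
    refine Finset.sum_congr rfl fun x _ => ?_
    rw [← mul_sub, ← mul_sub]
    congr 1
    omega
  rw [h2] at hsum
  set d := (can \ can').card
  -- Passing from `mid` to `q'` loses at most `n ^ 2` for each deleted element, and the survivors
  -- shift down by at most `d` each, which accounts for another `n ^ 2 * d`.
  have h3 : ∑ x ∈ can, (r x : ℤ) * mid x ≤ ∑ x ∈ can', (r x : ℤ) * q' x + 2 * n ^ 2 * d := by
    rw [← Finset.sum_sdiff h.sub]
    have h4 : ∑ x ∈ can \ can', (r x : ℤ) * mid x ≤ n ^ 2 * d := by
      rw [mul_comm, ← nsmul_eq_mul]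
      refine Finset.sum_le_card_nsmul _ _ _ fun x hx => ?_
      have h5 := hr x
      have h6 := h.mid_le x (Finset.mem_sdiff.1 hx).1
      rw [sq]
      gcongr
    have h5 : ∑ x ∈ can', (r x : ℤ) * mid x ≤ ∑ x ∈ can', (r x : ℤ) * q' x + n ^ 2 * d := by
      have h6 : ∑ x ∈ can', (r x : ℤ) * mid x ≤ ∑ x ∈ can', ((r x : ℤ) * q' x + n * d) := by
        refine Finset.sum_le_sum fun x hx => ?_
        have h7 : (mid x : ℤ) ≤ q' x + d := by exact_mod_cast (h.shift x hx).2
        have h8 : (r x : ℤ) ≤ n := by exact_mod_cast hr x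
        calc (r x : ℤ) * mid x ≤ r x * (q' x + d) := by gcongr
          _ = r x * q' x + r x * d := mul_add _ _ _
          _ ≤ _ := by gcongr
      rw [Finset.sum_add_distrib, Finset.sum_const, nsmul_eq_mul] at h6
      have h7 : can'.card ≤ n := by
        simpa using Finset.card_le_card (fun x hx => Finset.mem_range.2 (hcan x (h.sub hx)))
      have h8 : (can'.card : ℤ) * (n * d) ≤ n * (n * d) := by gcongr
      linarith
    linarith
  have h4 : (T + n : ℤ) * K.card ≤ (T + n) * (2 * d) := by
    have := h.card_K
    gcongr
    exact_mod_cast this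
  have h5 : (n : ℤ) * ((T + n) * K.card) ≤ n * ((T + n) * (2 * d)) := by gcongr
  rw [← hBc]
  linarith

/-- A ranking of `0, …, n - 1` compatible with the order of related elements at all times. -/
theorem exists_rank {n : ℕ} {q : ℕ → ℕ → ℕ} {reach : ℕ → ℕ → ℕ → Prop}
    (hq : ∀ x < n, ∀ y < n, q 0 x = q 0 y → x = y)
    (hmono : ∀ k y x, reach k y x → reach (k + 1) y x) (m : ℕ)
    (hreach : ∀ k ≤ m, ∀ x < n, ∀ y < n, reach k y x → q k y ≤ q k x) :
    ∃ r : ℕ → ℕ, (∀ x, r x ≤ n) ∧ (∀ x < n, ∀ y < n, r x = r y → x = y) ∧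
      ∀ k ≤ m, ∀ x < n, ∀ y < n, reach k y x → q k y < q k x → r y < r x := by
  -- The ranking counts lexicographic predecessors with respect to `a`, then `b`. It is injective as
  -- soon as the pair of values separates elements.
  have key : ∀ (a b : ℕ → ℕ), (∀ x < n, ∀ y < n, a x = a y → b x = b y → x = y) →
      ∃ r : ℕ → ℕ, (∀ x, r x ≤ n) ∧ (∀ x < n, ∀ y < n, r x = r y → x = y) ∧
        ∀ x < n, ∀ y < n, (a y < a x ∨ a y = a x ∧ b y < b x) → r y < r x := by
    intro a b hab
    let r : ℕ → ℕ := fun x =>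
      ((Finset.range n).filter fun z => a z < a x ∨ a z = a x ∧ b z < b x).card
    have hlt : ∀ x < n, ∀ y < n, (a y < a x ∨ a y = a x ∧ b y < b x) → r y < r x := by
      intro x hx y hy h
      refine Finset.card_lt_card (Finset.ssubset_iff_of_subset ?_ |>.2 ⟨y, ?_, ?_⟩)
      · intro z hz
        simp only [Finset.mem_filter] at hz ⊢
        exact ⟨hz.1, by omega⟩
      · simp [hy, h]
      · simp
    refine ⟨r, fun x => (Finset.card_filter_le _ _).trans (by simp), fun x hx y hy e => ?_, hlt⟩
    by_contra hne
    rcases lt_trichotomy (a x) (a y) with h | h | h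
    · have := hlt y hy x hx (Or.inl h); omega
    · rcases lt_trichotomy (b x) (b y) with h' | h' | h'
      · have := hlt y hy x hx (Or.inr ⟨h, h'⟩); omega
      · exact hne (hab x hx y hy h h')
      · have := hlt x hx y hy (Or.inr ⟨h.symm, h'⟩); omega
    · have := hlt x hx y hy (Or.inl h); omega
  induction m with
  | zero =>
    obtain ⟨r, h1, h2, h3⟩ := key (q 0) (q 0) fun x hx y hy e _ => hq x hx y hy e
    refine ⟨r, h1, h2, fun k hk x hx y hy _ hlt => ?_⟩
    obtain rfl : k = 0 := by omega
    exact h3 x hx y hy (Or.inl hlt)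
  | succ m ih =>
    obtain ⟨r, -, h2, h3⟩ := ih fun k hk => hreach k (by omega)
    obtain ⟨r', h1', h2', h3'⟩ := key (q (m + 1)) r fun x hx y hy _ e => h2 x hx y hy e
    have hm : ∀ k k' y x, k ≤ k' → reach k y x → reach k' y x := by
      intro k k' y x hk h
      induction hk with
      | refl => exact h
      | step _ ih => exact hmono _ _ _ ih
    refine ⟨r', h1', h2', fun k hk x hx y hy hre hlt => h3' x hx y hy ?_⟩
    rcases hk.lt_or_eq with hk | rfl
    -- Relations persist, so the latest order puts `y` weakly before `x`; ties are broken by the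
    -- previous ranking, which is right by induction.
    · have h4 := hreach (m + 1) le_rfl x hx y hy (hm _ _ _ _ (by omega) hre)
      have h5 := h3 k (by omega) x hx y hy hre hlt
      omega
    · exact Or.inl hlt

/-- The total displacement in a sequence of reorderings that maintain a topological order. -/
theorem sum_displacement_le {n T m : ℕ} {can K : ℕ → Finset ℕ} {q mid : ℕ → ℕ → ℕ}
    {reach : ℕ → ℕ → ℕ → Prop} (hT : T * T ≤ n)
    (hcan : ∀ k ≤ m, ∀ x ∈ can k, x < n) (hqn : ∀ k ≤ m, ∀ x < n, q k x ≤ n)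
    (hq : ∀ x < n, ∀ y < n, q 0 x = q 0 y → x = y)
    (hmono : ∀ k y x, reach k y x → reach (k + 1) y x)
    (hreach : ∀ k ≤ m, ∀ x < n, ∀ y < n, reach k y x → q k y ≤ q k x)
    (hstep : ∀ k < m, OrderStep n (can k) (can (k + 1)) (K k) (q k) (mid k) (q (k + 1))
      (reach (k + 1))) :
    T * ∑ k ∈ Finset.range m, ∑ x ∈ can k, (mid k x - q k x) ≤ 8 * n ^ 3 := by
  classical
  obtain ⟨r, hr1, hr2, hr3⟩ := exists_rank hq hmono m hreach
  let S := ((Finset.range n) ×ˢ (Finset.range n)).filter fun p => r p.1 < r p.2 ∧ r p.2 < r p.1 + T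
  -- A close pair is determined by its first element and by the difference of the ranks, which is
  -- below `T`.
  have hSc : S.card ≤ n * T := by
    have : S.card ≤ ((Finset.range n) ×ˢ (Finset.range T)).card := by
      refine Finset.card_le_card_of_injOn (fun p => (p.1, r p.2 - r p.1)) ?_ ?_
      · rintro ⟨y, x⟩ h
        simp only [S, Finset.coe_filter, Finset.mem_product, Finset.mem_range,
          Set.mem_ofPred_eq] at h
        simp only [Finset.coe_product, Finset.coe_range, Set.mem_prod, Set.mem_Iio]
        omega
      · rintro ⟨y, x⟩ h ⟨y', x'⟩ h' e
        simp only [S, Finset.coe_filter, Finset.mem_product, Finset.mem_range,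
          Set.mem_ofPred_eq] at h h'
        simp only [Prod.mk.injEq] at e
        obtain ⟨rfl, e⟩ := e
        rw [hr2 x h.1.2 x' h'.1.2 (by omega)]
    simpa using this
  -- The potential combines rank-weighted positions, related close pairs, and a term that rises when
  -- canonical elements disappear and thus pays for deletions.
  let Φ : ℕ → ℤ := fun k => ∑ x ∈ can k, (r x : ℤ) * q k x +
    T * n * (S.filter fun p => reach k p.1 p.2).card - (4 * n ^ 2 + 2 * n * T) * (can k).card
  have key : ∀ k ≤ m, (T : ℤ) * ∑ k ∈ Finset.range k, ∑ x ∈ can k, ((mid k x - q k x : ℕ) : ℤ) ≤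
      Φ k - Φ 0 := by
    intro k hk
    induction k with
    | zero => simp
    | succ k ih =>
      rw [Finset.sum_range_succ, mul_add]
      have h1 := ih (by omega)
      have h2 := (hstep k (by omega)).mul_le (T := T) (reach := reach k) (S := S) (r := r)
        (hcan k (by omega)) (fun x hx => hqn k (by omega) x (hcan k (by omega) x hx))
        (fun x hx y hy => hreach k (by omega) x (hcan k (by omega) x hx) y
          (hcan k (by omega) y hy)) (hmono k) hr1 (hr3 (k + 1) hk)
        (fun x hx y hy h3 h4 => by simp [S, hx, hy, h3, h4])
      have h3 : (((can k) \ can (k + 1)).card : ℤ) = (can k).card - (can (k + 1)).card := by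
        have h4 := (hstep k (by omega)).sub
        rw [Finset.card_sdiff_of_subset h4, Nat.cast_sub (Finset.card_le_card h4)]
      rw [h3] at h2
      simp only [Φ] at h1 ⊢
      linarith
  have h1 := key m le_rfl
  have hcard : ∀ k ≤ m, (can k).card ≤ n := fun k hk => by
    simpa using Finset.card_le_card (fun x hx => Finset.mem_range.2 (hcan k hk x hx))
  have h2 : Φ m ≤ n ^ 3 + T * n * (n * T) := by
    have h3 : ∑ x ∈ can m, (r x : ℤ) * q m x ≤ n ^ 3 := by
      have : ∑ x ∈ can m, (r x : ℤ) * q m x ≤ (can m).card • (n * n : ℤ) := by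
        refine Finset.sum_le_card_nsmul _ _ _ fun x hx => ?_
        have h5 := hr1 x
        have h6 := hqn m le_rfl x (hcan m le_rfl x hx)
        gcongr
      have h4 := hcard m le_rfl
      rw [nsmul_eq_mul] at this
      calc _ ≤ _ := this
        _ ≤ (n : ℤ) * (n * n) := by gcongr
        _ = n ^ 3 := by ring
    have h4 : (S.filter fun p => reach m p.1 p.2).card ≤ n * T :=
      (Finset.card_filter_le _ _).trans hSc
    have h5 : (T * n * (S.filter fun p => reach m p.1 p.2).card : ℤ) ≤ T * n * (n * T) := by
      gcongr
      exact_mod_cast h4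
    have h6 : (0 : ℤ) ≤ (4 * n ^ 2 + 2 * n * T) * (can m).card := by positivity
    simp only [Φ]
    linarith
  have h3 : -Φ 0 ≤ (4 * n ^ 2 + 2 * n * T) * n := by
    have h4 : (0 : ℤ) ≤ ∑ x ∈ can 0, (r x : ℤ) * q 0 x := by positivity
    have h5 : (0 : ℤ) ≤ T * n * (S.filter fun p => reach 0 p.1 p.2).card := by positivity
    have h6 := hcard 0 (by omega)
    have h7 : (4 * n ^ 2 + 2 * n * T : ℤ) * (can 0).card ≤ (4 * n ^ 2 + 2 * n * T) * n := by gcongr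
    simp only [Φ]
    linarith
  -- This keeps the close pair term `T * n * (n * T)` within `n ^ 3`.
  have h4 : (T : ℤ) * T ≤ n := by exact_mod_cast hT
  have h5 : (T : ℤ) ≤ n := by nlinarith [sq_nonneg ((T : ℤ) - 1), (Nat.cast_nonneg T : (0 : ℤ) ≤ T)]
  have h6 : (T : ℤ) * n * (n * T) ≤ n ^ 3 := by
    calc (T : ℤ) * n * (n * T) = T * T * n ^ 2 := by ring
      _ ≤ n * n ^ 2 := by gcongr
      _ = n ^ 3 := by ring
  have h7 : (2 * n * T : ℤ) * n ≤ 2 * n ^ 3 := by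
    calc (2 * n * T : ℤ) * n = 2 * n ^ 2 * T := by ring
      _ ≤ 2 * n ^ 2 * n := by gcongr
      _ = 2 * n ^ 3 := by ring
  have h8 : (T : ℤ) * ∑ k ∈ Finset.range m, ∑ x ∈ can k, ((mid k x - q k x : ℕ) : ℤ) ≤
      8 * n ^ 3 := by
    linarith
  exact_mod_cast h8

/-! ### Vacancies left by the search -/

namespace SearchResult

variable {n N k tF tB v w : ℕ} {C : ℕ → Prop} {V P F B V0 : ℕ → ℕ} {G : ℕ → ℕ → Prop}

theorem one_le (H : SearchResult n N C V P G v w k tF tB F B V0) : 1 ≤ k := by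
  have := H.pos_lt; omega

theorem k_le (H : SearchResult n N C V P G v w k tF tB F B V0) (hN : IsNumbering C V P N) :
    k ≤ N := by
  have h1 := hN.pos_le _ (H.state.B_can 0 H.state.B_pos)
  rw [H.state.B_zero] at h1
  exact H.le_pos.trans h1

theorem vertex_k (H : SearchResult n N C V P G v w k tF tB F B V0) : V0 k = n := by
  rcases H.meet with ⟨-, ⟨t, ht, rfl⟩, -⟩ | ⟨-, ⟨t, ht, rfl⟩, -⟩
  · exact H.state.vertex_null' t ht
  · exact H.state.vertex_null t ht

theorem vertex_eq_null_iff (H : SearchResult n N C V P G v w k tF tB F B V0)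
    (hN : IsNumbering C V P N) (hC : ∀ x, C x → x < n) {l : ℕ} (h1 : 1 ≤ l) (h2 : l ≤ N) :
    V0 l = n ↔ (∃ t < tF, P (F t) = l) ∨ ∃ t < tB, P (B t) = l := by
  constructor
  · intro h
    by_contra! hne
    have h3 := H.state.vertex_eq l h1 h2 hne.1 hne.2
    have h4 := hC _ (hN.can_vertex l h1 h2)
    omega
  · rintro (⟨t, ht, rfl⟩ | ⟨t, ht, rfl⟩)
    · exact H.state.vertex_null t ht
    · exact H.state.vertex_null' t ht

theorem card_image_F (H : SearchResult n N C V P G v w k tF tB F B V0) :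
    ((Finset.range tF).image fun t => P (F t)).card = tF := by
  rw [Finset.card_image_of_injOn, Finset.card_range]
  intro t ht t' ht' e
  simp only [Finset.coe_range, Set.mem_Iio] at ht ht' e
  rcases lt_trichotomy t t' with h | h | h
  · have := H.state.F_mono t t' h ht'; omega
  · exact h
  · have := H.state.F_mono t' t h ht; omega

theorem card_image_B (H : SearchResult n N C V P G v w k tF tB F B V0) :
    ((Finset.range tB).image fun t => P (B t)).card = tB := by
  rw [Finset.card_image_of_injOn, Finset.card_range]
  intro t ht t' ht' e
  simp only [Finset.coe_range, Set.mem_Iio] at ht ht' e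
  rcases lt_trichotomy t t' with h | h | h
  · have := H.state.B_anti t t' h ht'; omega
  · exact h
  · have := H.state.B_anti t' t h ht; omega

/-- The positions vacated from `k` on are those of `B`, together with `k` itself if `k` belongs to
`F`. By the alternation of the search the number is the size of `F` in both cases, so `F` fits
exactly. -/
theorem nullCount_ge (H : SearchResult n N C V P G v w k tF tB F B V0)
    (hN : IsNumbering C V P N) (hC : ∀ x, C x → x < n) : tF = nullCount n V0 k N := by
  have hk1 := H.one_le
  have hkN := H.k_le hN
  have hB : ∀ t < tB, P (B t) ≤ N := fun t ht => hN.pos_le _ (H.state.B_can t ht)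
  unfold nullCount
  rcases H.meet with ⟨e, ⟨t, ht, hk⟩, hF⟩ | ⟨e, ⟨t, ht, hk⟩, hB'⟩
  · conv_lhs => rw [e, ← H.card_image_B]
    congr 1
    ext l
    simp only [Finset.mem_image, Finset.mem_range, Finset.mem_filter, Finset.mem_Icc]
    constructor
    · rintro ⟨t, ht, rfl⟩
      exact ⟨⟨H.state.B_ge t ht, hB t ht⟩, H.state.vertex_null' t ht⟩
    · rintro ⟨⟨h1, h2⟩, h3⟩
      rcases (H.vertex_eq_null_iff hN hC (hk1.trans h1) h2).1 h3 with ⟨t, ht, rfl⟩ | h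
      · have := hF t ht; omega
      · exact h
  · have hnot : k ∉ (Finset.range tB).image fun t => P (B t) := by
      simp only [Finset.mem_image, Finset.mem_range, not_exists, not_and]
      intro t ht e
      have := hB' t ht
      omega
    conv_lhs => rw [e, ← H.card_image_B, ← Finset.card_insert_of_notMem hnot]
    congr 1
    ext l
    simp only [Finset.mem_image, Finset.mem_range, Finset.mem_filter, Finset.mem_Icc,
      Finset.mem_insert]
    constructor
    · rintro (rfl | ⟨t, ht, rfl⟩)
      · exact ⟨⟨le_rfl, hkN⟩, H.vertex_k⟩
      · exact ⟨⟨H.state.B_ge t ht, hB t ht⟩, H.state.vertex_null' t ht⟩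
    · rintro ⟨⟨h1, h2⟩, h3⟩
      rcases (H.vertex_eq_null_iff hN hC (hk1.trans h1) h2).1 h3 with ⟨t, ht, rfl⟩ | h
      · exact Or.inl (le_antisymm (H.state.F_le t ht) h1)
      · exact Or.inr h

/-- Below `k` the vacancies are the positions of `F`, except `k` itself when it belongs to `F`; in
both cases there are as many as elements of `B`. -/
theorem nullCount_lt (H : SearchResult n N C V P G v w k tF tB F B V0)
    (hN : IsNumbering C V P N) (hC : ∀ x, C x → x < n) : tB = nullCount n V0 1 (k - 1) := by
  have hk1 := H.one_le
  have hkN := H.k_le hN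
  have hF1 : ∀ t < tF, 1 ≤ P (F t) := fun t ht => hN.pos_ge _ (H.state.F_can t ht)
  unfold nullCount
  rcases H.meet with ⟨e, ⟨t, ht, hk⟩, hF⟩ | ⟨e, ⟨t, ht, hk⟩, hB'⟩
  · conv_lhs => rw [← e, ← H.card_image_F]
    congr 1
    ext l
    simp only [Finset.mem_image, Finset.mem_range, Finset.mem_filter, Finset.mem_Icc]
    constructor
    · rintro ⟨t, ht, rfl⟩
      have := hF t ht
      exact ⟨⟨hF1 t ht, by omega⟩, H.state.vertex_null t ht⟩
    · rintro ⟨⟨h1, h2⟩, h3⟩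
      rcases (H.vertex_eq_null_iff hN hC h1 (by omega)).1 h3 with h | ⟨t, ht, rfl⟩
      · exact h
      · have := H.state.B_ge t ht; omega
  · have hmem : k ∈ (Finset.range tF).image fun t => P (F t) := by
      simp only [Finset.mem_image, Finset.mem_range]
      exact ⟨t, ht, hk⟩
    have h0 : tB = tF - 1 := by omega
    conv_lhs => rw [h0, ← H.card_image_F, ← Finset.card_erase_of_mem hmem]
    congr 1
    ext l
    simp only [Finset.mem_image, Finset.mem_range, Finset.mem_filter, Finset.mem_Icc,
      Finset.mem_erase]
    constructor
    · rintro ⟨hl, t, ht, rfl⟩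
      have := H.state.F_le t ht
      exact ⟨⟨hF1 t ht, by omega⟩, H.state.vertex_null t ht⟩
    · rintro ⟨⟨h1, h2⟩, h3⟩
      refine ⟨by omega, ?_⟩
      rcases (H.vertex_eq_null_iff hN hC h1 (by omega)).1 h3 with h | ⟨t, ht, rfl⟩
      · exact h
      · have := H.state.B_ge t ht; omega

theorem gapped (H : SearchResult n N C V P G v w k tF tB F B V0)
    (hN : IsNumbering C V P N) (hC : ∀ x, C x → x < n) : Gapped n N C P V0 := by
  refine ⟨hC, fun x y hx hy e => hN.inj hx hy e, fun l h1 h2 h3 => ?_⟩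
  rw [Ne, H.vertex_eq_null_iff hN hC h1 h2] at h3
  push Not at h3
  rw [H.state.vertex_eq l h1 h2 h3.1 h3.2]
  exact ⟨hN.can_vertex l h1 h2, hN.pos_vertex l h1 h2⟩

end SearchResult

/-! ### The order after reordering -/

/-- The outcome of the search and the reordering: a numbering `P` with order `V` is replaced by `P'`
with order `V'`. The arcs of `G` agree with `P`, except for the new arc from `v` to `w`. -/
structure Reordered (n N : ℕ) (C : ℕ → Prop) (V P : ℕ → ℕ) (G : ℕ → ℕ → Prop) (v w k tF tB : ℕ)
    (F0 B0 V0 : ℕ → ℕ) (i TF : ℕ) (F V1 P1 : ℕ → ℕ) (j TB : ℕ) (B V' P' : ℕ → ℕ) : Prop where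
  num : IsNumbering C V P N
  can_lt : ∀ x, C x → x < n
  order : ∀ x y, C x → C y → G x y → P x < P y ∨ x = v ∧ y = w
  new_arc : G v w
  search : SearchResult n N C V P G v w k tF tB F0 B0 V0
  fwd : FwdState n N k C P V0 G F0 tF i TF TF F V1 P1
  bwd : BwdState n k C P V1 P1 G B0 tB j TB TB B V' P'

namespace Reordered

variable {n N : ℕ} {C : ℕ → Prop} {V P : ℕ → ℕ} {G : ℕ → ℕ → Prop} {v w k tF tB : ℕ}
  {F0 B0 V0 : ℕ → ℕ} {i TF : ℕ} {F V1 P1 : ℕ → ℕ} {j TB : ℕ} {B V' P' : ℕ → ℕ}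

theorem gapped (H : Reordered n N C V P G v w k tF tB F0 B0 V0 i TF F V1 P1 j TB B V' P') :
    Gapped n N C P V0 := H.search.gapped H.num H.can_lt

theorem listedF (H : Reordered n N C V P G v w k tF tB F0 B0 V0 i TF F V1 P1 j TB B V' P') {x : ℕ}
    (h : Listed tF F0 x) : Listed TF F x := by
  obtain ⟨t, ht, rfl⟩ := h
  exact ⟨t, ht.trans_le H.fwd.m_le, H.fwd.orig t ht⟩

theorem listedB (H : Reordered n N C V P G v w k tF tB F0 B0 V0 i TF F V1 P1 j TB B V' P') {x : ℕ}
    (h : Listed tB B0 x) : Listed TB B x := by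
  obtain ⟨t, ht, rfl⟩ := h
  exact ⟨t, ht.trans_le H.bwd.m_le, H.bwd.orig t ht⟩

theorem searchedF (H : Reordered n N C V P G v w k tF tB F0 B0 V0 i TF F V1 P1 j TB B V' P')
    {x : ℕ} (h : Listed tF F0 x) : C x ∧ V0 (P x) = n ∧ P x ≤ k := by
  obtain ⟨t, ht, rfl⟩ := h
  exact ⟨H.search.state.F_can t ht, H.search.state.vertex_null t ht, H.search.state.F_le t ht⟩

theorem searchedB (H : Reordered n N C V P G v w k tF tB F0 B0 V0 i TF F V1 P1 j TB B V' P')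
    {x : ℕ} (h : Listed tB B0 x) : C x ∧ V0 (P x) = n ∧ k ≤ P x := by
  obtain ⟨t, ht, rfl⟩ := h
  exact ⟨H.search.state.B_can t ht, H.search.state.vertex_null' t ht, H.search.state.B_ge t ht⟩

theorem movedF (H : Reordered n N C V P G v w k tF tB F0 B0 V0 i TF F V1 P1 j TB B V' P')
    {x : ℕ} (h : Listed TF F x) : C x ∧ (Listed tF F0 x ∨ k < P x ∧ V0 (P x) = x) := by
  obtain ⟨t, ht, rfl⟩ := h
  refine ⟨H.fwd.can t ht, ?_⟩
  by_cases h : t < tF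
  · exact Or.inl ⟨t, h, (H.fwd.orig t h).symm⟩
  · obtain ⟨h1, h2, -⟩ := H.fwd.pulled t (by omega) ht
    refine Or.inr ⟨lt_of_le_of_ne h1 fun e => ?_, h2⟩
    have h3 := H.can_lt _ (H.fwd.can t ht)
    rw [← e, H.search.vertex_k] at h2
    omega

theorem movedB (H : Reordered n N C V P G v w k tF tB F0 B0 V0 i TF F V1 P1 j TB B V' P')
    {x : ℕ} (h : Listed TB B x) : C x ∧ (Listed tB B0 x ∨ P x < k ∧ V0 (P x) = x) := by
  obtain ⟨t, ht, rfl⟩ := h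
  refine ⟨H.bwd.can t ht, ?_⟩
  by_cases h : t < tB
  · exact Or.inl ⟨t, h, (H.bwd.orig t h).symm⟩
  · obtain ⟨h1, h2, -⟩ := H.bwd.pulled t (by omega) ht
    exact Or.inr ⟨h1, by rwa [← H.fwd.before _ h1]⟩

theorem disjoint_search (H : Reordered n N C V P G v w k tF tB F0 B0 V0 i TF F V1 P1 j TB B V' P')
    {x : ℕ} (h : Listed tF F0 x) (h' : Listed tB B0 x) : False := by
  obtain ⟨t, ht, rfl⟩ := h
  obtain ⟨t', ht', e⟩ := h'
  have := H.search.state.F_lt_B t ht t' ht'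
  rw [e] at this
  omega

/-- Searched elements of `F` lie before those of `B`. An element lifted out during reordering was
not searched, and the two directions lift on different sides of `k`. -/
theorem disjoint (H : Reordered n N C V P G v w k tF tB F0 B0 V0 i TF F V1 P1 j TB B V' P')
    {x : ℕ} (h : Listed TF F x) (h' : Listed TB B x) : False := by
  obtain ⟨hC, h1⟩ := H.movedF h
  obtain ⟨-, h2⟩ := H.movedB h'
  have hn := H.can_lt x hC
  rcases h1 with h1 | h1 <;> rcases h2 with h2 | h2
  · exact H.disjoint_search h1 h2
  · have := H.searchedF h1; omega
  · have := H.searchedB h2; omega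
  · omega

theorem vertex_of_not_searched
    (H : Reordered n N C V P G v w k tF tB F0 B0 V0 i TF F V1 P1 j TB B V' P')
    {x : ℕ} (hx : C x) (h1 : ¬ Listed tF F0 x) (h2 : ¬ Listed tB B0 x) : V0 (P x) = x := by
  rw [H.search.state.vertex_eq _ (H.num.pos_ge x hx) (H.num.pos_le x hx), H.num.vertex_pos x hx]
  · exact fun t ht e => h1 ⟨t, ht, H.num.inj (H.search.state.F_can t ht) hx e⟩
  · exact fun t ht e => h2 ⟨t, ht, H.num.inj (H.search.state.B_can t ht) hx e⟩

/-- The search always vacates position `k`. -/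
theorem ne_k (H : Reordered n N C V P G v w k tF tB F0 B0 V0 i TF F V1 P1 j TB B V' P')
    {x : ℕ} (hx : C x) (h1 : ¬ Listed TF F x) (h2 : ¬ Listed TB B x) : P x ≠ k := by
  intro e
  have h3 := H.vertex_of_not_searched hx (fun h => h1 (H.listedF h)) (fun h => h2 (H.listedB h))
  have := H.can_lt x hx
  rw [e, H.search.vertex_k] at h3
  omega

theorem pos_F (H : Reordered n N C V P G v w k tF tB F0 B0 V0 i TF F V1 P1 j TB B V' P')
    {x : ℕ} (h : ¬ Listed TB B x) : P' x = P1 x :=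
  H.bwd.pos_eq x fun a ha e => h ⟨a, ha, e⟩

theorem up (H : Reordered n N C V P G v w k tF tB F0 B0 V0 i TF F V1 P1 j TB B V' P')
    {x : ℕ} (h : Listed TF F x) : k ≤ P' x ∧ P' x < i ∧ P x < P' x ∧ V' (P' x) = x := by
  rw [H.pos_F fun h' => H.disjoint h h']
  obtain ⟨t, ht, rfl⟩ := h
  obtain ⟨h1, h2, h3, h4⟩ := H.fwd.placed t ht
  exact ⟨h1, h2, h4, by rwa [H.bwd.after _ h1]⟩

theorem down (H : Reordered n N C V P G v w k tF tB F0 B0 V0 i TF F V1 P1 j TB B V' P')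
    {x : ℕ} (h : Listed TB B x) : j ≤ P' x ∧ P' x < k ∧ P' x < P x ∧ V' (P' x) = x := by
  obtain ⟨t, ht, rfl⟩ := h
  obtain ⟨h1, h2, h3, h4⟩ := H.bwd.placed t ht
  exact ⟨h1, h2, h4, h3⟩

theorem fixed (H : Reordered n N C V P G v w k tF tB F0 B0 V0 i TF F V1 P1 j TB B V' P')
    {x : ℕ} (hx : C x) (h1 : ¬ Listed TF F x) (h2 : ¬ Listed TB B x) : P' x = P x := by
  rw [H.pos_F h2]
  exact H.fwd.pos_eq x hx fun a ha e => h1 ⟨a, ha, e⟩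

theorem vertex_high (H : Reordered n N C V P G v w k tF tB F0 B0 V0 i TF F V1 P1 j TB B V' P')
    {l : ℕ} (h1 : k ≤ l) (h2 : l ≤ N) : (∃ x, Listed TF F x ∧ P' x = l) ∨
      V' l = V0 l ∧ V0 l ≠ n ∧ ¬ Listed TF F (V0 l) ∧
      (l < i → ∀ x, Listed TF F x → P x < l → G x (V0 l) → P' x < l) := by
  rw [H.bwd.after l h1]
  by_cases hl : l < i
  · rcases H.fwd.passed l h1 hl with ⟨⟨a, ha, e⟩, -⟩ | ⟨h3, h4, h5, h6⟩
    · left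
      refine ⟨F a, ⟨a, ha, rfl⟩, ?_⟩
      rw [H.pos_F fun h' => H.disjoint ⟨a, ha, rfl⟩ h', e]
    · refine Or.inr ⟨h3, h4, fun ⟨a, ha, e⟩ => h5 a ha e, fun _ x hx hP hG => ?_⟩
      rw [H.pos_F fun h' => H.disjoint hx h']
      obtain ⟨a, ha, rfl⟩ := hx
      exact (h6 a ha hP hG).2
  -- The queue ends empty, so no vacancy is left from `i` on and these positions are unchanged.
  · have hc := H.fwd.count
    have hne : V1 l ≠ n := ne_of_nullCount_eq_zero (by omega) (not_lt.1 hl) h2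
    have he : V1 l = V0 l := (H.fwd.rest l (not_lt.1 hl)).resolve_right fun h => hne h.2.1
    rw [he] at hne
    refine Or.inr ⟨he, hne, fun ⟨a, ha, e⟩ => ?_, fun h => absurd h hl⟩
    have h3 := (H.gapped.spec l (H.search.one_le.trans h1) h2 hne).2
    have h4 := H.fwd.le a ha
    rw [e, h3] at h4
    have h5 : l = k := by omega
    rw [h5, H.search.vertex_k] at hne
    exact hne rfl

theorem vertex_low (H : Reordered n N C V P G v w k tF tB F0 B0 V0 i TF F V1 P1 j TB B V' P')
    {l : ℕ} (h1 : 1 ≤ l) (h2 : l < k) : (∃ x, Listed TB B x ∧ P' x = l) ∨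
      V' l = V0 l ∧ V0 l ≠ n ∧ ¬ Listed TB B (V0 l) ∧
      (j ≤ l → ∀ x, Listed TB B x → l < P x → G (V0 l) x → l < P' x) := by
  rw [← H.fwd.before l h2]
  have hkN := H.search.k_le H.num
  by_cases hl : j ≤ l
  · rcases H.bwd.passed l hl h2 with ⟨⟨a, ha, e⟩, -⟩ | ⟨h3, h4, h5, h6⟩
    · exact Or.inl ⟨B a, ⟨a, ha, rfl⟩, e⟩
    · refine Or.inr ⟨h3, h4, fun ⟨a, ha, e⟩ => h5 a ha e, fun _ x hx hP hG => ?_⟩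
      obtain ⟨a, ha, rfl⟩ := hx
      exact (h6 a ha hP hG).2
  · have hc := H.bwd.count
    have hne : V' l ≠ n := ne_of_nullCount_eq_zero (a := 1) (b := j - 1) (by omega) h1 (by omega)
    have he : V' l = V1 l := (H.bwd.rest l (by omega)).resolve_right fun h => hne h.2.1
    rw [he] at hne
    refine Or.inr ⟨he, hne, fun ⟨a, ha, e⟩ => ?_, fun h => absurd h hl⟩
    rw [H.fwd.before l h2] at e hne
    have h3 := (H.gapped.spec l h1 (by omega) hne).2
    have h4 := H.bwd.ge a ha
    rw [e, h3] at h4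
    omega

/-- Every position holds either a moved element placed there or its original, unmoved element; a
cell is refilled only if it was vacated. -/
theorem renumbered (H : Reordered n N C V P G v w k tF tB F0 B0 V0 i TF F V1 P1 j TB B V' P') :
    IsNumbering C V' P' N := by
  have hkN := H.search.k_le H.num
  have hk1 := H.search.one_le
  have hiN := H.fwd.i_le
  have hj := H.bwd.one_le
  have hV : ∀ l, 1 ≤ l → l ≤ N → C (V' l) ∧ P' (V' l) = l := by
    intro l h1 h2
    by_cases hl : k ≤ l
    · rcases H.vertex_high hl h2 with ⟨x, hx, rfl⟩ | ⟨e, hn, hF, -⟩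
      · rw [(H.up hx).2.2.2]
        exact ⟨(H.movedF hx).1, rfl⟩
      · obtain ⟨hC, hP⟩ := H.gapped.spec l h1 h2 hn
        rw [e]
        refine ⟨hC, ?_⟩
        rw [H.fixed hC hF, hP]
        intro hB
        rcases (H.movedB hB).2 with h | h
        · have := (H.searchedB h).2.1
          rw [hP] at this
          exact hn this
        · omega
    · rcases H.vertex_low h1 (not_le.1 hl) with ⟨x, hx, rfl⟩ | ⟨e, hn, hB, -⟩
      · rw [(H.down hx).2.2.2]
        exact ⟨(H.movedB hx).1, rfl⟩
      · obtain ⟨hC, hP⟩ := H.gapped.spec l h1 h2 hn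
        rw [e]
        refine ⟨hC, ?_⟩
        rw [H.fixed hC _ hB, hP]
        intro hF
        rcases (H.movedF hF).2 with h | h
        · have := (H.searchedF h).2.1
          rw [hP] at this
          exact hn this
        · omega
  have hP : ∀ x, C x → 1 ≤ P' x ∧ P' x ≤ N ∧ V' (P' x) = x := by
    intro x hx
    by_cases h1 : Listed TF F x
    · have := H.up h1
      exact ⟨by omega, by omega, this.2.2.2⟩
    by_cases h2 : Listed TB B x
    · have := H.down h2
      exact ⟨by omega, by omega, this.2.2.2⟩
    have h3 := H.fixed hx h1 h2
    have h4 := H.num.pos_ge x hx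
    have h5 := H.num.pos_le x hx
    have h6 := H.vertex_of_not_searched hx (fun h => h1 (H.listedF h)) (fun h => h2 (H.listedB h))
    rw [h3]
    refine ⟨h4, h5, ?_⟩
    by_cases hl : k ≤ P x
    · rcases H.vertex_high hl h5 with ⟨y, hy, e⟩ | ⟨e, -⟩
      · exfalso
        -- If another element had been placed at the position of an unmoved `x`, then `x` would have
        -- been lifted out before.
        have h7 := H.fwd.passed (P x) hl (by have := H.up hy; omega)
        rw [h6] at h7
        rcases h7 with ⟨-, h7⟩ | ⟨h7, -⟩
        · exact h1 (h7 (H.can_lt x hx).ne)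
        · rw [← H.bwd.after _ hl, ← e, (H.up hy).2.2.2] at h7
          exact h1 (h7 ▸ hy)
      · rw [e, h6]
    · rcases H.vertex_low h4 (not_le.1 hl) with ⟨y, hy, e⟩ | ⟨e, -⟩
      · exfalso
        have h7 := H.bwd.passed (P x) (by have := H.down hy; omega) (not_le.1 hl)
        rw [H.fwd.before _ (not_le.1 hl), h6] at h7
        rcases h7 with ⟨-, h7⟩ | ⟨h7, -⟩
        · exact h2 (h7 (H.can_lt x hx).ne)
        · rw [← e, (H.down hy).2.2.2] at h7
          exact h2 (h7 ▸ hy)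
      · rw [e, h6]
  exact ⟨fun x hx => (hP x hx).1, fun x hx => (hP x hx).2.1, fun x hx => (hP x hx).2.2,
    fun l h1 h2 => (hV l h1 h2).1, fun l h1 h2 => (hV l h1 h2).2⟩

theorem listed_w (H : Reordered n N C V P G v w k tF tB F0 B0 V0 i TF F V1 P1 j TB B V' P') :
    Listed tF F0 w := ⟨0, H.search.state.F_pos, H.search.state.F_zero⟩

theorem listed_v (H : Reordered n N C V P G v w k tF tB F0 B0 V0 i TF F V1 P1 j TB B V' P') :
    Listed tB B0 v := ⟨0, H.search.state.B_pos, H.search.state.B_zero⟩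

theorem high (H : Reordered n N C V P G v w k tF tB F0 B0 V0 i TF F V1 P1 j TB B V' P')
    {x : ℕ} (hx : C x) (h : k ≤ P' x) : Listed TF F x ∨
      k < P x ∧ P' x = P x ∧ V0 (P x) = x ∧ ¬ Listed TF F x ∧ ¬ Listed TB B x := by
  by_cases h1 : Listed TF F x
  · exact Or.inl h1
  by_cases h2 : Listed TB B x
  · have := H.down h2; omega
  have h3 := H.fixed hx h1 h2
  have h4 := H.ne_k hx h1 h2
  exact Or.inr ⟨by omega, h3, H.vertex_of_not_searched hx (fun h => h1 (H.listedF h))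
    (fun h => h2 (H.listedB h)), h1, h2⟩

theorem low (H : Reordered n N C V P G v w k tF tB F0 B0 V0 i TF F V1 P1 j TB B V' P')
    {x : ℕ} (hx : C x) (h : P' x < k) : Listed TB B x ∨
      P x < k ∧ P' x = P x ∧ V0 (P x) = x ∧ ¬ Listed TF F x ∧ ¬ Listed TB B x := by
  by_cases h1 : Listed TF F x
  · have := H.up h1; omega
  by_cases h2 : Listed TB B x
  · exact Or.inl h2
  have h3 := H.fixed hx h1 h2
  have h4 := H.ne_k hx h1 h2
  exact Or.inr ⟨by omega, h3, H.vertex_of_not_searched hx (fun h => h1 (H.listedF h))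
    (fun h => h2 (H.listedB h)), h1, h2⟩

theorem closedF (H : Reordered n N C V P G v w k tF tB F0 B0 V0 i TF F V1 P1 j TB B V' P')
    {x y : ℕ} (hx : Listed tF F0 x) (hy : C y) (hG : G x y) (h : P x < P y) (hk : P y < k) :
    Listed tF F0 y := by
  obtain ⟨t, ht, rfl⟩ := hx
  exact H.search.state.F_closed t ht y hy hG h hk.le hk

theorem closedB (H : Reordered n N C V P G v w k tF tB F0 B0 V0 i TF F V1 P1 j TB B V' P')
    {x y : ℕ} (hx : C x) (hy : Listed tB B0 y) (hG : G x y) (h : P x < P y) (hk : k < P x) :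
    Listed tB B0 x := by
  obtain ⟨t, ht, rfl⟩ := hy
  exact H.search.state.B_closed t ht x hx hG h hk.le hk

/-- An arc from the upper to the lower part of the new order closes a cycle. -/
theorem searched_of_high_low
    (H : Reordered n N C V P G v w k tF tB F0 B0 V0 i TF F V1 P1 j TB B V' P')
    {x y : ℕ} (hx : C x) (hy : C y) (hG : G x y) (hkx : k ≤ P' x) (hky : P' y < k) :
    Listed tF F0 x ∧ Listed tB B0 y := by
  have hP : P x < P y := (H.order x y hx hy hG).resolve_right fun h => by
    have := H.down (H.listedB H.listed_v)
    rw [h.1] at hkx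
    omega
  -- If either end was not searched, closure of `F` or `B` along this arc would put it into the
  -- queue of the other end, or the two ends would be in the wrong order under `P`.
  rcases H.high hx hkx with h1 | ⟨h1, -, h2, h3, h4⟩
  · rcases (H.movedF h1).2 with h5 | ⟨h5, h6⟩
    · refine ⟨h5, ?_⟩
      rcases H.low hy hky with h7 | ⟨h7, -, -, h8, -⟩
      · rcases (H.movedB h7).2 with h8 | ⟨h8, h9⟩
        · exact h8
        · exact (H.disjoint (H.listedF (H.closedF h5 hy hG hP h8)) h7).elim
      · exact absurd (H.listedF (H.closedF h5 hy hG hP h7)) h8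
    · exfalso
      rcases H.low hy hky with h7 | ⟨h7, -⟩
      · rcases (H.movedB h7).2 with h8 | ⟨h8, h9⟩
        · exact H.disjoint h1 (H.listedB (H.closedB hx h8 hG hP h5))
        · omega
      · omega
  · exfalso
    rcases H.low hy hky with h7 | ⟨h7, -⟩
    · rcases (H.movedB h7).2 with h8 | ⟨h8, h9⟩
      · exact h4 (H.listedB (H.closedB hx h8 hG hP h1))
      · omega
    · omega

/-- On one side of `k`, queue order preserves the relative order of moved elements, and moving away
from `k` respects arcs into or out of unmoved elements because any that would be overtaken is lifted
as well. Across `k`, only an arc from searched `F` to searched `B` can point backwards. -/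
theorem lt_of_arc (H : Reordered n N C V P G v w k tF tB F0 B0 V0 i TF F V1 P1 j TB B V' P')
    {x y : ℕ} (hx : C x) (hy : C y) (hG : G x y) :
    P' x < P' y ∨ Listed tF F0 x ∧ Listed tB B0 y := by
  have hk1 := H.search.one_le
  by_cases hkx : k ≤ P' x
  · by_cases hky : k ≤ P' y
    · left
      have hP : P x < P y := (H.order x y hx hy hG).resolve_right fun h => by
        have := H.down (H.listedB H.listed_v)
        rw [h.1] at hkx
        omega
      rcases H.high hx hkx with h1 | ⟨h1, h2, -⟩
      · rcases H.high hy hky with h3 | ⟨h3, h4, h5, h6, h7⟩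
        · have hx' := H.pos_F fun h' => H.disjoint h1 h'
          have hy' := H.pos_F fun h' => H.disjoint h3 h'
          obtain ⟨a, ha, rfl⟩ := h1
          obtain ⟨b, hb, rfl⟩ := h3
          rw [hx', hy']
          refine H.fwd.placed_mono a b ?_ hb
          by_contra! hle
          rcases hle.eq_or_lt with rfl | hlt
          · omega
          · have := H.fwd.mono b a hlt ha; omega
        · rw [h4]
          by_cases hi : P y < i
          · rcases H.vertex_high h3.le (H.num.pos_le y hy) with ⟨z, hz, e⟩ | ⟨-, -, -, h8⟩
            · exact absurd (H.renumbered.inj (H.movedF hz).1 hy (e.trans h4.symm) ▸ hz) h6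
            · exact h8 hi x h1 hP (by rwa [h5])
          · have := H.up h1; omega
      · rw [h2]
        rcases H.high hy hky with h3 | ⟨h3, h4, -⟩
        · have := H.up h3; omega
        · omega
    · exact Or.inr (H.searched_of_high_low hx hy hG hkx (not_le.1 hky))
  · by_cases hky : k ≤ P' y
    · omega
    · left
      have hP : P x < P y := (H.order x y hx hy hG).resolve_right fun h => by
        have := H.up (H.listedF H.listed_w)
        rw [h.2] at hky
        omega
      rcases H.low hx (not_le.1 hkx) with h1 | ⟨h1, h2, h5, h6, h7⟩
      · rcases H.low hy (not_le.1 hky) with h3 | ⟨h3, h4, -⟩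
        · obtain ⟨a, ha, rfl⟩ := h1
          obtain ⟨b, hb, rfl⟩ := h3
          refine H.bwd.placed_anti b a ?_ ha
          by_contra! hle
          rcases hle.eq_or_lt with rfl | hlt
          · omega
          · have := H.bwd.anti a b hlt hb; omega
        · have := H.down h1; omega
      · rw [h2]
        rcases H.low hy (not_le.1 hky) with h3 | ⟨h3, h4, -⟩
        · by_cases hj : j ≤ P x
          · rcases H.vertex_low (H.num.pos_ge x hx) h1 with ⟨z, hz, e⟩ | ⟨-, -, -, h8⟩
            · exact absurd (H.renumbered.inj (H.movedB hz).1 hx (e.trans h2.symm) ▸ hz) h7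
            · exact h8 hj y h3 hP (by rwa [h5])
          · have := H.down h3; omega
        · omega

/-- `w` is the front of the queue and `k` the first vacancy. So `w` is the canonical vertex chosen
for a new component. -/
theorem pos_w (H : Reordered n N C V P G v w k tF tB F0 B0 V0 i TF F V1 P1 j TB B V' P') :
    P' w = k := by
  have hw := H.listedF H.listed_w
  have hup := H.up hw
  have hkN := H.search.k_le H.num
  have hC := H.renumbered.can_vertex k H.search.one_le hkN
  have hpv := H.renumbered.pos_vertex k H.search.one_le hkN
  rcases H.high hC hpv.ge with h | ⟨h1, h2, -⟩
  · have hx' := H.pos_F fun h' => H.disjoint h h'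
    have hy' := H.pos_F fun h' => H.disjoint hw h'
    obtain ⟨a, ha, e⟩ := h
    rcases Nat.eq_zero_or_pos a with rfl | h0
    · rw [H.fwd.orig 0 H.search.state.F_pos, H.search.state.F_zero] at e
      rw [← e] at hpv
      exact hpv
    · have h1 := H.fwd.placed_mono 0 a h0 ha
      rw [H.fwd.orig 0 H.search.state.F_pos, H.search.state.F_zero, e] at h1
      omega
  · omega

/-- Each element of the queue after the first, searched or lifted, has an arc from an earlier one.
-/
theorem reach_F (H : Reordered n N C V P G v w k tF tB F0 B0 V0 i TF F V1 P1 j TB B V' P') {x : ℕ}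
    (h : Listed TF F x) : Relation.ReflTransGen (fun x y => C x ∧ C y ∧ G x y) w x := by
  obtain ⟨t, ht, rfl⟩ := h
  induction t using Nat.strong_induction_on with
  | _ t ih =>
    by_cases hm : t < tF
    · rcases Nat.eq_zero_or_pos t with rfl | h0
      · rw [H.fwd.orig 0 hm, H.search.state.F_zero]
      · obtain ⟨t', h1, h2⟩ := H.search.state.F_pred t hm h0
        rw [← H.fwd.orig t hm, ← H.fwd.orig t' (h1.trans hm)] at h2
        exact (ih t' h1 (h1.trans ht)).tail ⟨H.fwd.can t' (h1.trans ht), H.fwd.can t ht, h2⟩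
    · obtain ⟨-, -, b, h1, h2⟩ := H.fwd.pulled t (not_lt.1 hm) ht
      exact (ih b h1 (h1.trans ht)).tail ⟨H.fwd.can b (h1.trans ht), H.fwd.can t ht, h2⟩

theorem reach_B (H : Reordered n N C V P G v w k tF tB F0 B0 V0 i TF F V1 P1 j TB B V' P') {x : ℕ}
    (h : Listed TB B x) : Relation.ReflTransGen (fun x y => C x ∧ C y ∧ G x y) x v := by
  obtain ⟨t, ht, rfl⟩ := h
  induction t using Nat.strong_induction_on with
  | _ t ih =>
    by_cases hm : t < tB
    · rcases Nat.eq_zero_or_pos t with rfl | h0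
      · rw [H.bwd.orig 0 hm, H.search.state.B_zero]
      · obtain ⟨t', h1, h2⟩ := H.search.state.B_pred t hm h0
        rw [← H.bwd.orig t hm, ← H.bwd.orig t' (h1.trans hm)] at h2
        exact (ih t' h1 (h1.trans ht)).head ⟨H.bwd.can t ht, H.bwd.can t' (h1.trans ht), h2⟩
    · obtain ⟨-, -, b, h1, h2⟩ := H.bwd.pulled t (not_lt.1 hm) ht
      exact (ih b h1 (h1.trans ht)).head ⟨H.bwd.can t ht, H.bwd.can b (h1.trans ht), h2⟩

/-- An element that changes its position upward is reached from one that changes it downward. -/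
theorem reach_of_cross (H : Reordered n N C V P G v w k tF tB F0 B0 V0 i TF F V1 P1 j TB B V' P')
    {x y : ℕ} (hx : C x) (hy : C y) (hPx : P x < P' x) (hPy : P' y < P y) :
    Relation.ReflTransGen (fun x y => C x ∧ C y ∧ G x y) y x := by
  have h1 : Listed TF F x := by
    by_contra h
    by_cases h' : Listed TB B x
    · have := H.down h'; omega
    · have := H.fixed hx h h'; omega
  have h2 : Listed TB B y := by
    by_contra h
    by_cases h' : Listed TF F y
    · have := H.up h'; omega
    · have := H.fixed hy h' h; omega
  exact ((H.reach_B h2).tail ⟨(H.searchedB H.listed_v).1, (H.searchedF H.listed_w).1,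
    H.new_arc⟩).trans (H.reach_F h1)

/-! ### Cycles through the new arc -/

section Cycle

variable {size : ℕ} {fd : ℕ → ℕ}

theorem reachIn_F (H : Reordered n N C V P G v w k tF tB F0 B0 V0 i TF F V1 P1 j TB B V' P')
    (hfd : ∀ x, Listed size fd x ↔ Listed tF F0 x ∨ Listed tB B0 x) {x : ℕ}
    (h : Listed tF F0 x) : ReachIn size fd G w x := by
  obtain ⟨t, ht, rfl⟩ := h
  induction t using Nat.strong_induction_on with
  | _ t ih =>
    rcases Nat.eq_zero_or_pos t with rfl | h0
    · rw [H.search.state.F_zero]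
      exact .refl
    · obtain ⟨t', h1, h2⟩ := H.search.state.F_pred t ht h0
      exact (ih t' h1 (h1.trans ht)).tail ⟨(hfd _).2 (Or.inl ⟨t', h1.trans ht, rfl⟩),
        (hfd _).2 (Or.inl ⟨t, ht, rfl⟩), h2⟩

theorem reachIn_B (H : Reordered n N C V P G v w k tF tB F0 B0 V0 i TF F V1 P1 j TB B V' P')
    (hfd : ∀ x, Listed size fd x ↔ Listed tF F0 x ∨ Listed tB B0 x) {x : ℕ}
    (h : Listed tB B0 x) : ReachIn size fd G x v := by
  obtain ⟨t, ht, rfl⟩ := h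
  induction t using Nat.strong_induction_on with
  | _ t ih =>
    rcases Nat.eq_zero_or_pos t with rfl | h0
    · rw [H.search.state.B_zero]
      exact .refl
    · obtain ⟨t', h1, h2⟩ := H.search.state.B_pred t ht h0
      exact (ih t' h1 (h1.trans ht)).head ⟨(hfd _).2 (Or.inr ⟨t, ht, rfl⟩),
        (hfd _).2 (Or.inr ⟨t', h1.trans ht, rfl⟩), h2⟩

/-- `x` is on a cycle through the new arc. -/
def OnCycle (size : ℕ) (fd : ℕ → ℕ) (G : ℕ → ℕ → Prop) (v w x : ℕ) : Prop :=
  ReachIn size fd G w x ∧ ReachIn size fd G x v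

theorem onCycle_of_arc (H : Reordered n N C V P G v w k tF tB F0 B0 V0 i TF F V1 P1 j TB B V' P')
    (hfd : ∀ x, Listed size fd x ↔ Listed tF F0 x ∨ Listed tB B0 x) {x y : ℕ}
    (hx : Listed tF F0 x) (hy : Listed tB B0 y) (hG : G x y) :
    OnCycle size fd G v w x ∧ OnCycle size fd G v w y := by
  have h1 := H.reachIn_F hfd hx
  have h2 := H.reachIn_B hfd hy
  have h3 : Listed size fd x ∧ Listed size fd y ∧ G x y :=
    ⟨(hfd _).2 (Or.inl hx), (hfd _).2 (Or.inr hy), hG⟩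
  exact ⟨⟨h1, h2.head h3⟩, ⟨h1.tail h3, h2⟩⟩

/-- Contracting the cycles to `w` at position `k` must not break outgoing arcs. A head below `k`
would either be in `B` and hence on a cycle, or contradict the old order; a head at `k` would be
`w`. -/
theorem lt_of_onCycle_left
    (H : Reordered n N C V P G v w k tF tB F0 B0 V0 i TF F V1 P1 j TB B V' P')
    (hfd : ∀ x, Listed size fd x ↔ Listed tF F0 x ∨ Listed tB B0 x) {x z : ℕ}
    (hxl : Listed size fd x) (hx : OnCycle size fd G v w x) (hz : ¬ OnCycle size fd G v w z)
    (hzw : z ≠ w) (hC : C z) (hG : G x z) : k < P' z := by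
  have hCx : C x := by
    rcases (hfd _).1 hxl with h | h
    · exact (H.searchedF h).1
    · exact (H.searchedB h).1
  have hP : P x < P z := (H.order x z hCx hC hG).resolve_right fun h => hzw h.2
  suffices h : k ≤ P' z by
    refine lt_of_le_of_ne h fun e => hzw ?_
    exact H.renumbered.inj hC (H.movedF (H.listedF H.listed_w)).1 (by rw [H.pos_w, e])
  by_contra! hk
  rcases (hfd _).1 hxl with h | h
  · have h1 := H.up (H.listedF h)
    have := H.searched_of_high_low hCx hC hG h1.1 hk
    exact hz (H.onCycle_of_arc hfd this.1 this.2 hG).2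
  · have h1 := H.searchedB h
    rcases H.low hC hk with h2 | h2
    · rcases (H.movedB h2).2 with h3 | h3
      · exact hz ⟨hx.1.tail ⟨hxl, (hfd _).2 (Or.inr h3), hG⟩, H.reachIn_B hfd h3⟩
      · omega
    · omega

/-- Dual statement for arcs entering a cycle: a tail at or above `k` would be a searched element of
`F` and hence itself on a cycle, or contradict the old order. -/
theorem lt_of_onCycle_right
    (H : Reordered n N C V P G v w k tF tB F0 B0 V0 i TF F V1 P1 j TB B V' P')
    (hfd : ∀ x, Listed size fd x ↔ Listed tF F0 x ∨ Listed tB B0 x) {x z : ℕ}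
    (hxl : Listed size fd x) (hx : OnCycle size fd G v w x) (hz : ¬ OnCycle size fd G v w z)
    (hzv : z ≠ v) (hC : C z) (hG : G z x) : P' z < k := by
  have hCx : C x := by
    rcases (hfd _).1 hxl with h | h
    · exact (H.searchedF h).1
    · exact (H.searchedB h).1
  have hP : P z < P x := (H.order z x hC hCx hG).resolve_right fun h => hzv h.1
  by_contra! hk
  rcases (hfd _).1 hxl with h | h
  · have h1 := H.searchedF h
    rcases H.high hC hk with h2 | h2
    · rcases (H.movedF h2).2 with h3 | h3
      · exact hz ⟨H.reachIn_F hfd h3, hx.2.head ⟨(hfd _).2 (Or.inl h3), hxl, hG⟩⟩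
      · omega
    · omega
  · have h1 := H.down (H.listedB h)
    have := H.searched_of_high_low hC hCx hG hk h1.2.1
    exact hz (H.onCycle_of_arc hfd this.1 this.2 hG).1

end Cycle

/-! ### Cost in terms of displacement -/

/-- The sum of the distances by which the elements of a list are moved. -/
theorem sum_range_le_sum {t : ℕ} {F g : ℕ → ℕ} {S : Finset ℕ}
    (hF : ∀ a < t, F a ∈ S) (hinj : ∀ a < t, ∀ b < t, F a = F b → a = b) :
    ∑ a ∈ Finset.range t, g (F a) ≤ ∑ x ∈ S, g x := by
  rw [← Finset.sum_image (s := Finset.range t) (g := F) (f := g)]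
  · refine Finset.sum_le_sum_of_subset fun x hx => ?_
    obtain ⟨a, ha, rfl⟩ := Finset.mem_image.1 hx
    exact hF a (Finset.mem_range.1 ha)
  · intro a ha b hb e
    simp only [Finset.coe_range, Set.mem_Iio] at ha hb
    exact hinj a ha b hb e

theorem injF (H : Reordered n N C V P G v w k tF tB F0 B0 V0 i TF F V1 P1 j TB B V' P') :
    ∀ a < TF, ∀ b < TF, F a = F b → a = b := by
  intro a ha b hb e
  rcases lt_trichotomy a b with h | h | h
  · have := H.fwd.mono a b h hb; rw [e] at this; omega
  · exact h
  · have := H.fwd.mono b a h ha; rw [e] at this; omega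

theorem injB (H : Reordered n N C V P G v w k tF tB F0 B0 V0 i TF F V1 P1 j TB B V' P') :
    ∀ a < TB, ∀ b < TB, B a = B b → a = b := by
  intro a ha b hb e
  rcases lt_trichotomy a b with h | h | h
  · have := H.bwd.anti a b h hb; rw [e] at this; omega
  · exact h
  · have := H.bwd.anti b a h ha; rw [e] at this; omega

/-- The total cost of the search and the reordering in terms of the displacement. -/
theorem cost_le (H : Reordered n N C V P G v w k tF tB F0 B0 V0 i TF F V1 P1 j TB B V' P')
    {S : Finset ℕ} (hS : ∀ x, x ∈ S ↔ C x)
    (hsum : ∑ x ∈ S, P x = ∑ x ∈ S, P' x) :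
    ∑ t ∈ Finset.range tF, (k - P (F0 t)) ≤ ∑ x ∈ S, (P' x - P x) ∧
    ∑ t ∈ Finset.range tB, (P (B0 t) - k) ≤ ∑ x ∈ S, (P' x - P x) ∧
    ∑ a ∈ Finset.range TF, (P1 (F a) + 1 - P (F a)) ≤ 2 * ∑ x ∈ S, (P' x - P x) ∧
    ∑ a ∈ Finset.range TB, (P (B a) + 1 - P' (B a)) ≤ 2 * ∑ x ∈ S, (P' x - P x) ∧
    (tF + tB) * (tF + tB) ≤ 6 * ∑ x ∈ S, (P' x - P x) := by
  -- Both numberings have the same sum, so the total upward and downward displacements agree.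
  have hD : ∑ x ∈ S, (P x - P' x) = ∑ x ∈ S, (P' x - P x) := by
    have h1 : ∑ x ∈ S, (P x - P' x) + ∑ x ∈ S, P' x = ∑ x ∈ S, (P' x - P x) + ∑ x ∈ S, P x := by
      rw [← Finset.sum_add_distrib, ← Finset.sum_add_distrib]
      exact Finset.sum_congr rfl fun x _ => by omega
    omega
  have hF : ∑ a ∈ Finset.range TF, (P' (F a) - P (F a)) ≤ ∑ x ∈ S, (P' x - P x) :=
    sum_range_le_sum (g := fun x => P' x - P x)
      (fun a ha => (hS _).2 (H.fwd.can a ha)) H.injF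
  have hB : ∑ a ∈ Finset.range TB, (P (B a) - P' (B a)) ≤ ∑ x ∈ S, (P' x - P x) := by
    rw [← hD]
    exact sum_range_le_sum (g := fun x => P x - P' x)
      (fun a ha => (hS _).2 (H.bwd.can a ha)) H.injB
  have hF0 : ∑ a ∈ Finset.range tF, (P' (F0 a) - P (F0 a)) ≤ ∑ x ∈ S, (P' x - P x) := by
    refine sum_range_le_sum (g := fun x => P' x - P x)
      (fun a ha => (hS _).2 (H.search.state.F_can a ha)) fun a ha b hb e => ?_
    rw [← H.fwd.orig a ha, ← H.fwd.orig b hb] at e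
    exact H.injF a (ha.trans_le H.fwd.m_le) b (hb.trans_le H.fwd.m_le) e
  have hB0 : ∑ a ∈ Finset.range tB, (P (B0 a) - P' (B0 a)) ≤ ∑ x ∈ S, (P' x - P x) := by
    rw [← hD]
    refine sum_range_le_sum (g := fun x => P x - P' x)
      (fun a ha => (hS _).2 (H.search.state.B_can a ha)) fun a ha b hb e => ?_
    rw [← H.bwd.orig a ha, ← H.bwd.orig b hb] at e
    exact H.injB a (ha.trans_le H.bwd.m_le) b (hb.trans_le H.bwd.m_le) e
  -- The new positions are distinct, increasing along the queue and at least `k`.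
  have hpF : ∀ a < tF, k + a ≤ P' (F0 a) ∧ P (F0 a) < P' (F0 a) := by
    intro a ha
    have h1 := H.up (H.listedF ⟨a, ha, rfl⟩)
    refine ⟨?_, h1.2.2.1⟩
    induction a with
    | zero => exact h1.1
    | succ a ih =>
      have h2 := H.up (H.listedF ⟨a, by omega, rfl⟩)
      have h3 := ih (by omega) h2
      have h4 := H.fwd.placed_mono a (a + 1) (by omega) (ha.trans_le H.fwd.m_le)
      rw [H.fwd.orig a (by omega), H.fwd.orig (a + 1) ha,
        ← H.pos_F fun h' => H.disjoint (H.listedF ⟨a, by omega, rfl⟩) h',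
        ← H.pos_F fun h' => H.disjoint (H.listedF ⟨a + 1, ha, rfl⟩) h'] at h4
      omega
  -- The old positions are increasing along the queue and end at `k` or before.
  have hqF : ∀ d, ∀ a < tF, tF = a + 1 + d → P (F0 a) + d ≤ k := by
    intro d
    induction d with
    | zero => intro a ha _; exact H.search.state.F_le a ha
    | succ d ih =>
      intro a ha e
      have h1 := ih (a + 1) (by omega) (by omega)
      have h2 := H.search.state.F_mono a (a + 1) (by omega) (by omega)
      omega
  have hpB : ∀ a < tB, P' (B0 a) + a + 1 ≤ k := by
    intro a ha
    have h1 := H.down (H.listedB ⟨a, ha, rfl⟩)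
    induction a with
    | zero => omega
    | succ a ih =>
      have h2 := H.down (H.listedB ⟨a, by omega, rfl⟩)
      have h3 := ih (by omega) h2
      have h4 := H.bwd.placed_anti a (a + 1) (by omega) (ha.trans_le H.bwd.m_le)
      rw [H.bwd.orig a (by omega), H.bwd.orig (a + 1) ha] at h4
      omega
  have hqB : ∀ d, ∀ a < tB, tB = a + 1 + d → k + d ≤ P (B0 a) := by
    intro d
    induction d with
    | zero => intro a ha _; exact H.search.state.B_ge a ha
    | succ d ih =>
      intro a ha e
      have h1 := ih (a + 1) (by omega) (by omega)
      have h2 := H.search.state.B_anti a (a + 1) (by omega) (by omega)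
      omega
  -- Each searched element of `F` moves by at least `tF - 1` and by at least 1, so twice its
  -- distance is at least `tF`.
  have hsF : tF * tF ≤ 2 * ∑ x ∈ S, (P' x - P x) := by
    calc tF * tF = ∑ a ∈ Finset.range tF, tF := by simp
      _ ≤ ∑ a ∈ Finset.range tF, 2 * (P' (F0 a) - P (F0 a)) := by
        refine Finset.sum_le_sum fun a ha => ?_
        have ha := Finset.mem_range.1 ha
        have h1 := hpF a ha
        have h2 := hqF (tF - a - 1) a ha (by omega)
        omega
      _ ≤ _ := by rw [← Finset.mul_sum]; omega
  -- On the backward side new positions are strictly below `k` and old ones at least `k`, so every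
  -- distance is at least `tB` and no factor is lost.
  have hsB : tB * tB ≤ ∑ x ∈ S, (P' x - P x) := by
    calc tB * tB = ∑ a ∈ Finset.range tB, tB := by simp
      _ ≤ ∑ a ∈ Finset.range tB, (P (B0 a) - P' (B0 a)) := by
        refine Finset.sum_le_sum fun a ha => ?_
        have ha := Finset.mem_range.1 ha
        have h1 := hpB a ha
        have h2 := hqB (tB - a - 1) a ha (by omega)
        omega
      _ ≤ _ := hB0
  refine ⟨le_trans (Finset.sum_le_sum fun a ha => ?_) hF0,
    le_trans (Finset.sum_le_sum fun a ha => ?_) hB0, ?_, ?_, ?_⟩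
  · have := hpF a (Finset.mem_range.1 ha); omega
  · have := hpB a (Finset.mem_range.1 ha); omega
  · refine le_trans (le_trans (Finset.sum_le_sum fun a ha => ?_)
      (Finset.mul_sum (Finset.range TF) (fun a => P' (F a) - P (F a)) 2).ge)
      (Nat.mul_le_mul_left 2 hF)
    have h1 : Listed TF F (F a) := ⟨a, Finset.mem_range.1 ha, rfl⟩
    have := H.up h1
    rw [H.pos_F fun h' => H.disjoint h1 h'] at *
    omega
  · refine le_trans (le_trans (Finset.sum_le_sum fun a ha => ?_)
      (Finset.mul_sum (Finset.range TB) (fun a => P (B a) - P' (B a)) 2).ge)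
      (Nat.mul_le_mul_left 2 hB)
    have := H.down ⟨a, Finset.mem_range.1 ha, rfl⟩
    omega
  -- The square of the sum is at most twice the sum of the squares, hence at most `2 * (2 + 1)`
  -- displacements.
  · nlinarith [sq_nonneg ((tF : ℤ) - tB)]

end Reordered

/-! ### Counting and summing over a numbering -/

namespace IsNumbering

variable {C : ℕ → Prop} {V P : ℕ → ℕ} {N : ℕ}

/-- The image does not depend on the numbering. Consequently any two numberings of the same set have
equal counts below each gap and equal sums. -/
theorem image_filter (h : IsNumbering C V P N) {S : Finset ℕ} (hS : ∀ x, x ∈ S ↔ C x) (g : ℕ) :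
    (S.filter fun x => P x ≤ g).image P = Finset.Icc 1 (min g N) := by
  ext l
  simp only [Finset.mem_image, Finset.mem_filter, hS, Finset.mem_Icc, le_min_iff]
  constructor
  · rintro ⟨x, ⟨hx, h1⟩, rfl⟩
    exact ⟨h.pos_ge x hx, h1, h.pos_le x hx⟩
  · rintro ⟨h1, h2, h3⟩
    have := h.pos_vertex l h1 h3
    exact ⟨V l, ⟨h.can_vertex l h1 h3, by omega⟩, this⟩

theorem injOn (h : IsNumbering C V P N) {S : Finset ℕ} (hS : ∀ x ∈ S, C x) :
    Set.InjOn P S := fun x hx y hy e => h.inj (hS x hx) (hS y hy) e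

theorem card_filter_le (h : IsNumbering C V P N) {S : Finset ℕ} (hS : ∀ x, x ∈ S ↔ C x) (g : ℕ) :
    (S.filter fun x => P x ≤ g).card = min g N := by
  rw [← Finset.card_image_of_injOn (h.injOn fun x hx => (hS x).1 (Finset.mem_filter.1 hx).1),
    h.image_filter hS]
  simp

theorem filter_eq_self (h : IsNumbering C V P N) {S : Finset ℕ} (hS : ∀ x, x ∈ S ↔ C x) :
    (S.filter fun x => P x ≤ N) = S :=
  Finset.filter_true_of_mem fun x hx => h.pos_le x ((hS x).1 hx)

theorem card_eq (h : IsNumbering C V P N) {S : Finset ℕ} (hS : ∀ x, x ∈ S ↔ C x) : S.card = N := by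
  rw [← h.filter_eq_self hS, h.card_filter_le hS, min_self]

theorem sum_eq (h : IsNumbering C V P N) {S : Finset ℕ} (hS : ∀ x, x ∈ S ↔ C x) :
    ∑ x ∈ S, P x = ∑ l ∈ Finset.Icc 1 N, l := by
  have h1 := h.image_filter hS N
  rw [h.filter_eq_self hS, min_self] at h1
  rw [← h1, Finset.sum_image]
  exact h.injOn fun x hx => (hS x).1 hx

end IsNumbering

/-! ### The invariant of the data structure -/

/-- The canonical elements. -/
def canonical (n : ℕ) (f : ℕ → ℕ) : Finset ℕ := (Finset.range n).filter fun x => f x = x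

theorem mem_canonical {n : ℕ} {f : ℕ → ℕ} {x : ℕ} : x ∈ canonical n f ↔ x < n ∧ f x = x := by
  simp [canonical]

/-- The memory `s` represents the strong components of the graph with the arcs `E`, and `f` gives
the canonical vertices. -/
structure Invariant (n : ℕ) (E : ℕ → ℕ → Prop) (s : Mem) (f : ℕ → ℕ) : Prop where
  sets : ∃ rt, s.Sets n f rt
  num : IsNumbering (fun x => x < n ∧ f x = x) (s.arr .vertex) (s.arr .position) (s.arr .count 0)
  adj : IsQuotientMatrix n E f s.adj
  topo : ∀ x < n, ∀ y < n, s.adj x y = 1 → s.arr .position x < s.arr .position y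
  reach_f : ∀ v < n, Relation.ReflTransGen E v (f v) ∧ Relation.ReflTransGen E (f v) v

theorem IsNumbering.le_of_canonical {n N : ℕ} {f V P : ℕ → ℕ}
    (h : IsNumbering (fun x => x < n ∧ f x = x) V P N) : N ≤ n := by
  rw [← h.card_eq (S := canonical n f) fun x => mem_canonical]
  exact (Finset.card_filter_le _ _).trans (Finset.card_range n).le

/-- An arc of the quotient is realized by a path. -/
theorem IsQuotientMatrix.reach {n : ℕ} {E : ℕ → ℕ → Prop} {f : ℕ → ℕ} {adj : ℕ → ℕ → ℕ}
    (h : IsQuotientMatrix n E f adj)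
    (hf : ∀ v < n, Relation.ReflTransGen E v (f v) ∧ Relation.ReflTransGen E (f v) v)
    (hE : ∀ a b, E a b → a < n ∧ b < n) {x y : ℕ} (hx : x < n) (hy : y < n) (hG : adj x y = 1) :
    Relation.ReflTransGen E x y := by
  obtain ⟨-, a, b, hab, rfl, rfl⟩ := (h x hx y hy).1 hG
  obtain ⟨ha, hb⟩ := hE a b hab
  exact ((hf a ha).2.tail hab).trans (hf b hb).1

namespace Invariant

variable {n : ℕ} {E : ℕ → ℕ → Prop} {s : Mem} {f : ℕ → ℕ}

theorem f_lt (h : Invariant n E s f) {v : ℕ} (hv : v < n) : f v < n :=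
  h.sets.choose_spec.f_lt v hv

theorem f_f (h : Invariant n E s f) {v : ℕ} (hv : v < n) : f (f v) = f v :=
  h.sets.choose_spec.f_f hv

/-- An arc stays within a class of `f` or goes to a later position. Applied in both directions, this
shows that `f` is constant on strong components. -/
theorem pos_le_of_reach (h : Invariant n E s f) (hE : ∀ a b, E a b → a < n ∧ b < n) {x y : ℕ}
    (hr : Relation.ReflTransGen E x y) : s.arr .position (f x) ≤ s.arr .position (f y) := by
  induction hr with
  | refl => exact le_rfl
  | @tail a b _ hab ih =>
    obtain ⟨ha, hb⟩ := hE a b hab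
    by_cases e : f a = f b
    · rw [← e]; exact ih
    · refine ih.trans (h.topo _ (h.f_lt ha) _ (h.f_lt hb) ?_).le
      exact (h.adj _ (h.f_lt ha) _ (h.f_lt hb)).2 ⟨e, a, b, hab, rfl, rfl⟩

theorem pos_lt_of_reach (h : Invariant n E s f) (hE : ∀ a b, E a b → a < n ∧ b < n) {x y : ℕ}
    (hx : x < n) (hy : y < n) (hr : Relation.ReflTransGen E x y) (hne : f x ≠ f y) :
    s.arr .position (f x) < s.arr .position (f y) :=
  lt_of_le_of_ne (h.pos_le_of_reach hE hr) fun e =>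
    hne (h.num.inj ⟨h.f_lt hx, h.f_f hx⟩ ⟨h.f_lt hy, h.f_f hy⟩ e)

end Invariant

theorem OrderStep.of_eq {n : ℕ} {can : Finset ℕ} {q q' : ℕ → ℕ} {reach' : ℕ → ℕ → Prop}
    (hn : ∀ x ∈ can, q x ≤ n) (hq : ∀ x ∈ can, q' x = q x) :
    OrderStep n can can ∅ q q q' reach' where
  sub := Finset.Subset.refl _
  mid_le := hn
  card_eq _ := rfl
  cross x _ y _ h := absurd h (lt_irrefl _)
  card_K := by simp
  shift x hx := by simp [hq x hx]

/-! ### Restoring the invariant after reordering -/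

namespace Reordered

variable {n N : ℕ} {f V P : ℕ → ℕ} {adj : ℕ → ℕ → ℕ} {v w k tF tB : ℕ}
  {F0 B0 V0 : ℕ → ℕ} {i TF : ℕ} {F V1 P1 : ℕ → ℕ} {j TB : ℕ} {B V' P' : ℕ → ℕ} {E : ℕ → ℕ → Prop}

theorem listed_lt (H : Reordered n N (fun x => x < n ∧ f x = x) V P (fun x y => adj x y = 1) v w
    k tF tB F0 B0 V0 i TF F V1 P1 j TB B V' P') {size : ℕ} {fd : ℕ → ℕ}
    (hfd : ∀ x, Listed size fd x ↔ Listed tF F0 x ∨ Listed tB B0 x) {x : ℕ}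
    (h : Listed size fd x) : x < n ∧ f x = x := by
  rcases (hfd x).1 h with h | h
  · exact (H.searchedF h).1
  · exact (H.searchedB h).1

/-- Two elements that cross each other are joined by a path through the new arc. Unless they were
merged, their new canonical vertices differ and the new topological order ranks them strictly;
merged pairs lie in `K`. -/
theorem orderStep (H : Reordered n N (fun x => x < n ∧ f x = x) V P (fun x y => adj x y = 1) v w
    k tF tB F0 B0 V0 i TF F V1 P1 j TB B V' P') (hadj : IsQuotientMatrix n E f adj)
    (hf : ∀ v < n, Relation.ReflTransGen E v (f v) ∧ Relation.ReflTransGen E (f v) v)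
    (hE : ∀ a b, E a b → a < n ∧ b < n) {s' : Mem} {f' : ℕ → ℕ} {R K : Finset ℕ}
    (hI : Invariant n E s' f') (hcan : canonical n f' = canonical n f \ R)
    (hR : R ⊆ canonical n f) (hK : K.card ≤ 2 * R.card)
    (hmer : ∀ x ∈ canonical n f, ∀ y ∈ canonical n f, x ≠ y → f' x = f' y → x ∈ K ∧ y ∈ K)
    (hshift : ∀ x ∈ canonical n f', s'.arr .position x ≤ P' x ∧
      P' x ≤ s'.arr .position x + R.card) :
    OrderStep n (canonical n f) (canonical n f') K (fun u => P (f u)) P'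
      (fun u => s'.arr .position (f' u)) (Relation.ReflTransGen E) := by
  have hN : N ≤ n := H.num.le_of_canonical
  have hG : ∀ x y, Relation.ReflTransGen
      (fun x y => (x < n ∧ f x = x) ∧ (y < n ∧ f y = y) ∧ adj x y = 1) x y →
      Relation.ReflTransGen E x y := by
    intro x y h
    induction h with
    | refl => exact .refl
    | tail _ h ih => exact ih.trans (hadj.reach hf hE h.1.1 h.2.1.1 h.2.2)
  have hd : canonical n f \ canonical n f' = R := by
    rw [hcan, Finset.sdiff_sdiff_eq_self hR]
  have hPf : ∀ x ∈ canonical n f, P (f x) = P x := fun x hx => by rw [(mem_canonical.1 hx).2]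
  refine ⟨hcan ▸ Finset.sdiff_subset, fun x hx => ?_, fun g => ?_, fun x hx y hy h1 h2 => ?_,
    by rw [hd]; exact hK, fun x hx => ?_⟩
  · exact (H.renumbered.pos_le x (mem_canonical.1 hx)).trans hN
  · rw [H.renumbered.card_filter_le (fun x => mem_canonical), ← H.num.card_filter_le
      (fun x => mem_canonical) g]
    congr 1
    exact Finset.filter_congr fun x hx => by rw [hPf x hx]
  · rw [hPf x hx] at h1
    rw [hPf y hy] at h2
    have hr : Relation.ReflTransGen E y x :=
      hG y x (H.reach_of_cross (mem_canonical.1 hx) (mem_canonical.1 hy) h1 h2)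
    refine ⟨hr, fun hK => hI.pos_lt_of_reach hE (mem_canonical.1 hy).1 (mem_canonical.1 hx).1 hr
      fun e => hK (hmer x hx y hy ?_ e.symm)⟩
    rintro rfl
    omega
  · rw [hd, (mem_canonical.1 hx).2]
    exact hshift x hx

theorem listed_of_onCycle (H : Reordered n N (fun x => x < n ∧ f x = x) V P
    (fun x y => adj x y = 1) v w k tF tB F0 B0 V0 i TF F V1 P1 j TB B V' P')
    {size : ℕ} {fd : ℕ → ℕ} (hfd : ∀ x, Listed size fd x ↔ Listed tF F0 x ∨ Listed tB B0 x) {x : ℕ}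
    (h : OnCycle size fd (fun x y => adj x y = 1) v w x) : Listed size fd x := by
  rcases Relation.ReflTransGen.cases_tail h.1 with e | ⟨y, -, h⟩
  · rw [e]
    exact (hfd w).2 (Or.inl H.listed_w)
  · exact h.2.1

/-- The only arcs that could point backwards lead from `F` to `B`, and any such arc would put `w` on
a cycle. -/
theorem invariant_of_acyclic (H : Reordered n N (fun x => x < n ∧ f x = x) V P
    (fun x y => adj x y = 1) v w k tF tB F0 B0 V0 i TF F V1 P1 j TB B V' P')
    (hadj : IsQuotientMatrix n E f adj)
    (hf : ∀ v < n, Relation.ReflTransGen E v (f v) ∧ Relation.ReflTransGen E (f v) v)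
    (hE : ∀ a b, E a b → a < n ∧ b < n)
    {size : ℕ} {fd : ℕ → ℕ} (hfd : ∀ x, Listed size fd x ↔ Listed tF F0 x ∨ Listed tB B0 x)
    (hcyc : ¬ OnCycle size fd (fun x y => adj x y = 1) v w w) {s : Mem} {rt : ℕ → ℕ}
    (hs : s.Sets n f rt) (hV : s.arr .vertex = V') (hP : s.arr .position = P')
    (hN : s.arr .count 0 = N) (hA : s.adj = adj) : Invariant n E s f := by
  subst hV hP hN hA
  refine ⟨⟨rt, hs⟩, H.renumbered, hadj, fun x hx y hy h => ?_, hf⟩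
  obtain ⟨-, a, b, hab, rfl, rfl⟩ := (hadj x hx y hy).1 h
  refine (H.lt_of_arc ⟨hx, hs.f_f (hE a b hab).1⟩ ⟨hy, hs.f_f (hE a b hab).2⟩ h).resolve_right
    fun h' => hcyc ?_
  have := (H.onCycle_of_arc hfd h'.1 h'.2 h).1
  exact ⟨.refl, this.1.trans this.2⟩

/-- A path from `x` to `v` continues along the new arc to `w`. -/
theorem reach_of_onCycle (H : Reordered n N (fun x => x < n ∧ f x = x) V P
    (fun x y => adj x y = 1) v w k tF tB F0 B0 V0 i TF F V1 P1 j TB B V' P')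
    (hadj : IsQuotientMatrix n E f adj)
    (hf : ∀ v < n, Relation.ReflTransGen E v (f v) ∧ Relation.ReflTransGen E (f v) v)
    (hE : ∀ a b, E a b → a < n ∧ b < n)
    {size : ℕ} {fd : ℕ → ℕ} (hfd : ∀ x, Listed size fd x ↔ Listed tF F0 x ∨ Listed tB B0 x) {x : ℕ}
    (h : OnCycle size fd (fun x y => adj x y = 1) v w x) :
    Relation.ReflTransGen E w x ∧ Relation.ReflTransGen E x w := by
  have hG : ∀ x y, ReachIn size fd (fun x y => adj x y = 1) x y → Relation.ReflTransGen E x y := by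
    intro x y h
    induction h with
    | refl => exact .refl
    | tail _ h ih =>
      exact ih.trans (hadj.reach hf hE (H.listed_lt hfd h.1).1 (H.listed_lt hfd h.2.1).1 h.2.2)
  exact ⟨hG _ _ h.1, (hG _ _ h.2).trans (hadj.reach hf hE (H.searchedB H.listed_v).1.1
    (H.searchedF H.listed_w).1.1 H.new_arc)⟩

/-- Arcs between two classes off the cycles keep their direction by `lt_of_arc`; for arcs leaving or
entering the merged class, position `k` of `w` separates the two ends. -/
theorem invariant_of_cyclic (H : Reordered n N (fun x => x < n ∧ f x = x) V P
    (fun x y => adj x y = 1) v w k tF tB F0 B0 V0 i TF F V1 P1 j TB B V' P')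
    (hadj : IsQuotientMatrix n E f adj)
    (hf : ∀ v < n, Relation.ReflTransGen E v (f v) ∧ Relation.ReflTransGen E (f v) v)
    (hff : ∀ v < n, f v < n ∧ f (f v) = f v)
    (hE : ∀ a b, E a b → a < n ∧ b < n)
    {size : ℕ} {fd : ℕ → ℕ} (hfd : ∀ x, Listed size fd x ↔ Listed tF F0 x ∨ Listed tB B0 x)
    (hcyc : OnCycle size fd (fun x y => adj x y = 1) v w w) {s : Mem} {rt : ℕ → ℕ} {R : Finset ℕ}
    (hR : ∀ x, x ∈ R ↔ OnCycle size fd (fun x y => adj x y = 1) v w x ∧ x ≠ w)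
    (hs : s.Sets n (merged R w f) rt)
    (hnum : IsNumbering (fun x => x < n ∧ merged R w f x = x) (s.arr .vertex) (s.arr .position)
      (s.arr .count 0))
    (hadj' : IsQuotientMatrix n E (merged R w f) s.adj)
    (hmono : ∀ x y, f x = x → x ∉ R → f y = y → y ∉ R → x < n → y < n → P' x < P' y →
      s.arr .position x < s.arr .position y) : Invariant n E s (merged R w f) := by
  obtain ⟨hwn, hfw⟩ := (H.searchedF H.listed_w).1
  have hvw : v ≠ w := by
    rintro rfl
    exact H.disjoint_search H.listed_w H.listed_v
  have hcv : OnCycle size fd (fun x y => adj x y = 1) v w v := ⟨hcyc.2, .refl⟩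
  have hwR : w ∉ R := fun h => ((hR w).1 h).2 rfl
  refine ⟨⟨rt, hs⟩, hnum, hadj', fun x hx y hy h => ?_, fun u hu => ?_⟩
  · obtain ⟨hne, a, b, hab, e1, e2⟩ := (hadj' x hx y hy).1 h
    obtain ⟨han, hbn⟩ := hE a b hab
    obtain ⟨hpn, hfp⟩ := hff a han
    obtain ⟨hqn, hfq⟩ := hff b hbn
    have hpq : f a ≠ f b := fun e => hne (by rw [← e1, ← e2, merged, merged, e])
    have hG : adj (f a) (f b) = 1 := (hadj _ hpn _ hqn).2 ⟨hpq, a, b, hab, rfl, rfl⟩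
    -- `R` omits `w`, which nevertheless already has the canonical value `w`.
    have hon : ∀ u, OnCycle size fd (fun x y => adj x y = 1) v w (f u) → merged R w f u = w := by
      intro u h
      unfold merged
      split_ifs with h'
      · rfl
      · by_contra h''
        exact h' ((hR _).2 ⟨h, h''⟩)
    have hoff : ∀ u, ¬ OnCycle size fd (fun x y => adj x y = 1) v w (f u) →
        merged R w f u = f u ∧ f u ∉ R := by
      intro u h
      have h' : f u ∉ R := fun h' => h ((hR _).1 h').1
      exact ⟨if_neg h', h'⟩
    by_cases hp : OnCycle size fd (fun x y => adj x y = 1) v w (f a)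
    · have hq : ¬ OnCycle size fd (fun x y => adj x y = 1) v w (f b) := fun hq =>
        hne (by rw [← e1, ← e2, hon a hp, hon b hq])
      have h1 := H.lt_of_onCycle_left hfd (H.listed_of_onCycle hfd hp) hp hq
        (fun e => hq (e ▸ hcyc)) ⟨hqn, hfq⟩ hG
      rw [← e1, ← e2, hon a hp, (hoff b hq).1]
      exact hmono _ _ hfw hwR hfq (hoff b hq).2 hwn hqn (by rwa [H.pos_w])
    · rw [← e1, ← e2, (hoff a hp).1]
      by_cases hq : OnCycle size fd (fun x y => adj x y = 1) v w (f b)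
      · have h1 := H.lt_of_onCycle_right hfd (H.listed_of_onCycle hfd hq) hq hp
          (fun e => hp (e ▸ hcv)) ⟨hpn, hfp⟩ hG
        rw [hon b hq]
        exact hmono _ _ hfp (hoff a hp).2 hfw hwR hpn hwn (by rwa [H.pos_w])
      · rw [(hoff b hq).1]
        refine hmono _ _ hfp (hoff a hp).2 hfq (hoff b hq).2 hpn hqn ?_
        refine (H.lt_of_arc ⟨hpn, hfp⟩ ⟨hqn, hfq⟩ hG).resolve_right fun h' => hp ?_
        exact (H.onCycle_of_arc hfd h'.1 h'.2 hG).1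
  · unfold merged
    obtain ⟨h1, h2⟩ := hf u hu
    split_ifs with h
    · obtain ⟨h3, h4⟩ := H.reach_of_onCycle hadj hf hE hfd ((hR _).1 h).1
      exact ⟨h1.trans h4, h3.trans h2⟩
    · exact ⟨h1, h2⟩

end Reordered

/-! ### The addition of an arc -/

theorem AgreeExcept.sets {A : Arr → Prop} {s s' : Mem} (h : AgreeExcept A s s') {n : ℕ}
    {f rt : ℕ → ℕ} (hs : s.Sets n f rt) (h1 : ¬ A .parent) (h2 : ¬ A .rank) (h3 : ¬ A .canon) :
    s'.Sets n f rt := by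
  unfold Mem.Sets at hs ⊢
  rwa [h.arr _ h1, h.arr _ h2, h.arr _ h3]

/-- The time bound separates the displacement from a charge of `O(n)` per deleted canonical vertex.
Here `mid` is the order after reordering and before deletion. -/
theorem wp_restoreOrder {s : Mem} {n v w : ℕ} {f rt : ℕ → ℕ} {E : ℕ → ℕ → Prop}
    (hs : s.Sets n f rt)
    (hnum : IsNumbering (fun x => x < n ∧ f x = x) (s.arr .vertex) (s.arr .position)
      (s.arr .count 0))
    (hadj : IsQuotientMatrix n E f s.adj)
    (horder : ∀ x y, x < n ∧ f x = x → y < n ∧ f y = y → s.adj x y = 1 →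
      s.arr .position x < s.arr .position y ∨ x = v ∧ y = w)
    (hf : ∀ v < n, Relation.ReflTransGen E v (f v) ∧ Relation.ReflTransGen E (f v) v)
    (hE : ∀ a b, E a b → a < n ∧ b < n) (hv : v < n ∧ f v = v) (hw : w < n ∧ f w = w)
    (hnew : s.adj v w = 1) (hlt : s.arr .position w < s.arr .position v) {Q : Unit → Mem → Prop}
    (hQ : ∀ s' f' mid K, Invariant n E s' f' →
      OrderStep n (canonical n f) (canonical n f') K (fun u => s.arr .position (f u)) mid
        (fun u => s'.arr .position (f' u)) (Relation.ReflTransGen E) →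
      s'.clock ≤ s.clock + 33 + 260 * ∑ x ∈ canonical n f, (mid x - s.arr .position (f x)) +
        40 * (n * (canonical n f \ canonical n f').card) → Q () s') :
    wp (do
      let (k, tF, tB) ← topologicalSearch n v w
      collect tF tB
      let new ← findComponent (tF + tB) v w
      reorderForward n k tF
      reorderBackward n k tB
      if new then
        let c ← read .vertex k
        formComponent n (tF + tB) c) Q s := by
  have hn : 0 < n := by omega
  rw [wp_bind]
  refine wp_topologicalSearch hnum hv hw hlt fun k tF tB s1 hSR hA1 hc1 => ?_
  simp only [wp_bind]
  refine wp_collect fun s2 hfF hfB h0 hA2 hc2 => ?_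
  have hfd : ∀ x, Listed (tF + tB) (s2.arr .found) x ↔
      Listed tF (s1.arr .fwd) x ∨ Listed tB (s1.arr .bwd) x := by
    intro x
    constructor
    · rintro ⟨t, ht, rfl⟩
      by_cases h : t < tF
      · exact Or.inl ⟨t, h, (hfF t h).symm⟩
      · refine Or.inr ⟨t - tF, by omega, ?_⟩
        rw [← hfB _ (by omega), Nat.add_sub_cancel' (not_lt.1 h)]
    · rintro (⟨t, ht, rfl⟩ | ⟨t, ht, rfl⟩)
      · exact ⟨t, by omega, hfF t ht⟩
      · exact ⟨tF + t, by omega, hfB t ht⟩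
  have hcan : ∀ x, Listed (tF + tB) (s2.arr .found) x → x < n ∧ f x = x := by
    intro x h
    rcases (hfd x).1 h with ⟨t, ht, rfl⟩ | ⟨t, ht, rfl⟩
    · exact hSR.state.F_can t ht
    · exact hSR.state.B_can t ht
  have hvw : v ≠ w := by rintro rfl; omega
  have hadj2 : s2.adj = s.adj := hA2.adj.trans hA1.adj
  refine wp_findComponent (P := s.arr .position) hvw
    ((hfd v).2 (Or.inr ⟨0, hSR.state.B_pos, hSR.state.B_zero⟩))
    ((hfd w).2 (Or.inl ⟨0, hSR.state.F_pos, hSR.state.F_zero⟩)) h0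
    (fun x z hx hz h => horder x z (hcan x hx) (hcan z hz) (by rwa [← hadj2])) ?_
  intro b s3 hb hmark hA3 hc3
  rw [hadj2] at hmark
  have hadj3 : s3.adj = s.adj := hA3.adj.trans hadj2
  have hvx3 : s3.arr .vertex = s1.arr .vertex :=
    (hA3.arr .vertex (by simp)).trans (hA2.arr .vertex (by simp))
  have hfw3 : s3.arr .fwd = s1.arr .fwd :=
    (hA3.arr .fwd (by simp)).trans (hA2.arr .fwd (by simp))
  have hbw3 : s3.arr .bwd = s1.arr .bwd :=
    (hA3.arr .bwd (by simp)).trans (hA2.arr .bwd (by simp))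
  have hps3 : s3.arr .position = s.arr .position :=
    ((hA3.arr .position (by simp)).trans (hA2.arr .position (by simp))).trans
      (hA1.arr .position (by simp))
  have hct3 : s3.arr .count = s.arr .count :=
    ((hA3.arr .count (by simp)).trans (hA2.arr .count (by simp))).trans (hA1.arr .count (by simp))
  have hfd3 : s3.arr .found = s2.arr .found := hA3.arr .found (by simp)
  have hs3 : s3.Sets n f rt := hA3.sets (hA2.sets (hA1.sets hs (by simp) (by simp) (by simp))
    (by simp) (by simp) (by simp)) (by simp) (by simp) (by simp)
  have hg := hSR.gapped hnum fun x hx => hx.1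
  refine wp_reorderForward (N := s.arr .count 0) (C := fun x => x < n ∧ f x = x)
    (P := s.arr .position) (by rwa [hvx3]) hSR.one_le (hSR.k_le hnum) (by rw [hvx3, hSR.vertex_k])
    hSR.state.F_pos (by rw [hfw3, hSR.state.F_zero]; exact hSR.pos_lt) (fun x _ => by rw [hps3])
    (by rw [hfw3]; exact hSR.state.F_can) (by rw [hfw3]; exact hSR.state.F_mono)
    (by rw [hfw3]; exact hSR.state.F_le)
    (by rw [hvx3]; exact hSR.nullCount_ge hnum fun x hx => hx.1) ?_
  intro s4 i TF hfwd hA4 hc4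
  rw [hvx3, hadj3, hfw3] at hfwd
  have hvx4 : ∀ l < k, s4.arr .vertex l = s1.arr .vertex l := hfwd.before
  have hbw4 : s4.arr .bwd = s1.arr .bwd := (hA4.arr .bwd (by simp)).trans hbw3
  have hkN := hSR.k_le hnum
  have hk1 := hSR.one_le
  refine wp_reorderBackward (C := fun x => x < n ∧ f x = x)
    (P := s.arr .position) ⟨hg.can_lt, hg.inj, fun l h1 h2 => ?_⟩ hSR.one_le
    (by rw [hbw4]; exact hSR.state.B_can) (by rw [hbw4]; exact hSR.state.B_anti)
    (by rw [hbw4]; exact hSR.state.B_ge) ?_ ?_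
  · rw [hvx4 l (by omega)]
    exact hg.spec l h1 (by omega)
  · rw [nullCount_congr fun l _ hl => hvx4 l (by omega)]
    exact hSR.nullCount_lt hnum fun x hx => hx.1
  intro s5 j TB hbwd hA5 hc5
  rw [hA4.adj, hadj3, hbw4] at hbwd
  have H : Reordered n (s.arr .count 0) (fun x => x < n ∧ f x = x) (s.arr .vertex)
      (s.arr .position) (fun x y => s.adj x y = 1) v w k tF tB (s1.arr .fwd) (s1.arr .bwd)
      (s1.arr .vertex) i TF (s4.arr .fwd) (s4.arr .vertex) (s4.arr .position) j TB
      (s5.arr .bwd) (s5.arr .vertex) (s5.arr .position) :=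
    ⟨hnum, fun x hx => hx.1, horder, hnew, hSR, hfwd, hbwd⟩
  have hadj5 : s5.adj = s.adj := (hA5.adj.trans hA4.adj).trans hadj3
  have hct5 : s5.arr .count = s.arr .count :=
    ((hA5.arr .count (by simp)).trans (hA4.arr .count (by simp))).trans hct3
  have hfd5 : s5.arr .found = s2.arr .found :=
    ((hA5.arr .found (by simp)).trans (hA4.arr .found (by simp))).trans hfd3
  have hmk5 : s5.arr .mark = s3.arr .mark :=
    (hA5.arr .mark (by simp)).trans (hA4.arr .mark (by simp))
  have hs5 : s5.Sets n f rt := hA5.sets (hA4.sets hs3 (by simp) (by simp) (by simp))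
    (by simp) (by simp) (by simp)
  obtain ⟨k1, k2, k3, k4, k5⟩ := H.cost_le (S := canonical n f) (fun x => mem_canonical)
    ((hnum.sum_eq fun x => mem_canonical).trans
      (H.renumbered.sum_eq fun x => mem_canonical).symm)
  have hD : ∑ x ∈ canonical n f, (s5.arr .position x - s.arr .position x) =
      ∑ x ∈ canonical n f, (s5.arr .position x - s.arr .position (f x)) :=
    Finset.sum_congr rfl fun x hx => by rw [(mem_canonical.1 hx).2]
  rw [hD] at k1 k2 k3 k4 k5
  set D := ∑ x ∈ canonical n f, (s5.arr .position x - s.arr .position (f x)) with hDdef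
  -- The coefficient `236` is made up of `20` for the search, `48` for listing the vertices, `120`
  -- for the depth-first search and `24` for each direction of the reordering.
  have hclock : s5.clock ≤ s.clock + 28 + 236 * D := by
    have h1 : tF + tB ≤ (tF + tB) * (tF + tB) := Nat.le_mul_self _
    omega
  have hsize : tF + tB ≤ 6 * D := (Nat.le_mul_self _).trans k5
  clear hc1 hc2 hc3 hc4 hc5 k1 k2 k3 k4 k5
  have hwL : Listed (tF + tB) (s2.arr .found) w := (hfd w).2 (Or.inl H.listed_w)
  have hb' : b = true ↔ Reordered.OnCycle (tF + tB) (s2.arr .found) (fun x y => s.adj x y = 1) v w w :=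
    hb.trans (hmark w hwL)
  refine wp_if (fun hbt => ?_) (fun hbt => ?_)
  · have hcyc := hb'.1 hbt
    simp only [wp_bind, wp_read]
    have hwP : s5.arr .vertex k = w := by
      rw [← H.pos_w]
      exact H.renumbered.vertex_pos w hw
    rw [hwP]
    refine wp_formComponent (s := ⟨s5.arr, s5.adj, s5.clock + 1⟩) (N := s.arr .count 0) (f := f) (rt := rt) (E := E) hs5 ?_ ?_ hw.1 hw.2
      (by rw [hct5]) H.renumbered (by rwa [hadj5]) ?_
    · intro t ht
      dsimp only
      rw [hfd5]
      exact hcan _ ⟨t, ht, rfl⟩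
    · intro t ht t' ht' e
      dsimp only at e
      rw [hfd5] at e
      have hinj : ∀ t < tF, ∀ t' < tB, s1.arr .fwd t ≠ s1.arr .bwd t' := fun t ht t' ht' e =>
        H.disjoint_search ⟨t, ht, rfl⟩ ⟨t', ht', e.symm⟩
      by_cases h : t < tF <;> by_cases h' : t' < tF
      · rw [hfF t h, hfF t' h', ← H.fwd.orig t h, ← H.fwd.orig t' h'] at e
        exact H.injF t (h.trans_le H.fwd.m_le) t' (h'.trans_le H.fwd.m_le) e
      · obtain ⟨u, rfl⟩ := Nat.exists_eq_add_of_le (not_lt.1 h')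
        rw [hfF t h, hfB u (by omega)] at e
        exact absurd e (hinj t h u (by omega))
      · obtain ⟨u, rfl⟩ := Nat.exists_eq_add_of_le (not_lt.1 h)
        rw [hfF t' h', hfB u (by omega)] at e
        exact absurd e.symm (hinj t' h' u (by omega))
      · obtain ⟨u, rfl⟩ := Nat.exists_eq_add_of_le (not_lt.1 h)
        obtain ⟨u', rfl⟩ := Nat.exists_eq_add_of_le (not_lt.1 h')
        have h1 : u < tB := by omega
        have h2 : u' < tB := by omega
        rw [hfB u h1, hfB u' h2, ← H.bwd.orig u h1, ← H.bwd.orig u' h2] at e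
        rw [H.injB u (h1.trans_le H.bwd.m_le) u' (h2.trans_le H.bwd.m_le) e]
    · intro s6 rt6 R hR hs6 hnum6 hadj6 hcan6 hmono6 hshift6 hc6
      dsimp only at hR hc6 hmono6 hshift6
      rw [hfd5, hmk5] at hR
      have hRm : ∀ x, x ∈ R ↔ Reordered.OnCycle (tF + tB) (s2.arr .found) (fun x y => s.adj x y = 1) v w x ∧
          x ≠ w := by
        intro x
        rw [hR, mem_absorbed]
        constructor
        · rintro ⟨h1, h2, h3⟩
          exact ⟨(hmark x h1).1 h2, h3⟩
        · rintro ⟨h1, h2⟩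
          have h3 := H.listed_of_onCycle hfd h1
          exact ⟨h3, (hmark x h3).2 h1, h2⟩
      clear hR
      have hI := H.invariant_of_cyclic hadj hf (fun v hv => ⟨hs.f_lt v hv, hs.f_f hv⟩) hE hfd hcyc
        hRm hs6 hnum6 hadj6 hmono6
      -- At least `v` loses its canonical role, so the single renumbering in time `O(n)` can be
      -- charged to a deletion.
      have hvR : v ∈ R := (hRm v).2 ⟨⟨hcyc.2, .refl⟩, hvw⟩
      have hwR : w ∉ R := fun h => ((hRm w).1 h).2 rfl
      have hR1 : 1 ≤ R.card := Finset.card_pos.2 ⟨v, hvR⟩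
      have hsub : R ⊆ canonical n f := fun x hx => mem_canonical.2
        (H.listed_lt hfd (H.listed_of_onCycle hfd ((hRm x).1 hx).1))
      have hcan' : canonical n (merged R w f) = canonical n f \ R := by
        ext x
        rw [Finset.mem_sdiff, mem_canonical, mem_canonical]
        constructor
        · rintro ⟨h1, h2⟩
          have := (hcan6 x h1).1 h2
          exact ⟨⟨h1, this.1⟩, this.2⟩
        · rintro ⟨⟨h1, h2⟩, h3⟩
          exact ⟨h1, (hcan6 x h1).2 ⟨h2, h3⟩⟩
      -- `K` is the merged class including `w`. As `R` is nonempty, one extra element at most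
      -- doubles its size.
      refine hQ s6 (merged R w f) (s5.arr .position) (insert w R) hI ?_ ?_
      · refine H.orderStep hadj hf hE hI hcan' hsub ?_ ?_ ?_
        · rw [Finset.card_insert_of_notMem hwR]
          omega
        · intro x hx y hy hxy e
          have hx' := (mem_canonical.1 hx).2
          have hy' := (mem_canonical.1 hy).2
          unfold merged at e
          rw [hx', hy'] at e
          split_ifs at e with h1 h2 h2
          · exact ⟨Finset.mem_insert_of_mem h1, Finset.mem_insert_of_mem h2⟩
          · exact ⟨Finset.mem_insert_of_mem h1, by rw [← e]; exact Finset.mem_insert_self _ _⟩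
          · exact ⟨by rw [e]; exact Finset.mem_insert_self _ _, Finset.mem_insert_of_mem h2⟩
          · exact absurd e hxy
        · intro x hx
          rw [hcan', Finset.mem_sdiff, mem_canonical] at hx
          exact hshift6 x hx.1.1 hx.1.2 hx.2
      · rw [hcan', Finset.sdiff_sdiff_eq_self hsub]
        have hNn : s.arr .count 0 ≤ n := hnum.le_of_canonical
        have hlog : Nat.log 2 n ≤ n := Nat.log_le_self 2 n
        have h1 : R.card * (7 * n + 10 * Nat.log 2 n + 13) ≤ R.card * (30 * n) :=
          Nat.mul_le_mul_left _ (by omega)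
        have h2 : R.card * (30 * n) = 30 * (n * R.card) := by ring
        have h3 : n ≤ n * R.card := Nat.le_mul_of_pos_right n hR1
        rw [← hDdef]
        omega
  · rw [wp_pure]
    have hI := H.invariant_of_acyclic hadj hf hE hfd (fun h => hbt (hb'.2 h)) hs5 rfl rfl
      (by rw [hct5]) hadj5
    refine hQ s5 f (s5.arr .position) ∅ hI (H.orderStep hadj hf hE hI (R := ∅) (by simp) (by simp)
      (by simp) (fun x hx y hy hxy e => ?_) (fun x _ => by simp)) ?_
    · rw [(mem_canonical.1 hx).2, (mem_canonical.1 hy).2] at e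
      exact absurd e hxy
    · rw [← hDdef]
      omega

/-- If both ends lie in one class or the arc agrees with the order, nothing moves and `K` is empty.
Otherwise the new matrix entry is the only one against the order, which is the situation of
`wp_restoreOrder`. -/
theorem wp_addArc {s : Mem} {n v w : ℕ} {f : ℕ → ℕ} {E E' : ℕ → ℕ → Prop}
    (hI : Invariant n E s f) (hE : ∀ a b, E a b → a < n ∧ b < n) (hv : v < n) (hw : w < n)
    (hE' : ∀ a b, E' a b ↔ E a b ∨ a = v ∧ b = w) {Q : Unit → Mem → Prop}
    (hQ : ∀ s' f' mid K, Invariant n E' s' f' →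
      OrderStep n (canonical n f) (canonical n f') K (fun u => s.arr .position (f u)) mid
        (fun u => s'.arr .position (f' u)) (Relation.ReflTransGen E') →
      s'.clock ≤ s.clock + (10 * Nat.log 2 n + 44) +
        260 * ∑ x ∈ canonical n f, (mid x - s.arr .position (f x)) +
        40 * (n * (canonical n f \ canonical n f').card) → Q () s') :
    wp (addArc n v w) Q s := by
  obtain ⟨⟨rt, hs⟩, hnum, hadj, htopo, hreach⟩ := hI
  have hE'n : ∀ a b, E' a b → a < n ∧ b < n := by
    intro a b h
    rcases (hE' a b).1 h with h | ⟨rfl, rfl⟩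
    · exact hE a b h
    · exact ⟨hv, hw⟩
  have hreach' : ∀ v < n, Relation.ReflTransGen E' v (f v) ∧ Relation.ReflTransGen E' (f v) v :=
    fun u hu => ⟨Relation.ReflTransGen.mono (fun a b h => (hE' a b).2 (Or.inl h)) _ _ (hreach u hu).1,
      Relation.ReflTransGen.mono (fun a b h => (hE' a b).2 (Or.inl h)) _ _ (hreach u hu).2⟩
  have hNn : s.arr .count 0 ≤ n := hnum.le_of_canonical
  have hstep : ∀ s' : Mem, s'.arr .position = s.arr .position →
      OrderStep n (canonical n f) (canonical n f) ∅ (fun u => s.arr .position (f u))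
        (fun u => s.arr .position (f u)) (fun u => s'.arr .position (f u))
        (Relation.ReflTransGen E') := fun s' h =>
    OrderStep.of_eq (fun x hx => by
      rw [(mem_canonical.1 hx).2]
      exact (hnum.pos_le x (mem_canonical.1 hx)).trans hNn) (fun x _ => by rw [h])
  have hvn := hs.f_lt v hv
  have hwn := hs.f_lt w hw
  have hfv := hs.f_f hv
  have hfw := hs.f_f hw
  simp only [addArc, wp_bind]
  refine wp_find hs hv fun s1 hs1 hA1 hc1 => ?_
  refine wp_find hs1 hw fun s2 hs2 hA2 hc2 => ?_
  have hA : AgreeExcept (· = .parent) s s2 := hA1.trans hA2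
  have hadj2 : s2.adj = s.adj := hA.adj
  have hps2 : s2.arr .position = s.arr .position := hA.arr _ (by simp)
  have hvx2 : s2.arr .vertex = s.arr .vertex := hA.arr _ (by simp)
  have hct2 : s2.arr .count = s.arr .count := hA.arr _ (by simp)
  refine wp_if (fun hne => ?_) (fun hne => ?_)
  · simp only [wp_bind, wp_writeAdj, wp_read]
    set A : ℕ → ℕ → ℕ := Function.update s2.adj (f v) (Function.update (s2.adj (f v)) (f w) 1)
      with hAdef
    have hA1 : ∀ a b, A a b = 1 ↔ s.adj a b = 1 ∨ a = f v ∧ b = f w := by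
      intro a b
      rw [hAdef, hadj2]
      by_cases ha : a = f v
      · subst ha
        rw [Function.update_self]
        by_cases hb : b = f w
        · simp [hb]
        · simp [hb]
      · simp [ha]
    have hAq : IsQuotientMatrix n E' f A := by
      intro a ha b hb
      rw [hA1, hadj a ha b hb]
      constructor
      · rintro (⟨h1, a', b', h2, h3⟩ | ⟨rfl, rfl⟩)
        · exact ⟨h1, a', b', (hE' _ _).2 (Or.inl h2), h3⟩
        · exact ⟨hne, v, w, (hE' _ _).2 (Or.inr ⟨rfl, rfl⟩), rfl, rfl⟩
      · rintro ⟨h1, a', b', h2, rfl, rfl⟩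
        rcases (hE' _ _).1 h2 with h2 | ⟨rfl, rfl⟩
        · exact Or.inl ⟨h1, a', b', h2, rfl, rfl⟩
        · exact Or.inr ⟨rfl, rfl⟩
    have hnum2 : IsNumbering (fun x => x < n ∧ f x = x) (s2.arr .vertex) (s2.arr .position)
        (s2.arr .count 0) := by
      rw [hvx2, hps2, hct2]; exact hnum
    refine wp_if (fun hlt => ?_) (fun hlt => ?_)
    · refine wp_restoreOrder (s := ⟨s2.arr, A, s2.clock + 1 + 1 + 1⟩) (E := E') (f := f) (rt := rt)
        hs2 hnum2 hAq (fun x y hx hy h => ?_) hreach' hE'n ⟨hvn, hfv⟩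
        ⟨hwn, hfw⟩ ((hA1 _ _).2 (Or.inr ⟨rfl, rfl⟩)) hlt ?_
      · rcases (hA1 _ _).1 h with h | h
        · left
          dsimp only
          rw [hps2]
          exact htopo x hx.1 y hy.1 h
        · exact Or.inr h
      · intro s' f' mid K h1 h2 h3
        dsimp only at h2 h3
        rw [hps2] at h2 h3
        exact hQ s' f' mid K h1 h2 (by omega)
    · rw [wp_pure]
      refine hQ _ f _ ∅ ⟨⟨_, hs2⟩, hnum2, hAq, fun x hx y hy h => ?_, hreach'⟩
        (hstep _ hps2) ?_
      · dsimp only at h hlt ⊢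
        rw [hps2] at hlt ⊢
        rcases (hA1 _ _).1 h with h | ⟨rfl, rfl⟩
        · exact htopo x hx y hy h
        · refine lt_of_le_of_ne (not_lt.1 hlt) fun e => hne ?_
          exact hnum.inj ⟨hvn, hfv⟩ ⟨hwn, hfw⟩ e
      · dsimp only; omega
  · rw [wp_pure]
    refine hQ s2 f _ ∅ ⟨⟨_, hs2⟩, ?_, ?_, ?_, hreach'⟩ (hstep s2 hps2) ?_
    · rw [hvx2, hps2, hct2]; exact hnum
    · rw [hadj2]
      intro a ha b hb
      rw [hadj a ha b hb]
      refine and_congr_right fun hab => ⟨?_, ?_⟩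
      · rintro ⟨a', b', h, e⟩
        exact ⟨a', b', (hE' _ _).2 (Or.inl h), e⟩
      · rintro ⟨a', b', h, rfl, rfl⟩
        rcases (hE' _ _).1 h with h | ⟨rfl, rfl⟩
        · exact ⟨a', b', h, rfl, rfl⟩
        · exact absurd (not_ne_iff.1 hne) hab
    · rw [hadj2, hps2]; exact htopo
    · omega

/-! ### Initialization -/

theorem wp_setup {s : Mem} {n : ℕ} (init : Equiv.Perm (Fin n)) {Q : Unit → Mem → Prop}
    (hQ : ∀ s', Invariant n (fun _ _ => False) s' (fun v => v) →
      s'.clock ≤ s.clock + (2 * (n * n) + 8 * n + 1) → Q () s') :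
    wp (setup n init) Q s := by
  simp only [setup, wp_bind]
  refine wp_forRange (fun i s' => (∀ x < i, ∀ y < n, s'.adj x y = 0) ∧
    s'.clock ≤ s.clock + i * (2 * n + 1)) ?_ ?_ ⟨fun x hx => absurd hx (by omega), by simp⟩
  · rintro i hi s' ⟨h1, h2⟩
    refine wp_forRange (fun j s'' => (∀ x < i, ∀ y < n, s''.adj x y = 0) ∧
      (∀ y < j, s''.adj i y = 0) ∧ s''.clock ≤ s.clock + i * (2 * n + 1) + 1 + 2 * j) ?_ ?_
      ⟨h1, fun y hy => absurd hy (by omega), by dsimp only; omega⟩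
    · rintro j hj s'' ⟨h3, h4, h5⟩
      rw [wp_writeAdj]
      refine ⟨fun x hx y hy => ?_, fun y hy => ?_, by dsimp only; omega⟩
      · dsimp only
        rw [Function.update_of_ne hx.ne]
        exact h3 x hx y hy
      · dsimp only
        rw [Function.update_self]
        by_cases e : y = j
        · rw [e, Function.update_self]
        · rw [Function.update_of_ne e]
          exact h4 y (by omega)
    · rintro s'' ⟨h3, h4, h5⟩
      refine ⟨fun x hx y hy => ?_, by rw [Nat.add_mul]; omega⟩
      rcases Nat.lt_succ_iff_lt_or_eq.1 hx with hx | rfl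
      · exact h3 x hx y hy
      · exact h4 y hy
  rintro s1 ⟨hadj, hc1⟩
  refine wp_forRange (fun i s' => (∀ x < i, s'.arr .parent x = x ∧ s'.arr .rank x = 0 ∧
    s'.arr .canon x = x) ∧ s'.adj = s1.adj ∧ s'.clock ≤ s1.clock + 4 * i) ?_ ?_
    ⟨fun x hx => absurd hx (by omega), rfl, by omega⟩
  · rintro i hi s' ⟨h1, h2, h3⟩
    simp only [wp_bind, wp_write]
    refine ⟨fun x hx => ?_, h2, by omega⟩
    simp [Function.update_of_ne]
    by_cases e : x = i
    · simp [e]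
    · rw [Function.update_of_ne e, Function.update_of_ne e, Function.update_of_ne e]
      exact h1 x (by omega)
  rintro s2 ⟨hds, hadj2, hc2⟩
  refine wp_forRange (fun i s' => (∀ l (h : l < n), l < i →
      s'.arr .vertex (l + 1) = init ⟨l, h⟩ ∧ s'.arr .position (init ⟨l, h⟩) = l + 1) ∧
    s'.arr .parent = s2.arr .parent ∧ s'.arr .rank = s2.arr .rank ∧
    s'.arr .canon = s2.arr .canon ∧ s'.adj = s1.adj ∧ s'.clock ≤ s2.clock + 3 * i) ?_ ?_
    ⟨fun l _ hl => absurd hl (by omega), rfl, rfl, rfl, hadj2, by omega⟩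
  · rintro i hi s' ⟨h1, h2, h3, h4, h5, h6⟩
    rw [dif_pos hi]
    simp only [wp_bind, wp_write]
    refine ⟨fun l hl hli => ?_, ?_, ?_, ?_, h5, by omega⟩
    · simp [Function.update_of_ne]
      by_cases e : l = i
      · subst e; simp
      · have hne : ((init ⟨l, hl⟩ : Fin n) : ℕ) ≠ init ⟨i, hi⟩ := fun h => by
          have := init.injective (Fin.ext h)
          simp only [Fin.mk.injEq] at this
          exact e this
        rw [Function.update_of_ne (by omega), Function.update_of_ne hne]
        exact h1 l hl (by omega)
    · simpa [Function.update_of_ne] using h2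
    · simpa [Function.update_of_ne] using h3
    · simpa [Function.update_of_ne] using h4
  rintro s3 ⟨hnum, hp, hr, hca, hadj3, hc3⟩
  rw [wp_write]
  refine hQ _ ⟨⟨fun v => v, ?_⟩, ?_, ?_, ?_, fun v _ => ⟨.refl, .refl⟩⟩ ?_
  · unfold Mem.Sets
    simp only [ne_eq, reduceCtorEq, not_false_eq_true, Function.update_of_ne]
    rw [hp, hr, hca]
    refine ⟨fun v hv => ?_, fun v hv => hv, fun v hv => ?_, fun v hv => ?_, fun v hv _ => rfl,
      fun v hv h => absurd (hds v hv).1 h, fun v hv => le_rfl, fun v hv => ?_,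
      fun v hv => (hds v hv).2.2, fun v hv => hv, fun v hv => rfl⟩
    · rw [(hds v hv).1]; exact hv
    · exact (hds v hv).1
    · exact (hds v hv).1
    · rw [(hds v hv).2.1, pow_zero]
      exact Finset.card_pos.2 ⟨v, by simp [hv]⟩
  · simp only [ne_eq, reduceCtorEq, not_false_eq_true, Function.update_of_ne,
      Function.update_self, and_true]
    have hpos : ∀ x (hx : x < n), s3.arr .position x = (init.symm ⟨x, hx⟩ : ℕ) + 1 ∧
        s3.arr .vertex ((init.symm ⟨x, hx⟩ : ℕ) + 1) = x := by
      intro x hx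
      have := hnum (init.symm ⟨x, hx⟩) (init.symm ⟨x, hx⟩).isLt (init.symm ⟨x, hx⟩).isLt
      simpa using this.symm
    refine ⟨fun x hx => ?_, fun x hx => ?_, fun x hx => ?_, fun i h1 h2 => ?_, fun i h1 h2 => ?_⟩
    · rw [(hpos x hx).1]; omega
    · rw [(hpos x hx).1]; omega
    · rw [(hpos x hx).1, (hpos x hx).2]
    · obtain ⟨l, rfl⟩ := Nat.exists_eq_add_of_le' h1
      rw [(hnum l (by omega) (by omega)).1]
      exact (init ⟨l, _⟩).isLt
    · obtain ⟨l, rfl⟩ := Nat.exists_eq_add_of_le' h1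
      rw [(hnum l (by omega) (by omega)).1, (hnum l (by omega) (by omega)).2]
  · intro a ha b hb
    dsimp only
    rw [hadj3, hadj a ha b hb]
    simp
  · intro x hx y hy h
    dsimp only at h
    rw [hadj3, hadj x hx y hy] at h
    exact absurd h (by norm_num)
  · dsimp only
    have : n * (2 * n + 1) = 2 * (n * n) + n := by ring
    omega

/-! ### From the invariant to the specification -/

/-- The arcs in a list, as a relation between numbers. -/
def ArcOf {n : ℕ} (arcs : List (Fin n × Fin n)) (a b : ℕ) : Prop :=
  ∃ p ∈ arcs, (p.1 : ℕ) = a ∧ (p.2 : ℕ) = b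

theorem ArcOf.lt {n : ℕ} {arcs : List (Fin n × Fin n)} {a b : ℕ} (h : ArcOf arcs a b) :
    a < n ∧ b < n := by
  obtain ⟨p, -, rfl, rfl⟩ := h
  exact ⟨p.1.isLt, p.2.isLt⟩

theorem reachable_iff {n : ℕ} {arcs : List (Fin n × Fin n)} {v w : Fin n} :
    Reachable arcs v w ↔ Relation.ReflTransGen (ArcOf arcs) v w := by
  constructor
  · intro h
    exact Relation.ReflTransGen.lift (fun v : Fin n => (v : ℕ)) (fun a b h => ⟨(a, b), h, rfl, rfl⟩)
      _ _ h
  · intro h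
    suffices ∀ b : ℕ, Relation.ReflTransGen (ArcOf arcs) v b →
        ∀ w : Fin n, (w : ℕ) = b → Reachable arcs v w from this w h w rfl
    intro b h
    induction h with
    | refl => intro w e; rw [Fin.ext e]; exact .refl
    | tail _ h ih =>
      obtain ⟨p, hp, rfl, rfl⟩ := h
      intro w e
      rw [Fin.ext e]
      exact (ih p.1 rfl).tail hp

theorem strongComponent_eq_iff {n : ℕ} {arcs : List (Fin n × Fin n)} {v w : Fin n} :
    strongComponent arcs v = strongComponent arcs w ↔ Reachable arcs v w ∧ Reachable arcs w v := by
  constructor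
  · intro h
    have : w ∈ strongComponent arcs v := by rw [h]; exact ⟨.refl, .refl⟩
    exact this
  · rintro ⟨h1, h2⟩
    ext x
    exact ⟨fun h => ⟨h2.trans h.1, h.2.trans h1⟩, fun h => ⟨h1.trans h.1, h.2.trans h2⟩⟩

theorem Invariant.represents {n : ℕ} {arcs : List (Fin n × Fin n)} {s : Mem} {f : ℕ → ℕ}
    (h : Invariant n (ArcOf arcs) s f) : Represents arcs s := by
  have hE : ∀ a b, ArcOf arcs a b → a < n ∧ b < n := fun a b h => h.lt
  have hC : ∀ v : Fin n, f v < n ∧ f (f v) = f v := fun v => ⟨h.f_lt v.isLt, h.f_f v.isLt⟩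
  have hf : ∀ v : Fin n, Reachable arcs v ⟨f v, h.f_lt v.isLt⟩ ∧
      Reachable arcs ⟨f v, h.f_lt v.isLt⟩ v := fun v => by
    rw [reachable_iff, reachable_iff]
    exact h.reach_f v v.isLt
  refine ⟨fun v => ⟨f v, h.f_lt v.isLt⟩, fun v => ?_, hf, fun v w e => ?_, fun v => ?_,
    fun i h1 h2 => ?_, fun v w ha => ?_⟩
  · obtain ⟨rt, hs⟩ := h.sets
    obtain ⟨⟨r, s'⟩, hr, rfl⟩ : wp (find v) (fun r _ => r = f v) s :=
      wp_find hs v.isLt fun _ _ _ _ => rfl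
    exact ⟨s', hr⟩
  · rw [strongComponent_eq_iff, reachable_iff, reachable_iff] at e
    -- Mutual reachability forces equal positions, hence equal canonical vertices.
    exact Fin.ext (h.num.inj (hC v) (hC w)
      (le_antisymm (h.pos_le_of_reach hE e.1) (h.pos_le_of_reach hE e.2)))
  · exact ⟨h.num.pos_ge _ (hC v), h.num.pos_le _ (hC v), h.num.vertex_pos _ (hC v)⟩
  · obtain ⟨h3, h4⟩ := h.num.can_vertex i h1 h2
    refine ⟨⟨_, h3⟩, h4.symm, ?_⟩
    dsimp only
    rw [h4, h.num.pos_vertex i h1 h2]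
  · obtain ⟨hne, x, hx, y, hy, hxy⟩ := ha
    have hvw : Reachable arcs v w := (hx.1.tail hxy).trans hy.2
    refine h.pos_lt_of_reach hE v.isLt w.isLt (reachable_iff.1 hvw) fun e => hne ?_
    have e' : (⟨f v, h.f_lt v.isLt⟩ : Fin n) = ⟨f w, h.f_lt w.isLt⟩ := Fin.ext e
    rw [strongComponent_eq_iff]
    exact ⟨hvw, (hf w).1.trans (e' ▸ (hf v).2)⟩

/-! ### The total time -/

/-- In the form `log n ≤ 2 * √n`, this puts the logarithmic cost of up to `n ^ 2` queries within `n
^ (5 / 2)`. -/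
theorem sq_log_le (n : ℕ) (hn : n ≠ 0) : Nat.log 2 n ^ 2 ≤ 4 * n := by
  set L := Nat.log 2 n
  have h1 : 2 ^ L ≤ n := Nat.pow_log_le_self 2 hn
  have h2 : L / 2 + 1 ≤ 2 ^ (L / 2) := Nat.lt_two_pow_self
  have h3 : L ≤ 2 * 2 ^ (L / 2) := by omega
  calc L ^ 2 ≤ (2 * 2 ^ (L / 2)) ^ 2 := Nat.pow_le_pow_left h3 2
    _ = 4 * 2 ^ (2 * (L / 2)) := by ring
    _ ≤ 4 * 2 ^ L := by
      gcongr
      · norm_num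
      · omega
    _ ≤ 4 * n := by omega

/-- The displacement contributes `260 * 16 = 4160`, and the remaining terms `11 + 64 + 40`, in units
of `n ^ 2 * √n`. -/
theorem cost_bound {n m L D c : ℕ} (hn : 1 ≤ n) (hm : m ≤ n * n) (hL : L ^ 2 ≤ 4 * n)
    (hD : Nat.sqrt n * D ≤ 8 * n ^ 3)
    (hc : c ≤ (2 * (n * n) + 8 * n + 1) + m * (10 * L + 44) + 260 * D + 40 * (n * n)) :
    (c : ℝ) ≤ 4300 * (n : ℝ) ^ (5 / 2 : ℝ) := by
  have hn' : (1 : ℝ) ≤ n := by exact_mod_cast hn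
  set r := Real.sqrt n with hr
  have hr1 : 1 ≤ r := Real.one_le_sqrt.2 hn'
  have hrr : r * r = n := Real.mul_self_sqrt (by linarith)
  have hpow : (n : ℝ) ^ (5 / 2 : ℝ) = n ^ 2 * r := by
    rw [show (5 / 2 : ℝ) = 2 + 1 / 2 by norm_num, Real.rpow_add (by linarith), hr,
      Real.sqrt_eq_rpow]
    norm_num
  have hLr : (L : ℝ) ≤ 2 * r := by
    refine le_of_sq_le_sq ?_ (by positivity)
    have : (L : ℝ) ^ 2 ≤ 4 * n := by exact_mod_cast hL
    nlinarith
  -- The integer square root is at least 1, so rounding down loses at most a factor 2.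
  have hT : r ≤ 2 * Nat.sqrt n := by
    have h1 : (n : ℝ) < (Nat.sqrt n + 1) * (Nat.sqrt n + 1) := by exact_mod_cast Nat.lt_succ_sqrt n
    have h2 : (1 : ℝ) ≤ Nat.sqrt n := by
      exact_mod_cast Nat.sqrt_pos.2 hn
    have h3 : r ≤ Nat.sqrt n + 1 := by
      refine le_of_sq_le_sq ?_ (by positivity)
      nlinarith
    linarith
  have hDr : (D : ℝ) ≤ 16 * (n ^ 2 * r) := by
    have h1 : (Nat.sqrt n : ℝ) * D ≤ 8 * n ^ 3 := by exact_mod_cast hD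
    have h2 : r * D ≤ 16 * n ^ 3 := by
      calc r * D ≤ 2 * Nat.sqrt n * D := by gcongr
        _ ≤ _ := by linarith
    refine le_of_mul_le_mul_left ?_ (by linarith : (0 : ℝ) < r)
    calc r * D ≤ 16 * (n : ℝ) ^ 3 := h2
      _ = 16 * n ^ 2 * (r * r) := by rw [hrr]; ring
      _ = _ := by ring
  have hmr : (m : ℝ) ≤ n * n := by exact_mod_cast hm
  have h1 : (m : ℝ) * (10 * L + 44) ≤ n * n * (10 * (2 * r) + 44) := by gcongr
  have h2 : (c : ℝ) ≤ (2 * (n * n) + 8 * n + 1) + m * (10 * L + 44) + 260 * D + 40 * (n * n) := by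
    exact_mod_cast hc
  have h3 : (n : ℝ) ≤ n * n := le_mul_of_one_le_left (by linarith) hn'
  have h4 : (n : ℝ) * n ≤ n ^ 2 * r := by
    rw [← sq]
    exact le_mul_of_one_le_right (by positivity) hr1
  rw [hpow]
  have h5 : (n : ℝ) * n * (10 * (2 * r) + 44) = 20 * (n ^ 2 * r) + 44 * (n * n) := by ring
  linarith

theorem exists_run {n : ℕ} (init : Equiv.Perm (Fin n)) (arcs : List (Fin n × Fin n)) (s₀ : Mem) :
    ∃ (s : ℕ → Mem) (f mid : ℕ → ℕ → ℕ) (K : ℕ → Finset ℕ),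
      ((), s 0) ∈ (setup n init).run s₀ ∧
      (s 0).clock ≤ s₀.clock + (2 * (n * n) + 8 * n + 1) ∧
      f 0 = (fun v => v) ∧
      (∀ k ≤ arcs.length, Invariant n (ArcOf (arcs.take k)) (s k) (f k)) ∧
      ∀ (k : ℕ) (hk : k < arcs.length),
        ((), s (k + 1)) ∈ (addArc n (arcs[k]).1 (arcs[k]).2).run (s k) ∧
        OrderStep n (canonical n (f k)) (canonical n (f (k + 1))) (K k)
          (fun u => (s k).arr .position (f k u)) (mid k)
          (fun u => (s (k + 1)).arr .position (f (k + 1) u))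
          (Relation.ReflTransGen (ArcOf (arcs.take (k + 1)))) ∧
        (s (k + 1)).clock ≤ (s k).clock + (10 * Nat.log 2 n + 44) +
          260 * ∑ x ∈ canonical n (f k), (mid k x - (s k).arr .position (f k x)) +
          40 * (n * (canonical n (f k) \ canonical n (f (k + 1))).card) := by
  obtain ⟨⟨⟨⟩, s0⟩, hr0, hI0, hc0⟩ : wp (setup n init) (fun _ s' =>
      Invariant n (fun _ _ => False) s' (fun v => v) ∧
      s'.clock ≤ s₀.clock + (2 * (n * n) + 8 * n + 1)) s₀ :=
    wp_setup init fun s' h1 h2 => ⟨h1, h2⟩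
  -- Stated for every index and every state, with the invariant as a hypothesis, so that `choose`
  -- yields a total successor function to iterate.
  have step : ∀ (k : ℕ) (st : Mem × (ℕ → ℕ)), ∃ (st' : Mem × (ℕ → ℕ)) (mid : ℕ → ℕ)
      (K : Finset ℕ), ∀ hk : k < arcs.length, Invariant n (ArcOf (arcs.take k)) st.1 st.2 →
        Invariant n (ArcOf (arcs.take (k + 1))) st'.1 st'.2 ∧
        ((), st'.1) ∈ (addArc n (arcs[k]).1 (arcs[k]).2).run st.1 ∧
        OrderStep n (canonical n st.2) (canonical n st'.2) K
          (fun u => st.1.arr .position (st.2 u)) mid (fun u => st'.1.arr .position (st'.2 u))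
          (Relation.ReflTransGen (ArcOf (arcs.take (k + 1)))) ∧
        st'.1.clock ≤ st.1.clock + (10 * Nat.log 2 n + 44) +
          260 * ∑ x ∈ canonical n st.2, (mid x - st.1.arr .position (st.2 x)) +
          40 * (n * (canonical n st.2 \ canonical n st'.2).card) := by
    intro k st
    by_cases h : ∃ hk : k < arcs.length, Invariant n (ArcOf (arcs.take k)) st.1 st.2
    · obtain ⟨hk, hI⟩ := h
      have hE' : ∀ a b, ArcOf (arcs.take (k + 1)) a b ↔
          ArcOf (arcs.take k) a b ∨ a = (arcs[k]).1 ∧ b = (arcs[k]).2 := by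
        intro a b
        unfold ArcOf
        rw [← List.take_concat_get' arcs k hk]
        constructor
        · rintro ⟨p, hp, h1, h2⟩
          rcases List.mem_append.1 hp with hp | hp
          · exact Or.inl ⟨p, hp, h1, h2⟩
          · rw [List.mem_singleton] at hp
            subst hp
            exact Or.inr ⟨h1.symm, h2.symm⟩
        · rintro (⟨p, hp, h1, h2⟩ | ⟨rfl, rfl⟩)
          · exact ⟨p, List.mem_append_left _ hp, h1, h2⟩
          · exact ⟨arcs[k], List.mem_append_right _ (List.mem_singleton.2 rfl), rfl, rfl⟩
      obtain ⟨⟨⟨⟩, s'⟩, hr, f', mid, K, h1, h2, h3⟩ : wp (addArc n (arcs[k]).1 (arcs[k]).2)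
          (fun _ s' => ∃ (f' mid : ℕ → ℕ) (K : Finset ℕ),
            Invariant n (ArcOf (arcs.take (k + 1))) s' f' ∧
            OrderStep n (canonical n st.2) (canonical n f') K
              (fun u => st.1.arr .position (st.2 u)) mid (fun u => s'.arr .position (f' u))
              (Relation.ReflTransGen (ArcOf (arcs.take (k + 1)))) ∧
            s'.clock ≤ st.1.clock + (10 * Nat.log 2 n + 44) +
              260 * ∑ x ∈ canonical n st.2, (mid x - st.1.arr .position (st.2 x)) +
              40 * (n * (canonical n st.2 \ canonical n f').card)) st.1 :=
        wp_addArc hI (fun a b h => h.lt) (arcs[k]).1.isLt (arcs[k]).2.isLt hE'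
          fun s' f' mid K h1 h2 h3 => ⟨f', mid, K, h1, h2, h3⟩
      exact ⟨(s', f'), mid, K, fun _ _ => ⟨h1, hr, h2, h3⟩⟩
    -- Default value where there is no arc to add or the invariant fails; nothing is claimed there.
    · exact ⟨st, id, ∅, fun hk hI => absurd ⟨hk, hI⟩ h⟩
  choose nxt mid K hnxt using step
  let st : ℕ → Mem × (ℕ → ℕ) := fun k => Nat.rec (s0, fun v => v) nxt k
  have hst : ∀ k, st (k + 1) = nxt k (st k) := fun k => rfl
  have hI : ∀ k ≤ arcs.length, Invariant n (ArcOf (arcs.take k)) (st k).1 (st k).2 := by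
    intro k
    induction k with
    | zero =>
      intro _
      have : ArcOf (arcs.take 0) = fun _ _ => False := by
        funext a b
        simp [ArcOf]
      rw [this]
      exact hI0
    | succ k ih =>
      intro hk
      rw [hst]
      exact (hnxt k (st k) hk (ih (by omega))).1
  refine ⟨fun k => (st k).1, fun k => (st k).2, fun k => mid k (st k), fun k => K k (st k), hr0,
    hc0, rfl, hI, fun k hk => ?_⟩
  obtain ⟨-, h2, h3, h4⟩ := hnxt k (st k) hk (hI k hk.le)
  exact ⟨h2, h3, h4⟩

theorem mainTheorem9 :
    ∃ C : ℝ, 0 < C ∧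
      ∀ (n : ℕ), 1 ≤ n →
      ∀ (init : Equiv.Perm (Fin n)) (arcs : List (Fin n × Fin n)), arcs.Nodup →
      ∀ s₀ : Mem, s₀.clock = 0 →
        ∃ s : ℕ → Mem,
          ((), s 0) ∈ (TopSearch.setup n init).run s₀ ∧
          (∀ (k : ℕ) (hk : k < arcs.length),
            ((), s (k + 1)) ∈ (TopSearch.addArc n (arcs[k]).1 (arcs[k]).2).run (s k)) ∧
          (∀ k ≤ arcs.length, Represents (arcs.take k) (s k)) ∧
          ((s arcs.length).clock : ℝ) ≤ C * (n : ℝ) ^ (5 / 2 : ℝ) := by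
  refine ⟨4300, by norm_num, fun n hn init arcs hnodup s₀ hs₀ => ?_⟩
  obtain ⟨s, f, mid, K, hr0, hc0, hf0, hI, hstep⟩ := exists_run init arcs s₀
  refine ⟨s, hr0, fun k hk => (hstep k hk).1, fun k hk => (hI k hk).represents, ?_⟩
  set m := arcs.length with hm
  -- Distinct arcs are distinct pairs of vertices.
  have hmn : m ≤ n * n := by
    simpa using hnodup.length_le_card
  have hE : ∀ k a b, ArcOf (arcs.take k) a b → a < n ∧ b < n := fun k a b h => h.lt
  -- Taking `T` to be the integer square root of `n` balances `n ^ 3 / T` from the potential against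
  -- `T * n ^ 2` from the close pairs.
  have hD := sum_displacement_le (n := n) (T := Nat.sqrt n) (m := m)
    (can := fun k => canonical n (f k)) (K := K) (q := fun k u => (s k).arr .position (f k u))
    (mid := mid) (reach := fun k => Relation.ReflTransGen (ArcOf (arcs.take k)))
    (Nat.sqrt_le n) (fun k _ x hx => (mem_canonical.1 hx).1)
    (fun k hk x hx => ((hI k hk).num.pos_le _ ⟨(hI k hk).f_lt hx, (hI k hk).f_f hx⟩).trans
      (hI k hk).num.le_of_canonical)
    (fun x hx y hy e => by
      have h := (hI 0 (Nat.zero_le _)).num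
      simp only [hf0] at h e
      exact h.inj ⟨hx, trivial⟩ ⟨hy, trivial⟩ e)
    (fun k y x h => Relation.ReflTransGen.mono (fun a b ⟨p, hp, hab⟩ =>
      ⟨p, (List.take_subset_take_left arcs (Nat.le_succ k)) hp, hab⟩) _ _ h)
    (fun k hk x hx y hy h => (hI k hk).pos_le_of_reach (hE k) h)
    (fun k hk => (hstep k hk).2.1)
  -- The number of canonical vertices serves as a second potential: each deletion releases the `40 *
  -- n` that it costs, and initially there are at most `n` of them.
  have hclock : ∀ k ≤ m, (s k).clock + 40 * (n * (canonical n (f k)).card) ≤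
      (2 * (n * n) + 8 * n + 1) + k * (10 * Nat.log 2 n + 44) +
      260 * ∑ l ∈ Finset.range k, ∑ x ∈ canonical n (f l),
        (mid l x - (s l).arr .position (f l x)) + 40 * (n * n) := by
    intro k
    induction k with
    | zero =>
      intro _
      have h1 : (canonical n (f 0)).card ≤ n :=
        (Finset.card_filter_le _ _).trans (Finset.card_range n).le
      have h2 := Nat.mul_le_mul_left n h1
      simp only [Finset.range_zero, Finset.sum_empty]
      omega
    | succ k ih =>
      intro hk
      obtain ⟨-, h1, h2⟩ := hstep k hk
      have h3 := ih (by omega)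
      have h4 : (canonical n (f k) \ canonical n (f (k + 1))).card +
          (canonical n (f (k + 1))).card = (canonical n (f k)).card :=
        Finset.card_sdiff_add_card_eq_card h1.sub
      rw [← h4, Nat.mul_add] at h3
      rw [Finset.sum_range_succ, Nat.add_mul]
      omega
  exact cost_bound hn hmn (sq_log_le n (by omega)) hD (by have := hclock m le_rfl; omega)
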